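/- Let $n\ge 2$ be an even integer and put $m=n/2$. Let $H=\mathcal K_n$ be the Nichols Hopf algebra: the complex Hopf algebra generated by $K,\xi_1,\dots,\xi_n$ with relations $K^2=1$, $\xi_i^2=0$, $K\xi_i=-\xi_iK$, $\xi_i\xi_j=-\xi_j\xi_i$, and with $\Delta(K)=K\otimes K$, $\Delta(\xi_i)=K\otimes\xi_i+\xi_i\otimes1$, $\epsilon(K)=1$, $\epsilon(\xi_i)=0$, antipode $s(K)=K$, $s(\xi_i)=-K\xi_i$. Let $W$ be the set of words $w=\xi_{i_1}\cdots\xi_{i_k}$ with $i_1<\dots<i_k$, and $|w|=k$; then $B=W\cup KW$ is a basis of $H$, with dual basis $(b^*)_{b\in B}$. Let $D\mathcal K_n=H^{*\mathrm{cop}}\bowtie H$ be the Drinfeld double: $H^*\otimes H$ with the product $(\phi\otimes h)(\phi'\otimes h')=\phi\,\phi'(s^{-1}(h_{(3)})\,\cdot\,h_{(1)})\otimes h_{(2)}h'$, containing the Hopf algebras $H^{*\mathrm{cop}}$ and $H$. Put $\bar K=1^*-K^*$, $\bar\xi_i=\xi_i^*+(K\xi_i)^*$, and $\bar w=\bar\xi_{i_1}\cdots\bar\xi_{i_k}$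 for $w=\xi_{i_1}\cdots\xi_{i_k}$. Consider $$R=\sum_{b\in B}b\otimes b^*,\qquad \nu=(1+K-\bar K+K\bar K)\sum_{w\in W}\tfrac{(-1)^{\lfloor(|w|+1)/2\rfloor}}2\,w\bar w,$$ $$\Lambda=\tfrac12(1+K+\bar K+K\bar K)\,\xi_1\cdots\xi_n\bar\xi_1\cdots\bar\xi_n,\qquad \lambda=2(\xi_1\cdots\xi_n\bar\xi_1\cdots\bar\xi_n)^*,$$ where $\lambda$ is written in the basis dual to $\{K^a\bar K^bw\bar w' : a,b\in\{0,1\},\,w,w'\in W\}$; it is the integral of $(D\mathcal K_n)^*$ with $\lambda(\Lambda)=1$. The Lyubashenko–Majid maps on $D\mathcal K_n$ are $$S_{LM}(x)=(\mathrm{id}\otimes\lambda)\bigl(R^{-1}(1\otimes x)R_{21}^{-1}\bigr),\qquad T_{LM}(x)=\nu x .$$ Let $Z$ be the center of $D\mathcal K_n$, let $\mathrm{Hig}(D\mathcal K_n)$ be the image of $x\mapsto\sum s(\Lambda_{(2)})\,x\,\Lambda_{(1)}K^{-1}$, and let $Z_\Lambda=\mathrm{span}\{(1+K\bar K)w\bar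 w' : w,w'\in W,\ |w|+|w'|\text{ even}\}$. Then: 1. $\left(\begin{smallmatrix}0&-1\\1&0\end{smallmatrix}\right)\mapsto(-1)^{m}S_{LM}|_Z$, $\left(\begin{smallmatrix}1&1\\0&1\end{smallmatrix}\right)\mapsto T_{LM}|_Z$ defines a linear representation of $\mathrm{SL}(2,\mathbb Z)$ on $Z$, and $Z=\mathrm{Hig}(D\mathcal K_n)\oplus Z_\Lambda$ as representations of $\mathrm{SL}(2,\mathbb Z)$. 2. $\mathrm{Hig}(D\mathcal K_n)\cong\mathbb C_{\mathrm{triv}}\oplus N_1$, where $N_1$ is the two-dimensional level-2 Weil representation. Explicitly, let $M=(\mathbb Z/2)^2$, $Q(x,y)=\tfrac12(x^2+xy+y^2)\in\mathbb Q/\mathbb Z$, $B(u,v)=Q(u+v)-Q(u)-Q(v)$ and $g_Q=\sum_{u\in M}e^{2\pi iQ(u)}$. On functions $f:M\to\mathbb C$ let $\left(\begin{smallmatrix}1&1\\0&1\end{smallmatrix}\right)$ act by $f(u)\mapsto e^{2\pi iQ(u)}f(u)$ and let $\left(\begin{smallmatrix}0&-1\\1&0\end{smallmatrix}\right)$ (which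 modulo 2 equals its inverse) act by $f(u)\mapsto\frac{g_Q}{|M|}\sum_{v\in M}e^{2\pi iB(u,v)}f(v)$; $N_1$ is the subrepresentation of functions invariant under $(x,y)\mapsto(y,x+y)$. 3. As a representation of $\mathrm{SL}(2,\mathbb Z)$, $$Z_\Lambda\;\cong\bigoplus_{\substack{0\le k\le n\\ k\text{ even}}}\binom nk2^{n-k}\,(\mathbb C^2_{\mathrm{std}})^{\otimes k},$$ where $\mathbb C^2_{\mathrm{std}}$ is the defining representation and $(\mathbb C^2_{\mathrm{std}})^{\otimes0}=\mathbb C_{\mathrm{triv}}$. -/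

import Mathlib

open scoped TensorProduct MatrixGroups

/-- Generators of the Nichols Hopf algebra. -/
inductive NicholsGen (n : ℕ) : Type
  | K : NicholsGen n
  | xi (i : Fin n) : NicholsGen n

open NicholsGen FreeAlgebra in
/-- Defining relations `K² = 1`, `ξ_i² = 0`, `K ξ_i = - ξ_i K`, `ξ_i ξ_j = - ξ_j ξ_i`. -/
inductive NicholsRel (n : ℕ) :
    FreeAlgebra ℂ (NicholsGen n) → FreeAlgebra ℂ (NicholsGen n) → Prop
  | K_sq : NicholsRel n (ι ℂ K * ι ℂ K) 1
  | xi_sq (i : Fin n) : NicholsRel n (ι ℂ (xi i) * ι ℂ (xi i)) 0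
  | K_xi (i : Fin n) : NicholsRel n (ι ℂ K * ι ℂ (xi i)) (-(ι ℂ (xi i) * ι ℂ K))
  | xi_xi (i j : Fin n) : NicholsRel n (ι ℂ (xi i) * ι ℂ (xi j)) (-(ι ℂ (xi j) * ι ℂ (xi i)))

/-- The Nichols Hopf algebra with generators `K, ξ₁, …, ξ_n`. -/
def Nichols (n : ℕ) : Type := RingQuot (NicholsRel n)

namespace Nichols

variable {n : ℕ}

noncomputable instance : Ring (Nichols n) := inferInstanceAs (Ring (RingQuot (NicholsRel n)))
noncomputable instance : Algebra ℂ (Nichols n) :=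
  inferInstanceAs (Algebra ℂ (RingQuot (NicholsRel n)))

/-- The group-like generator. -/
noncomputable def K : Nichols n :=
  RingQuot.mkAlgHom ℂ (NicholsRel n) (FreeAlgebra.ι ℂ NicholsGen.K)

/-- The odd generators. -/
noncomputable def xi (i : Fin n) : Nichols n :=
  RingQuot.mkAlgHom ℂ (NicholsRel n) (FreeAlgebra.ι ℂ (NicholsGen.xi i))

theorem K_mul_K : (K * K : Nichols n) = 1 := by
  have := RingQuot.mkAlgHom_rel ℂ (NicholsRel.K_sq (n := n))
  rw [map_mul, map_one] at this
  exact this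

theorem xi_mul_self (i : Fin n) : (xi i * xi i : Nichols n) = 0 := by
  have := RingQuot.mkAlgHom_rel ℂ (NicholsRel.xi_sq (n := n) i)
  rw [map_mul, map_zero] at this
  exact this

theorem K_mul_xi (i : Fin n) : (K * xi i : Nichols n) = -(xi i * K) := by
  have := RingQuot.mkAlgHom_rel ℂ (NicholsRel.K_xi (n := n) i)
  rw [map_mul, map_neg, map_mul] at this
  exact this

theorem xi_mul_xi (i j : Fin n) : (xi i * xi j : Nichols n) = -(xi j * xi i) := by
  have := RingQuot.mkAlgHom_rel ℂ (NicholsRel.xi_xi (n := n) i j)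
  rw [map_mul, map_neg, map_mul] at this
  exact this

/-- The universal property of the presentation. -/
noncomputable def lift {A : Type*} [Ring A] [Algebra ℂ A] (k : A) (x : Fin n → A)
    (hk : k * k = 1) (hx : ∀ i, x i * x i = 0) (hkx : ∀ i, k * x i = -(x i * k))
    (hxx : ∀ i j, x i * x j = -(x j * x i)) : Nichols n →ₐ[ℂ] A :=
  RingQuot.liftAlgHom ℂ (s := NicholsRel n)
    ⟨FreeAlgebra.lift ℂ (fun g => NicholsGen.casesOn g k x), by
      intro a b h
      cases h <;> simp [hk, hx, hkx]
      exact hxx _ _⟩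

section
variable {A : Type*} [Ring A] [Algebra ℂ A] (k : A) (x : Fin n → A)
    (hk : k * k = 1) (hx : ∀ i, x i * x i = 0) (hkx : ∀ i, k * x i = -(x i * k))
    (hxx : ∀ i j, x i * x j = -(x j * x i))

@[simp] theorem lift_K : lift k x hk hx hkx hxx K = k := by
  unfold lift K
  erw [RingQuot.liftAlgHom_mkAlgHom_apply]
  simp

@[simp] theorem lift_xi (i : Fin n) : lift k x hk hx hkx hxx (xi i) = x i := by
  unfold lift xi
  erw [RingQuot.liftAlgHom_mkAlgHom_apply]
  simp
end

theorem adjoin_eq_top :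
    Algebra.adjoin ℂ (insert K (Set.range xi) : Set (Nichols n)) = ⊤ := by
  rw [eq_top_iff]
  rintro a -
  obtain ⟨b, rfl⟩ := RingQuot.mkAlgHom_surjective ℂ (NicholsRel n) a
  induction b using FreeAlgebra.induction with
  | grade0 r => 
    rw [AlgHom.commutes]
    exact Subalgebra.algebraMap_mem _ r
  | grade1 g =>
    apply Algebra.subset_adjoin
    cases g with
    | K => exact Set.mem_insert _ _
    | xi i => exact Set.mem_insert_of_mem _ ⟨i, rfl⟩
  | mul a b ha hb => rw [map_mul]; exact mul_mem ha hb
  | add a b ha hb => rw [map_add]; exact add_mem ha hb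

@[elab_as_elim]
theorem induct {P : Nichols n → Prop} (a : Nichols n) (hK : P K) (hxi : ∀ i, P (xi i))
    (halg : ∀ r : ℂ, P (algebraMap ℂ _ r)) (hadd : ∀ a b, P a → P b → P (a + b))
    (hmul : ∀ a b, P a → P b → P (a * b)) : P a := by
  have h : a ∈ Algebra.adjoin ℂ (insert K (Set.range xi) : Set (Nichols n)) := by
    rw [adjoin_eq_top]; trivial
  induction h using Algebra.adjoin_induction with
  | mem x hx =>
    rcases hx with rfl | ⟨i, rfl⟩
    · exact hK
    · exact hxi i
  | algebraMap r => exact halg r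
  | add x y _ _ hx hy => exact hadd _ _ hx hy
  | mul x y _ _ hx hy => exact hmul _ _ hx hy

theorem algHom_ext {A : Type*} [Semiring A] [Algebra ℂ A] {f g : Nichols n →ₐ[ℂ] A}
    (hK : f K = g K) (hxi : ∀ i, f (xi i) = g (xi i)) : f = g := by
  ext a
  induction a using induct with
  | hK => exact hK
  | hxi i => exact hxi i
  | halg r => simp
  | hadd a b ha hb => simp [ha, hb]
  | hmul a b ha hb => simp [ha, hb]

/-- The comultiplication: `Δ(K) = K ⊗ K` and `Δ(ξ_i) = K ⊗ ξ_i + ξ_i ⊗ 1`. -/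
noncomputable def comulHom : Nichols n →ₐ[ℂ] Nichols n ⊗[ℂ] Nichols n :=
  lift (K ⊗ₜ K) (fun i => K ⊗ₜ xi i + xi i ⊗ₜ 1)
    (by simp [K_mul_K, Algebra.TensorProduct.one_def])
    (fun i => by simp [mul_add, add_mul, K_mul_K, xi_mul_self, K_mul_xi, TensorProduct.neg_tmul])
    (fun i => by
      simp [mul_add, add_mul, K_mul_K, K_mul_xi, TensorProduct.neg_tmul, TensorProduct.tmul_neg]
      abel)
    (fun i j => by
      simp only [mul_add, add_mul, K_mul_K, K_mul_xi, TensorProduct.neg_tmul,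
        Algebra.TensorProduct.tmul_mul_tmul, mul_one, one_mul]
      rw [xi_mul_xi j i]
      simp only [TensorProduct.neg_tmul, TensorProduct.tmul_neg]
      abel)

/-- The counit: `ε(K) = 1` and `ε(ξ_i) = 0`. -/
noncomputable def counitHom : Nichols n →ₐ[ℂ] ℂ :=
  lift 1 (fun _ => 0) (by simp) (by simp) (by simp) (by simp)

noncomputable instance : Bialgebra ℂ (Nichols n) :=
  Bialgebra.ofAlgHom comulHom counitHom
    (algHom_ext (by simp [comulHom]) (fun i => by
      simp [comulHom, TensorProduct.add_tmul, TensorProduct.tmul_add, Algebra.TensorProduct.one_def]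
      abel))
    (algHom_ext (by simp [comulHom, counitHom]) (fun i => by simp [comulHom, counitHom]))
    (algHom_ext (by simp [comulHom, counitHom]) (fun i => by simp [comulHom, counitHom]))

theorem comul_K : Coalgebra.comul (R := ℂ) (K : Nichols n) = K ⊗ₜ K := lift_K ..
theorem comul_xi (i : Fin n) :
    Coalgebra.comul (R := ℂ) (xi i : Nichols n) = K ⊗ₜ xi i + xi i ⊗ₜ 1 := lift_xi ..
theorem counit_K : Coalgebra.counit (R := ℂ) (K : Nichols n) = 1 := lift_K ..
theorem counit_xi (i : Fin n) : Coalgebra.counit (R := ℂ) (xi i : Nichols n) = 0 := lift_xi ..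

open MulOpposite in
/-- The antipode, as an algebra map to the opposite algebra: `S(K) = K`, `S(ξ_i) = - K ξ_i`. -/
noncomputable def antipodeHom : Nichols n →ₐ[ℂ] (Nichols n)ᵐᵒᵖ :=
  lift (op K) (fun i => op (-(K * xi i)))
    (by rw [← op_mul, K_mul_K, op_one])
    (fun i => by
      rw [← op_mul, neg_mul_neg, ← mul_assoc, mul_assoc K, ← neg_eq_iff_eq_neg.mpr (K_mul_xi i)]
      simp [mul_assoc, xi_mul_self])
    (fun i => by
      rw [← op_mul, ← op_mul, ← op_neg]
      congr 1
      simp only [neg_mul, mul_neg, neg_neg]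
      rw [← mul_assoc, K_mul_K, mul_assoc, ← neg_eq_iff_eq_neg.mpr (K_mul_xi i), mul_neg,
        ← mul_assoc, K_mul_K, neg_neg])
    (fun i j => by
      rw [← op_mul, ← op_mul, ← op_neg]
      congr 1
      have h : ∀ i j : Fin n, (K * xi i) * (K * xi j) = -(xi i * xi j : Nichols n) := by
        intro i j
        rw [mul_assoc, ← mul_assoc (xi i), ← neg_eq_iff_eq_neg.mpr (K_mul_xi i)]
        simp only [neg_mul, mul_neg]
        rw [mul_assoc, ← mul_assoc, K_mul_K, one_mul]
      simp only [neg_mul_neg, h]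
      rw [xi_mul_xi j i])

open MulOpposite in
/-- The inverse of the antipode, as an algebra map to the opposite algebra: `S⁻¹(K) = K`,
`S⁻¹(ξ_i) = K ξ_i`. -/
noncomputable def antipodeInvHom : Nichols n →ₐ[ℂ] (Nichols n)ᵐᵒᵖ :=
  lift (op K) (fun i => op (K * xi i))
    (by rw [← op_mul, K_mul_K, op_one])
    (fun i => by
      rw [← op_mul, ← mul_assoc, mul_assoc K, ← neg_eq_iff_eq_neg.mpr (K_mul_xi i)]
      simp [mul_assoc, xi_mul_self])
    (fun i => by
      rw [← op_mul, ← op_mul, ← op_neg]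
      congr 1
      rw [← mul_assoc, K_mul_K, mul_assoc, ← neg_eq_iff_eq_neg.mpr (K_mul_xi i), mul_neg,
        ← mul_assoc, K_mul_K])
    (fun i j => by
      rw [← op_mul, ← op_mul, ← op_neg]
      congr 1
      have h : ∀ i j : Fin n, (K * xi i) * (K * xi j) = -(xi i * xi j : Nichols n) := by
        intro i j
        rw [mul_assoc, ← mul_assoc (xi i), ← neg_eq_iff_eq_neg.mpr (K_mul_xi i)]
        simp only [neg_mul, mul_neg]
        rw [mul_assoc, ← mul_assoc, K_mul_K, one_mul]
      simp only [h]
      rw [xi_mul_xi j i])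

/-- The antipode, as a linear map. -/
noncomputable def antipodeLin : Nichols n →ₗ[ℂ] Nichols n :=
  (MulOpposite.opLinearEquiv ℂ).symm.toLinearMap ∘ₗ antipodeHom.toLinearMap

/-- The inverse of the antipode, as a linear map. -/
noncomputable def antipodeInv : Nichols n →ₗ[ℂ] Nichols n :=
  (MulOpposite.opLinearEquiv ℂ).symm.toLinearMap ∘ₗ antipodeInvHom.toLinearMap

theorem antipodeLin_mul (a b : Nichols n) :
    antipodeLin (a * b) = antipodeLin b * antipodeLin a := by simp [antipodeLin]
theorem antipodeLin_K : antipodeLin (K : Nichols n) = K := by simp [antipodeLin, antipodeHom]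
theorem antipodeLin_xi (i : Fin n) : antipodeLin (xi i : Nichols n) = -(K * xi i) := by
  simp [antipodeLin, antipodeHom]
theorem antipodeLin_algebraMap (r : ℂ) :
    antipodeLin (algebraMap ℂ (Nichols n) r) = algebraMap ℂ _ r := by
  simp [antipodeLin]
theorem antipodeInv_mul (a b : Nichols n) :
    antipodeInv (a * b) = antipodeInv b * antipodeInv a := by simp [antipodeInv]
theorem antipodeInv_K : antipodeInv (K : Nichols n) = K := by simp [antipodeInv, antipodeInvHom]
theorem antipodeInv_xi (i : Fin n) : antipodeInv (xi i : Nichols n) = K * xi i := by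
  simp [antipodeInv, antipodeInvHom]
theorem antipodeInv_algebraMap (r : ℂ) :
    antipodeInv (algebraMap ℂ (Nichols n) r) = algebraMap ℂ _ r := by
  simp [antipodeInv]

theorem antipodeInv_antipode (a : Nichols n) : antipodeInv (antipodeLin a) = a := by
  induction a using induct with
  | hK => rw [antipodeLin_K, antipodeInv_K]
  | hxi i =>
    rw [antipodeLin_xi, map_neg, antipodeInv_mul, antipodeInv_K, antipodeInv_xi, mul_assoc,
      ← neg_eq_iff_eq_neg.mpr (K_mul_xi i), mul_neg, ← mul_assoc, K_mul_K, neg_neg, one_mul]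
  | halg r => rw [antipodeLin_algebraMap, antipodeInv_algebraMap]
  | hadd a b ha hb => rw [map_add, map_add, ha, hb]
  | hmul a b ha hb => rw [antipodeLin_mul, antipodeInv_mul, ha, hb]

theorem antipode_antipodeInv (a : Nichols n) : antipodeLin (antipodeInv a) = a := by
  induction a using induct with
  | hK => rw [antipodeInv_K, antipodeLin_K]
  | hxi i =>
    rw [antipodeInv_xi, antipodeLin_mul, antipodeLin_K, antipodeLin_xi, neg_mul, mul_assoc,
      ← neg_eq_iff_eq_neg.mpr (K_mul_xi i), mul_neg, ← mul_assoc, K_mul_K, neg_neg, one_mul]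
  | halg r => rw [antipodeInv_algebraMap, antipodeLin_algebraMap]
  | hadd a b ha hb => rw [map_add, map_add, ha, hb]
  | hmul a b ha hb => rw [antipodeInv_mul, antipodeLin_mul, ha, hb]

theorem antipode_left_aux (a : Nichols n) : LinearMap.mul' ℂ (Nichols n)
    (antipodeLin.rTensor (Nichols n) (Coalgebra.comul a)) =
      algebraMap ℂ (Nichols n) (Coalgebra.counit a) := by
  induction a using induct with
  | hK => simp [comul_K, counit_K, antipodeLin_K, K_mul_K]
  | hxi i => simp [comul_xi, counit_xi, antipodeLin_K, antipodeLin_xi]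
  | halg r =>
    rw [Bialgebra.comul_algebraMap, Bialgebra.counit_algebraMap]
    simp only [Algebra.TensorProduct.algebraMap_apply, LinearMap.rTensor_tmul,
      LinearMap.mul'_apply, mul_one, antipodeLin_algebraMap]
  | hadd a b ha hb => simp only [map_add, ha, hb]
  | hmul a b ha hb =>
    rw [Bialgebra.comul_mul, Bialgebra.counit_mul, RingHom.map_mul, ← hb]
    have key : ∀ (u v : Nichols n ⊗[ℂ] Nichols n) (c : ℂ),
        LinearMap.mul' ℂ (Nichols n) (antipodeLin.rTensor (Nichols n) u) = algebraMap ℂ _ c →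
        LinearMap.mul' ℂ (Nichols n) (antipodeLin.rTensor (Nichols n) (u * v)) =
          algebraMap ℂ _ c *
            LinearMap.mul' ℂ (Nichols n) (antipodeLin.rTensor (Nichols n) v) := by
      intro u v c hu
      rw [← hu]
      induction v with
      | zero => simp
      | add v w hv hw => simp only [mul_add, map_add, hv, hw]
      | tmul x y =>
        have h2 : ∀ u : Nichols n ⊗[ℂ] Nichols n,
            LinearMap.mul' ℂ (Nichols n) (antipodeLin.rTensor (Nichols n) (u * x ⊗ₜ y)) =
            antipodeLin x * LinearMap.mul' ℂ (Nichols n) (antipodeLin.rTensor (Nichols n) u)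
              * y := by
          intro u
          induction u with
          | zero => simp
          | add v w hv hw => simp only [mul_add, add_mul, map_add, hv, hw]
          | tmul p q => simp [antipodeLin_mul, mul_assoc]
        rw [h2, hu, ← Algebra.commutes, mul_assoc]
        simp
    exact key _ _ _ ha

theorem antipode_right_aux (a : Nichols n) : LinearMap.mul' ℂ (Nichols n)
    (antipodeLin.lTensor (Nichols n) (Coalgebra.comul a)) =
      algebraMap ℂ (Nichols n) (Coalgebra.counit a) := by
  induction a using induct with
  | hK => simp [comul_K, counit_K, antipodeLin_K, K_mul_K]
  | hxi i =>
    have h1 : antipodeLin (1 : Nichols n) = 1 := by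
      simpa using antipodeLin_algebraMap (n := n) 1
    simp [comul_xi, counit_xi, antipodeLin_xi, h1, ← mul_assoc, K_mul_K]
  | halg r =>
    have h1 : antipodeLin (1 : Nichols n) = 1 := by
      simpa using antipodeLin_algebraMap (n := n) 1
    rw [Bialgebra.comul_algebraMap, Bialgebra.counit_algebraMap]
    simp only [Algebra.TensorProduct.algebraMap_apply, LinearMap.lTensor_tmul,
      LinearMap.mul'_apply, mul_one, h1]
  | hadd a b ha hb => simp only [map_add, ha, hb]
  | hmul a b ha hb =>
    rw [Bialgebra.comul_mul, Bialgebra.counit_mul, RingHom.map_mul, ← ha]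
    have key : ∀ (u v : Nichols n ⊗[ℂ] Nichols n) (c : ℂ),
        LinearMap.mul' ℂ (Nichols n) (antipodeLin.lTensor (Nichols n) v) = algebraMap ℂ _ c →
        LinearMap.mul' ℂ (Nichols n) (antipodeLin.lTensor (Nichols n) (u * v)) =
            LinearMap.mul' ℂ (Nichols n) (antipodeLin.lTensor (Nichols n) u) *
          algebraMap ℂ _ c := by
      intro u v c hv
      rw [← hv]
      induction u with
      | zero => simp
      | add v w hv hw => simp only [add_mul, map_add, hv, hw]
      | tmul x y =>
        have h2 : ∀ u : Nichols n ⊗[ℂ] Nichols n,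
            LinearMap.mul' ℂ (Nichols n) (antipodeLin.lTensor (Nichols n) (x ⊗ₜ y * u)) =
            x * LinearMap.mul' ℂ (Nichols n) (antipodeLin.lTensor (Nichols n) u)
              * antipodeLin y := by
          intro u
          induction u with
          | zero => simp
          | add v w hv hw => simp only [mul_add, add_mul, map_add, hv, hw]
          | tmul p q => simp [antipodeLin_mul, mul_assoc]
        rw [h2, hv, mul_assoc, Algebra.commutes, ← mul_assoc]
        simp
    exact key _ _ _ hb

noncomputable instance : HopfAlgebra ℂ (Nichols n) where
  antipode := antipodeLin
  mul_antipode_rTensor_comul := LinearMap.ext antipode_left_aux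
  mul_antipode_lTensor_comul := LinearMap.ext antipode_right_aux

end Nichols

namespace Nichols

variable {n : ℕ}

/-- The product of the `x i` with `i ∈ S`, in increasing order of the index. -/
def orderedProd {A : Type*} [Monoid A] (x : Fin n → A) (S : Finset (Fin n)) : A :=
  ((List.finRange n).map fun i => if i ∈ S then x i else 1).prod

/-- The partial ordered product along a list. -/
def listProd {A : Type*} [Monoid A] (x : Fin n → A) (L : List (Fin n)) (S : Finset (Fin n)) : A :=
  (L.map fun i => if i ∈ S then x i else 1).prod

/-- The word `K ^ a * ξ_{i₁} ⋯ ξ_{iₖ}`, where `S = {i₁ < ⋯ < iₖ}`. -/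
noncomputable def word (p : Fin 2 × Finset (Fin n)) : Nichols n :=
  K ^ (p.1 : ℕ) * orderedProd xi p.2

theorem listProd_congr {A : Type*} [Monoid A] (x : Fin n → A) (L : List (Fin n))
    {S T : Finset (Fin n)} (h : ∀ i ∈ L, (i ∈ S ↔ i ∈ T)) : listProd x L S = listProd x L T := by
  unfold listProd
  congr 1
  apply List.map_congr_left
  intro i hi
  simp [h i hi]

theorem xi_mul_listProd (L : List (Fin n)) (hL : L.Nodup) (i : Fin n) (hi : i ∈ L)
    (S : Finset (Fin n)) : xi i * listProd xi L S ∈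
      Submodule.span ℂ (Set.range fun T => (listProd xi L T : Nichols n)) := by
  induction L generalizing S with
  | nil => simp at hi
  | cons j L ih =>
    rw [List.nodup_cons] at hL
    have hcons : ∀ T, (listProd xi (j :: L) T : Nichols n) =
        (if j ∈ T then xi j else 1) * listProd xi L T := by
      intro T; simp [listProd]
    rw [hcons]
    by_cases hij : i = j
    · subst hij
      by_cases hS : i ∈ S
      · rw [if_pos hS, ← mul_assoc, xi_mul_self, zero_mul]
        exact Submodule.zero_mem _
      · rw [if_neg hS, one_mul]
        apply Submodule.subset_span
        refine ⟨insert i S, ?_⟩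
        simp only [hcons]
        rw [if_pos (Finset.mem_insert_self _ _)]
        congr 1
        apply listProd_congr
        intro k hk
        have : k ≠ i := by rintro rfl; exact hL.1 hk
        simp [this]
    · have hi' : i ∈ L := by simpa [hij] using hi
      have h1 := ih hL.2 hi' S
      have h2 : ∀ (y : Nichols n), (y = xi j ∨ y = 1) → ∀ z ∈ Submodule.span ℂ (Set.range fun T => (listProd xi L T : Nichols n)),
          y * z ∈ Submodule.span ℂ (Set.range fun T => (listProd xi (j :: L) T : Nichols n)) := by
        intro y hy z hz
        induction hz using Submodule.span_induction with
        | zero => simp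
        | add a b _ _ ha hb => rw [mul_add]; exact add_mem ha hb
        | smul r a _ ha => rw [mul_smul_comm]; exact Submodule.smul_mem _ _ ha
        | mem a ha =>
          obtain ⟨T, rfl⟩ := ha
          apply Submodule.subset_span
          rcases hy with rfl | rfl
          · refine ⟨insert j T, ?_⟩
            simp only [hcons]
            rw [if_pos (Finset.mem_insert_self _ _)]
            congr 1
            apply listProd_congr
            intro k hk
            have : k ≠ j := by rintro rfl; exact hL.1 hk
            simp [this]
          · refine ⟨T.erase j, ?_⟩
            simp only [hcons]
            rw [if_neg (Finset.notMem_erase _ _)]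
            congr 1
            apply listProd_congr
            intro k hk
            have : k ≠ j := by rintro rfl; exact hL.1 hk
            simp [this]
      by_cases hS : j ∈ S
      · rw [if_pos hS, ← mul_assoc, xi_mul_xi, neg_mul, mul_assoc]
        exact Submodule.neg_mem _ (h2 _ (Or.inl rfl) _ h1)
      · rw [if_neg hS, one_mul]
        have := h2 1 (Or.inr rfl) _ h1
        rwa [one_mul] at this

theorem span_word : Submodule.span ℂ (Set.range (word (n := n))) = ⊤ := by
  set M := Submodule.span ℂ (Set.range (word (n := n))) with hM
  have hone : (1 : Nichols n) ∈ M := by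
    apply Submodule.subset_span
    refine ⟨(0, ∅), ?_⟩
    simp [word, orderedProd]
  have hK : ∀ z ∈ M, K * z ∈ M := by
    intro z hz
    induction hz using Submodule.span_induction with
    | zero => simp
    | add a b _ _ ha hb => rw [mul_add]; exact add_mem ha hb
    | smul r a _ ha => rw [mul_smul_comm]; exact Submodule.smul_mem _ _ ha
    | mem a ha =>
      obtain ⟨⟨e, S⟩, rfl⟩ := ha
      apply Submodule.subset_span
      refine ⟨(e + 1, S), ?_⟩
      fin_cases e
      · simp [word]
      · simp [word, ← mul_assoc, K_mul_K]
  have hxi : ∀ i, ∀ z ∈ M, xi i * z ∈ M := by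
    intro i z hz
    induction hz using Submodule.span_induction with
    | zero => simp
    | add a b _ _ ha hb => rw [mul_add]; exact add_mem ha hb
    | smul r a _ ha => rw [mul_smul_comm]; exact Submodule.smul_mem _ _ ha
    | mem a ha =>
      obtain ⟨⟨e, S⟩, rfl⟩ := ha
      have h0 : xi i * orderedProd xi S ∈ M := by
        have := xi_mul_listProd (List.finRange n) (List.nodup_finRange n) i
          (List.mem_finRange i) S
        refine (Submodule.span_le.mpr ?_) this
        rintro _ ⟨T, rfl⟩
        apply Submodule.subset_span
        exact ⟨(0, T), by simp [word, orderedProd, listProd]⟩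
      fin_cases e
      · simpa [word] using h0
      · have : xi i * word (1, S) = -(K * (xi i * orderedProd xi S)) := by
          simp only [word, ← mul_assoc, K_mul_xi]
          simp
        exact this ▸ Submodule.neg_mem _ (hK _ h0)
  rw [eq_top_iff]
  rintro a -
  have : ∀ a : Nichols n, ∀ z ∈ M, a * z ∈ M := by
    intro a
    induction a using induct with
    | hK => exact hK
    | hxi i => exact hxi i
    | halg r => intro z hz; rw [← Algebra.smul_def]; exact Submodule.smul_mem _ _ hz
    | hadd a b ha hb => intro z hz; rw [add_mul]; exact add_mem (ha z hz) (hb z hz)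
    | hmul a b ha hb => intro z hz; rw [mul_assoc]; exact ha _ (hb _ hz)
  simpa using this a 1 hone

/-- The sign picked up when `ξ_i` is moved past the letters of `S` with smaller index. -/
def regSign (i : Fin n) (S : Finset (Fin n)) : ℂ := (-1) ^ (S.filter (· < i)).card

/-- The operator by which `K` acts on the regular representation. -/
noncomputable def regK : Module.End ℂ (Fin 2 × Finset (Fin n) →₀ ℂ) :=
  Finsupp.lmapDomain ℂ ℂ fun p => (p.1 + 1, p.2)

/-- The operator by which `ξ_i` acts on the regular representation. -/
noncomputable def regXi (i : Fin n) : Module.End ℂ (Fin 2 × Finset (Fin n) →₀ ℂ) :=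
  Finsupp.lsum ℂ fun p => (LinearMap.toSpanSingleton ℂ _
    (if i ∈ p.2 then 0 else Finsupp.single (p.1, insert i p.2)
      ((-1) ^ (p.1 : ℕ) * regSign i p.2)))

theorem regK_single (p : Fin 2 × Finset (Fin n)) :
    regK (Finsupp.single p 1) = Finsupp.single (p.1 + 1, p.2) 1 := by
  simp [regK]

theorem regXi_single (i : Fin n) (p : Fin 2 × Finset (Fin n)) :
    regXi i (Finsupp.single p 1) = if i ∈ p.2 then 0 else
      ((-1) ^ (p.1 : ℕ) * regSign i p.2) • Finsupp.single (p.1, insert i p.2) 1 := by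
  simp [regXi]

theorem regSign_insert (i j : Fin n) (hij : i < j) (S : Finset (Fin n)) (hi : i ∉ S) :
    regSign j (insert i S) = - regSign j S ∧ regSign i (insert j S) = regSign i S := by
  constructor
  · rw [regSign, regSign, Finset.filter_insert, if_pos hij, Finset.card_insert_of_notMem
      (by simp [hi]), pow_succ]
    simp
  · rw [regSign, regSign, Finset.filter_insert, if_neg (not_lt.mpr hij.le)]

/-- The regular representation of the Nichols algebra, in coordinates. -/
noncomputable def regRep : Nichols n →ₐ[ℂ] Module.End ℂ (Fin 2 × Finset (Fin n) →₀ ℂ) :=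
  lift regK regXi
    (by
      ext1 p; ext1
      simp only [LinearMap.comp_apply, Finsupp.lsingle_apply, Module.End.mul_apply,
        Module.End.one_apply, regK_single]
      obtain ⟨e, S⟩ := p
      fin_cases e <;> rfl)
    (by
      intro i
      ext1 p; ext1
      simp only [LinearMap.comp_apply, Finsupp.lsingle_apply, Module.End.mul_apply,
        regXi_single, LinearMap.zero_apply]
      split_ifs with h
      · simp
      · rw [map_smul, regXi_single]; simp)
    (by
      intro i
      ext1 p; ext1
      simp only [LinearMap.comp_apply, Finsupp.lsingle_apply, Module.End.mul_apply,
        regXi_single, LinearMap.neg_apply, regK_single]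
      obtain ⟨e, S⟩ := p
      split_ifs with h
      · simp
      · rw [map_smul, regK_single]
        fin_cases e <;> simp)
    (by
      have key : ∀ i j : Fin n, i < j → (regXi i * regXi j : Module.End ℂ _) =
          -(regXi j * regXi i) := by
        intro i j hij
        ext1 p; ext1
        simp only [LinearMap.comp_apply, Finsupp.lsingle_apply, Module.End.mul_apply,
          regXi_single, LinearMap.neg_apply]
        obtain ⟨e, S⟩ := p
        by_cases hi : i ∈ S
        · by_cases hj : j ∈ S
          · simp [hi, hj]
          · simp only [hi, hj, if_true, if_false, map_smul, regXi_single, map_zero]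
            simp [hi]
        · by_cases hj : j ∈ S
          · simp only [hi, hj, if_true, if_false, map_smul, regXi_single, map_zero]
            simp [hj]
          · simp only [hi, hj, if_false, map_smul, regXi_single]
            rw [if_neg (by simp [hi, hij.ne]), if_neg (by simp [hj, hij.ne'])]
            obtain ⟨h1, h2⟩ := regSign_insert i j hij S hi
            rw [h1, h2, Finset.insert_comm, smul_smul, smul_smul, ← neg_smul]
            congr 1
            ring
      intro i j
      rcases lt_trichotomy i j with h | h | h
      · exact key i j h
      · subst h
        have : (regXi i * regXi i : Module.End ℂ (Fin 2 × Finset (Fin n) →₀ ℂ)) = 0 := by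
          ext1 p; ext1
          simp only [LinearMap.comp_apply, Finsupp.lsingle_apply, Module.End.mul_apply,
            regXi_single, LinearMap.zero_apply]
          split_ifs with h
          · simp
          · rw [map_smul, regXi_single]; simp
        rw [this]
        exact LinearMap.ext fun v => by simp
      · rw [key j i h]
        exact LinearMap.ext fun v => by simp)

theorem regRep_listProd (L : List (Fin n)) (hL : L.Pairwise (· < ·)) (S : Finset (Fin n)) :
    regRep (listProd xi L S) (Finsupp.single (0, ∅) 1) =
      Finsupp.single (0, S.filter (· ∈ L)) 1 := by
  induction L with
  | nil => simp [listProd]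
  | cons j L ih =>
    rw [List.pairwise_cons] at hL
    have hcons : (listProd xi (j :: L) S : Nichols n) =
        (if j ∈ S then xi j else 1) * listProd xi L S := by simp [listProd]
    rw [hcons, map_mul, Module.End.mul_apply, ih hL.2]
    have hjL : j ∉ L := fun h => (hL.1 j h).false
    by_cases hS : j ∈ S
    · rw [if_pos hS, regRep, lift_xi, regXi_single, if_neg (by simp [hjL])]
      have h1 : regSign j (S.filter (· ∈ L)) = 1 := by
        rw [regSign, Finset.filter_filter, Finset.filter_false_of_mem, Finset.card_empty, pow_zero]
        rintro k - ⟨hk, hkj⟩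
        exact (hL.1 k hk).not_gt hkj
      rw [h1]
      have h2 : insert j (S.filter (· ∈ L)) = S.filter (· ∈ j :: L) := by
        ext k; simp only [Finset.mem_insert, Finset.mem_filter, List.mem_cons]
        constructor
        · rintro (rfl | h)
          · exact ⟨hS, Or.inl rfl⟩
          · exact ⟨h.1, Or.inr h.2⟩
        · rintro ⟨h, rfl | h'⟩
          · exact Or.inl rfl
          · exact Or.inr ⟨h, h'⟩
      simp [h2]
    · rw [if_neg hS, map_one, Module.End.one_apply]
      congr 2
      ext k; simp only [Finset.mem_filter, List.mem_cons]
      constructor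
      · rintro ⟨h, h'⟩; exact ⟨h, Or.inr h'⟩
      · rintro ⟨h, rfl | h'⟩
        · exact absurd h hS
        · exact ⟨h, h'⟩

theorem regRep_word (p : Fin 2 × Finset (Fin n)) :
    regRep (word p) (Finsupp.single (0, ∅) 1) = Finsupp.single p 1 := by
  obtain ⟨e, S⟩ := p
  have h := regRep_listProd (List.finRange n) (List.pairwise_lt_finRange n) S
  have h' : (S.filter (· ∈ List.finRange n)) = S := by ext; simp
  rw [h'] at h
  have h2 : regRep (orderedProd xi S) (Finsupp.single (0, ∅) 1) =
    (Finsupp.single (0, S) 1 : Fin 2 × Finset (Fin n) →₀ ℂ) := h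
  rw [word, map_mul, Module.End.mul_apply, h2]
  fin_cases e
  · simp
  · simp only [Fin.mk_one, pow_one]
    rw [regRep, lift_K, regK_single]
    simp

theorem linearIndependent_word : LinearIndependent ℂ (word (n := n)) := by
  have h : LinearIndependent ℂ (fun p => (Finsupp.single p 1 : Fin 2 × Finset (Fin n) →₀ ℂ)) := by
    simpa using (Finsupp.basisSingleOne (R := ℂ) (ι := Fin 2 × Finset (Fin n))).linearIndependent
  refine LinearIndependent.of_comp
    ((LinearMap.applyₗ (Finsupp.single (0, ∅) 1)) ∘ₗ (regRep (n := n)).toLinearMap) ?_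
  convert h using 1
  funext p
  simp [regRep_word]

/-- The basis of the Nichols Hopf algebra formed by the words `K ^ a * ξ_{i₁} ⋯ ξ_{iₖ}`. -/
noncomputable def basis (n : ℕ) : Module.Basis (Fin 2 × Finset (Fin n)) ℂ (Nichols n) :=
  Module.Basis.mk linearIndependent_word span_word.ge

theorem basis_apply (p : Fin 2 × Finset (Fin n)) : basis n p = word p := by
  simp [basis]

end Nichols

namespace Nichols

variable {n : ℕ}

/-- The convolution product `(φψ)(x) = φ(x₁) ψ(x₂)` on the dual. -/
noncomputable def conv : Module.Dual ℂ (Nichols n) →ₗ[ℂ] Module.Dual ℂ (Nichols n) →ₗ[ℂ]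
    Module.Dual ℂ (Nichols n) :=
  LinearMap.mk₂ ℂ (fun φ ψ => LinearMap.mul' ℂ ℂ ∘ₗ TensorProduct.map φ ψ ∘ₗ Coalgebra.comul)
    (fun _ _ _ => by ext; simp [TensorProduct.map_add_left])
    (fun _ _ _ => by ext; simp [TensorProduct.map_smul_left])
    (fun _ _ _ => by ext; simp [TensorProduct.map_add_right])
    (fun _ _ _ => by ext; simp [TensorProduct.map_smul_right])

theorem conv_apply (φ ψ : Module.Dual ℂ (Nichols n)) (x : Nichols n) :
    conv φ ψ x = LinearMap.mul' ℂ ℂ (TensorProduct.map φ ψ (Coalgebra.comul x)) := rfl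

theorem conv_assoc (φ ψ χ : Module.Dual ℂ (Nichols n)) :
    conv (conv φ ψ) χ = conv φ (conv ψ χ) :=
  congrArg WithConv.ofConv
    (mul_assoc (WithConv.toConv φ) (WithConv.toConv ψ) (WithConv.toConv χ))

theorem counit_conv (φ : Module.Dual ℂ (Nichols n)) : conv Coalgebra.counit φ = φ :=
  congrArg WithConv.ofConv (one_mul (WithConv.toConv φ))

theorem conv_counit (φ : Module.Dual ℂ (Nichols n)) : conv φ Coalgebra.counit = φ :=
  congrArg WithConv.ofConv (mul_one (WithConv.toConv φ))

/-- `a` acts on `φ ⊗ k` by `φ(· a) ⊗ k`. -/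
noncomputable def actRight :
    Nichols n →ₐ[ℂ] Module.End ℂ (Module.Dual ℂ (Nichols n) ⊗[ℂ] Nichols n) :=
  AlgHom.ofLinearMap
    (LinearMap.rTensorHom (Nichols n) ∘ₗ Module.Dual.transpose ∘ₗ (LinearMap.mul ℂ _).flip)
    (by
      refine TensorProduct.ext' fun φ k => ?_
      change (φ ∘ₗ LinearMap.mulRight ℂ 1) ⊗ₜ[ℂ] k = φ ⊗ₜ[ℂ] k
      rw [LinearMap.mulRight_one, LinearMap.comp_id])
    (fun a b => by
      refine TensorProduct.ext' fun φ k => ?_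
      change (φ ∘ₗ LinearMap.mulRight ℂ (a * b)) ⊗ₜ[ℂ] k =
        ((φ ∘ₗ LinearMap.mulRight ℂ b) ∘ₗ LinearMap.mulRight ℂ a) ⊗ₜ[ℂ] k
      congr 1
      ext x
      simp [mul_assoc])

/-- `b` acts on `φ ⊗ k` by `φ(S⁻¹(b) ·) ⊗ k`. -/
noncomputable def actLeft :
    Nichols n →ₐ[ℂ] Module.End ℂ (Module.Dual ℂ (Nichols n) ⊗[ℂ] Nichols n) :=
  AlgHom.ofLinearMap
    (LinearMap.rTensorHom (Nichols n) ∘ₗ Module.Dual.transpose ∘ₗ LinearMap.mul ℂ _ ∘ₗ antipodeInv)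
    (by
      have h1 : antipodeInv (1 : Nichols n) = 1 := by
        simpa using antipodeInv_algebraMap (n := n) 1
      refine TensorProduct.ext' fun φ k => ?_
      change (φ ∘ₗ LinearMap.mulLeft ℂ (antipodeInv 1)) ⊗ₜ[ℂ] k = φ ⊗ₜ[ℂ] k
      rw [h1, LinearMap.mulLeft_one, LinearMap.comp_id])
    (fun a b => by
      refine TensorProduct.ext' fun φ k => ?_
      change (φ ∘ₗ LinearMap.mulLeft ℂ (antipodeInv (a * b))) ⊗ₜ[ℂ] k =
        ((φ ∘ₗ LinearMap.mulLeft ℂ (antipodeInv b)) ∘ₗ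
          LinearMap.mulLeft ℂ (antipodeInv a)) ⊗ₜ[ℂ] k
      congr 1
      ext x
      simp [antipodeInv_mul])

/-- `h` acts on `φ ⊗ k` by `φ ⊗ h k`. -/
noncomputable def actMul :
    Nichols n →ₐ[ℂ] Module.End ℂ (Module.Dual ℂ (Nichols n) ⊗[ℂ] Nichols n) :=
  AlgHom.ofLinearMap
    (LinearMap.lTensorHom (Module.Dual ℂ (Nichols n)) ∘ₗ LinearMap.mul ℂ _)
    (by
      refine TensorProduct.ext' fun φ k => ?_
      change φ ⊗ₜ[ℂ] (1 * k) = φ ⊗ₜ[ℂ] k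
      rw [one_mul])
    (fun a b => by
      refine TensorProduct.ext' fun φ k => ?_
      change φ ⊗ₜ[ℂ] (a * b * k) = φ ⊗ₜ[ℂ] (a * (b * k))
      rw [mul_assoc])

theorem actRight_tmul (a : Nichols n) (φ : Module.Dual ℂ (Nichols n)) (k : Nichols n) :
    actRight a (φ ⊗ₜ k) = (φ ∘ₗ LinearMap.mulRight ℂ a) ⊗ₜ k := rfl
theorem actLeft_tmul (a : Nichols n) (φ : Module.Dual ℂ (Nichols n)) (k : Nichols n) :
    actLeft a (φ ⊗ₜ k) = (φ ∘ₗ LinearMap.mulLeft ℂ (antipodeInv a)) ⊗ₜ k := rfl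
theorem actMul_tmul (a : Nichols n) (φ : Module.Dual ℂ (Nichols n)) (k : Nichols n) :
    actMul a (φ ⊗ₜ k) = φ ⊗ₜ (a * k) := rfl

theorem commute_actMul_actLeft (a b : Nichols n) : Commute (actMul a) (actLeft b) :=
  TensorProduct.ext' fun φ k => by
    rw [Module.End.mul_apply, Module.End.mul_apply, actLeft_tmul, actMul_tmul, actMul_tmul,
      actLeft_tmul]

theorem commute_actRight_actMul (a b : Nichols n) : Commute (actRight a) (actMul b) :=
  TensorProduct.ext' fun φ k => by
    rw [Module.End.mul_apply, Module.End.mul_apply, actRight_tmul, actMul_tmul, actMul_tmul,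
      actRight_tmul]

theorem commute_actRight_actLeft (a b : Nichols n) : Commute (actRight a) (actLeft b) :=
  TensorProduct.ext' fun φ k => by
    rw [Module.End.mul_apply, Module.End.mul_apply, actLeft_tmul, actRight_tmul, actRight_tmul,
      actLeft_tmul]
    congr 1
    ext x
    simp [mul_assoc]

/-- `a ⊗ b` acts on `φ ⊗ k` by `φ(S⁻¹(b) ·) ⊗ a k`. -/
noncomputable def actMulLeft : Nichols n ⊗[ℂ] Nichols n →ₐ[ℂ]
    Module.End ℂ (Module.Dual ℂ (Nichols n) ⊗[ℂ] Nichols n) :=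
  Algebra.TensorProduct.lift actMul actLeft commute_actMul_actLeft

theorem actMulLeft_tmul (a b : Nichols n) : actMulLeft (a ⊗ₜ b) = actMul a * actLeft b :=
  Algebra.TensorProduct.lift_tmul ..

theorem commute_actRight_actMulLeft (a : Nichols n) (b : Nichols n ⊗[ℂ] Nichols n) :
    Commute (actRight a) (actMulLeft b) := by
  induction b with
  | zero => rw [map_zero]; exact Commute.zero_right _
  | add x y hx hy => rw [map_add]; exact hx.add_right hy
  | tmul x y =>
    rw [actMulLeft_tmul]
    exact (commute_actRight_actMul a x).mul_right (commute_actRight_actLeft a y)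

/-- `a ⊗ (b ⊗ c)` acts on `φ ⊗ k` by `φ(S⁻¹(c) · a) ⊗ b k`. -/
noncomputable def actAll : Nichols n ⊗[ℂ] (Nichols n ⊗[ℂ] Nichols n) →ₐ[ℂ]
    Module.End ℂ (Module.Dual ℂ (Nichols n) ⊗[ℂ] Nichols n) :=
  Algebra.TensorProduct.lift actRight actMulLeft commute_actRight_actMulLeft

theorem actAll_tmul (a b c : Nichols n) :
    actAll (a ⊗ₜ (b ⊗ₜ c)) = actRight a * (actMul b * actLeft c) := by
  rw [← actMulLeft_tmul]
  exact Algebra.TensorProduct.lift_tmul ..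

/-- Left multiplication by `ε ⊗ h` in the Drinfeld double:
`(ε ⊗ h)(φ ⊗ k) = φ(S⁻¹(h₃) · h₁) ⊗ h₂ k`. -/
noncomputable def mulNichols :
    Nichols n →ₐ[ℂ] Module.End ℂ (Module.Dual ℂ (Nichols n) ⊗[ℂ] Nichols n) :=
  actAll.comp ((Algebra.TensorProduct.map (AlgHom.id ℂ (Nichols n))
    (Bialgebra.comulAlgHom ℂ (Nichols n))).comp (Bialgebra.comulAlgHom ℂ (Nichols n)))

/-- Left multiplication by `φ ⊗ 1` in the Drinfeld double: `(φ ⊗ 1)(ψ ⊗ k) = φψ ⊗ k`. -/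
noncomputable def mulDual : Module.Dual ℂ (Nichols n) →ₗ[ℂ]
    Module.End ℂ (Module.Dual ℂ (Nichols n) ⊗[ℂ] Nichols n) :=
  LinearMap.rTensorHom (Nichols n) ∘ₗ conv

theorem mulDual_tmul (φ ψ : Module.Dual ℂ (Nichols n)) (k : Nichols n) :
    mulDual φ (ψ ⊗ₜ k) = conv φ ψ ⊗ₜ k := rfl

/-- The multiplication of the Drinfeld double, as a bilinear map:
`(φ ⊗ h)(ψ ⊗ k) = φ ψ(S⁻¹(h₃) · h₁) ⊗ h₂ k`. -/
noncomputable def doubleMul : (Module.Dual ℂ (Nichols n) ⊗[ℂ] Nichols n) →ₗ[ℂ]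
    Module.End ℂ (Module.Dual ℂ (Nichols n) ⊗[ℂ] Nichols n) :=
  TensorProduct.lift ((LinearMap.mul ℂ _).compl₁₂ mulDual mulNichols.toLinearMap)

theorem doubleMul_tmul (φ : Module.Dual ℂ (Nichols n)) (h : Nichols n) :
    doubleMul (φ ⊗ₜ h) = mulDual φ * mulNichols h := rfl

theorem mulNichols_K : mulNichols (K : Nichols n) = actRight K * (actMul K * actLeft K) := by
  simp [mulNichols, comul_K, actAll_tmul]

theorem antipodeInv_one : antipodeInv (1 : Nichols n) = 1 := by
  simpa using antipodeInv_algebraMap (n := n) 1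

theorem mulNichols_xi (i : Fin n) : mulNichols (xi i : Nichols n) =
    actRight K * (actMul K * actLeft (xi i)) + actRight K * actMul (xi i) + actRight (xi i) := by
  simp [mulNichols, comul_xi, TensorProduct.tmul_add, Algebra.TensorProduct.one_def, actAll_tmul]

theorem conv_comp_K (φ ψ : Module.Dual ℂ (Nichols n)) :
    conv φ ψ ∘ₗ LinearMap.mulRight ℂ K =
      conv (φ ∘ₗ LinearMap.mulRight ℂ K) (ψ ∘ₗ LinearMap.mulRight ℂ K) := by
  ext x
  simp only [LinearMap.comp_apply, conv_apply, LinearMap.mulRight_apply, Bialgebra.comul_mul,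
    comul_K]
  induction Coalgebra.comul (R := ℂ) x with
  | zero => simp
  | add x y hx hy => simp only [add_mul, map_add, hx, hy]
  | tmul x y => simp

theorem conv_comp_xi (φ ψ : Module.Dual ℂ (Nichols n)) (i : Fin n) :
    conv φ ψ ∘ₗ LinearMap.mulRight ℂ (xi i) =
      conv (φ ∘ₗ LinearMap.mulRight ℂ K) (ψ ∘ₗ LinearMap.mulRight ℂ (xi i)) +
      conv (φ ∘ₗ LinearMap.mulRight ℂ (xi i)) ψ := by
  ext x
  simp only [LinearMap.comp_apply, conv_apply, LinearMap.mulRight_apply, Bialgebra.comul_mul,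
    comul_xi, LinearMap.add_apply]
  induction Coalgebra.comul (R := ℂ) x with
  | zero => simp
  | add x y hx hy => simp only [add_mul, map_add, hx, hy]; ring
  | tmul x y => simp [mul_add]

theorem conv_comp_K_left (φ ψ : Module.Dual ℂ (Nichols n)) :
    conv φ ψ ∘ₗ LinearMap.mulLeft ℂ K =
      conv (φ ∘ₗ LinearMap.mulLeft ℂ K) (ψ ∘ₗ LinearMap.mulLeft ℂ K) := by
  ext x
  simp only [LinearMap.comp_apply, conv_apply, LinearMap.mulLeft_apply, Bialgebra.comul_mul,
    comul_K]
  induction Coalgebra.comul (R := ℂ) x with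
  | zero => simp
  | add x y hx hy => simp only [mul_add, map_add, hx, hy]
  | tmul x y => simp

theorem conv_comp_Kxi_left (φ ψ : Module.Dual ℂ (Nichols n)) (i : Fin n) :
    conv φ ψ ∘ₗ LinearMap.mulLeft ℂ (K * xi i) =
      conv φ (ψ ∘ₗ LinearMap.mulLeft ℂ (K * xi i)) +
      conv (φ ∘ₗ LinearMap.mulLeft ℂ (K * xi i)) (ψ ∘ₗ LinearMap.mulLeft ℂ K) := by
  ext x
  have e : Coalgebra.comul (R := ℂ) (K * xi i : Nichols n) =
      1 ⊗ₜ (K * xi i) + (K * xi i) ⊗ₜ K := by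
    rw [Bialgebra.comul_mul, comul_K, comul_xi, mul_add, Algebra.TensorProduct.tmul_mul_tmul,
      Algebra.TensorProduct.tmul_mul_tmul, K_mul_K, mul_one]
  simp only [LinearMap.comp_apply, conv_apply, LinearMap.mulLeft_apply, LinearMap.add_apply]
  rw [Bialgebra.comul_mul, e]
  induction Coalgebra.comul (R := ℂ) x with
  | zero => simp
  | add x y hx hy => rw [mul_add]; simp only [map_add, hx, hy]; ring
  | tmul x y => simp [add_mul, mul_assoc]

theorem mulNichols_mul_doubleMul (h : Nichols n)
    (x : Module.Dual ℂ (Nichols n) ⊗[ℂ] Nichols n) :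
    mulNichols h * doubleMul x = doubleMul (mulNichols h x) := by
  induction h using induct generalizing x with
  | halg r =>
    rw [AlgHom.commutes, Algebra.algebraMap_eq_smul_one, smul_mul_assoc, one_mul,
      LinearMap.smul_apply, map_smul, Module.End.one_apply]
  | hadd a b ha hb => rw [map_add, add_mul, ha, hb, LinearMap.add_apply, map_add]
  | hmul a b ha hb => rw [map_mul, mul_assoc, hb, ha, Module.End.mul_apply]
  | hK =>
    induction x with
    | zero => simp
    | add x y hx hy => simp only [map_add, mul_add, hx, hy]
    | tmul ψ k =>
      rw [doubleMul_tmul]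
      have e : mulNichols K (ψ ⊗ₜ k) = (ψ ∘ₗ LinearMap.mulLeft ℂ K ∘ₗ LinearMap.mulRight ℂ K) ⊗ₜ
          (K * k) := by
        rw [mulNichols_K]
        simp only [Module.End.mul_apply, actRight_tmul, actMul_tmul, actLeft_tmul, antipodeInv_K]
        rfl
      rw [e, doubleMul_tmul, map_mul, ← mul_assoc, ← mul_assoc]
      congr 1
      refine TensorProduct.ext' fun φ l => ?_
      rw [Module.End.mul_apply, Module.End.mul_apply, mulDual_tmul, mulNichols_K]
      simp only [Module.End.mul_apply, actRight_tmul, actMul_tmul, actLeft_tmul, antipodeInv_K,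
        mulDual_tmul, conv_comp_K_left, conv_comp_K]
      rfl
  | hxi i =>
    induction x with
    | zero => simp
    | add x y hx hy => simp only [map_add, mul_add, hx, hy]
    | tmul ψ k =>
      rw [doubleMul_tmul]
      have e : mulNichols (xi i) (ψ ⊗ₜ k) =
          (ψ ∘ₗ LinearMap.mulLeft ℂ (K * xi i) ∘ₗ LinearMap.mulRight ℂ K) ⊗ₜ (K * k)
          + (ψ ∘ₗ LinearMap.mulRight ℂ K) ⊗ₜ (xi i * k)
          + (ψ ∘ₗ LinearMap.mulRight ℂ (xi i)) ⊗ₜ k := by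
        rw [mulNichols_xi]
        simp only [Module.End.mul_apply, actRight_tmul, actMul_tmul, actLeft_tmul, antipodeInv_xi,
          LinearMap.add_apply]
        rfl
      rw [e, map_add, map_add, doubleMul_tmul, doubleMul_tmul, doubleMul_tmul, map_mul, map_mul,
        ← mul_assoc, ← mul_assoc, ← mul_assoc, ← add_mul, ← add_mul]
      congr 1
      refine TensorProduct.ext' fun φ l => ?_
      simp only [Module.End.mul_apply, LinearMap.add_apply]
      rw [mulDual_tmul, mulNichols_K, mulNichols_xi]
      simp only [Module.End.mul_apply, actRight_tmul, actMul_tmul, actLeft_tmul, antipodeInv_K,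
        antipodeInv_xi, LinearMap.add_apply, map_add,
        mulDual_tmul, conv_comp_Kxi_left, conv_comp_K, conv_comp_xi,
        TensorProduct.add_tmul, LinearMap.comp_assoc]
      abel

theorem mulDual_mul_doubleMul (φ : Module.Dual ℂ (Nichols n))
    (x : Module.Dual ℂ (Nichols n) ⊗[ℂ] Nichols n) :
    mulDual φ * doubleMul x = doubleMul (mulDual φ x) := by
  induction x with
  | zero => simp
  | add x y hx hy => simp only [map_add, mul_add, hx, hy]
  | tmul ψ k =>
    rw [mulDual_tmul, doubleMul_tmul, doubleMul_tmul, ← mul_assoc]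
    congr 1
    refine TensorProduct.ext' fun χ l => ?_
    rw [Module.End.mul_apply, mulDual_tmul, mulDual_tmul, mulDual_tmul, conv_assoc]

theorem doubleMul_mul_doubleMul (x y : Module.Dual ℂ (Nichols n) ⊗[ℂ] Nichols n) :
    doubleMul x * doubleMul y = doubleMul (doubleMul x y) := by
  induction x with
  | zero => simp
  | add x x' hx hx' => simp only [map_add, add_mul, hx, hx', LinearMap.add_apply]
  | tmul φ h =>
    rw [doubleMul_tmul, mul_assoc, mulNichols_mul_doubleMul, mulDual_mul_doubleMul]
    rfl

theorem mulNichols_counit (h k : Nichols n) :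
    mulNichols h ((Coalgebra.counit : Module.Dual ℂ (Nichols n)) ⊗ₜ[ℂ] k) =
      Coalgebra.counit ⊗ₜ (h * k) := by
  induction h using induct generalizing k with
  | halg r =>
    rw [AlgHom.commutes, Algebra.algebraMap_eq_smul_one, LinearMap.smul_apply,
      Module.End.one_apply, ← TensorProduct.tmul_smul, ← Algebra.smul_def]
  | hadd a b ha hb => rw [map_add, LinearMap.add_apply, ha, hb, add_mul, TensorProduct.tmul_add]
  | hmul a b ha hb => rw [map_mul, Module.End.mul_apply, hb, ha, mul_assoc]
  | hK =>
    rw [mulNichols_K]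
    simp only [Module.End.mul_apply, actRight_tmul, actMul_tmul, actLeft_tmul, antipodeInv_K]
    congr 1
    ext x
    simp [counit_K]
  | hxi i =>
    rw [mulNichols_xi]
    simp only [Module.End.mul_apply, actRight_tmul, actMul_tmul, actLeft_tmul, antipodeInv_xi,
      LinearMap.add_apply]
    have h1 : ((Coalgebra.counit : Module.Dual ℂ (Nichols n)) ∘ₗ LinearMap.mulLeft ℂ (K * xi i))
        = 0 := by ext; simp [counit_xi]
    have h2 : ((Coalgebra.counit : Module.Dual ℂ (Nichols n)) ∘ₗ LinearMap.mulRight ℂ (xi i))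
        = 0 := by ext; simp [counit_xi]
    have h3 : ((Coalgebra.counit : Module.Dual ℂ (Nichols n)) ∘ₗ LinearMap.mulRight ℂ K)
        = Coalgebra.counit := by ext; simp [counit_K]
    rw [h1, h2, h3]
    simp

end Nichols

/-- The underlying vector space `H* ⊗ H` of the Drinfeld double of `H = Nichols n`. -/
def DNichols (n : ℕ) : Type := Module.Dual ℂ (Nichols n) ⊗[ℂ] Nichols n

namespace DNichols

open Nichols

variable {n : ℕ}

noncomputable instance : AddCommGroup (DNichols n) :=
  inferInstanceAs (AddCommGroup (Module.Dual ℂ (Nichols n) ⊗[ℂ] Nichols n))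
noncomputable instance : Module ℂ (DNichols n) :=
  inferInstanceAs (Module ℂ (Module.Dual ℂ (Nichols n) ⊗[ℂ] Nichols n))

/-- The element `φ ⊗ h` of the Drinfeld double, as a bilinear map. -/
noncomputable def mk : Module.Dual ℂ (Nichols n) →ₗ[ℂ] Nichols n →ₗ[ℂ] DNichols n :=
  TensorProduct.mk ℂ (Module.Dual ℂ (Nichols n)) (Nichols n)

/-- The multiplication is `(φ ⊗ h)(ψ ⊗ k) = φ ψ(S⁻¹(h₃) · h₁) ⊗ h₂ k` and the unit is `ε ⊗ 1`. -/
noncomputable instance : Ring (DNichols n) where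
  mul x y := doubleMul x y
  one := mk Coalgebra.counit 1
  zero_mul x := LinearMap.congr_fun (map_zero doubleMul) x
  mul_zero x := map_zero (doubleMul x)
  left_distrib x y z := map_add (doubleMul x) y z
  right_distrib x y z := LinearMap.congr_fun (map_add doubleMul x y) z
  mul_assoc x y z := (LinearMap.congr_fun (doubleMul_mul_doubleMul x y) z).symm
  one_mul x := by
    change doubleMul (Coalgebra.counit ⊗ₜ 1) x = x
    rw [doubleMul_tmul, map_one, mul_one]
    induction x using TensorProduct.induction_on with
    | zero => exact map_zero _
    | add x y hx hy => exact (map_add _ x y).trans (congrArg₂ (· + ·) hx hy)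
    | tmul φ h => rw [mulDual_tmul, counit_conv]
  mul_one x := by
    change doubleMul x (Coalgebra.counit ⊗ₜ 1) = x
    induction x using TensorProduct.induction_on with
    | zero => exact LinearMap.congr_fun (map_zero doubleMul) _
    | add x y hx hy =>
      exact (LinearMap.congr_fun (map_add doubleMul x y) _).trans (congrArg₂ (· + ·) hx hy)
    | tmul φ h =>
      rw [doubleMul_tmul, Module.End.mul_apply, mulNichols_counit, mul_one, mulDual_tmul,
        conv_counit]
  neg_add_cancel := neg_add_cancel
  zsmul := zsmulRec

noncomputable instance : Algebra ℂ (DNichols n) :=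
  Algebra.ofModule (fun r x y => LinearMap.congr_fun (map_smul doubleMul r x) y)
    (fun r x y => map_smul (doubleMul x) r y)

end DNichols

namespace DNichols

open Nichols

variable {n : ℕ}

/-- The inclusion `h ↦ ε ⊗ h` of `H` into its double. -/
noncomputable def ofNichols : Nichols n →ₗ[ℂ] DNichols n := mk Coalgebra.counit

/-- The inclusion `φ ↦ φ ⊗ 1` of `H*` into the double of `H`. -/
noncomputable def ofDual : Module.Dual ℂ (Nichols n) →ₗ[ℂ] DNichols n := mk.flip 1

/-- The group-like element `K` of `H`, in the double. -/
noncomputable def K : DNichols n := ofNichols Nichols.K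

/-- The generator `ξ_i` of `H`, in the double. -/
noncomputable def xi (i : Fin n) : DNichols n := ofNichols (Nichols.xi i)

/-- `K̄ = 1* - K*`, where `b*` denotes the dual basis of the basis of words. -/
noncomputable def Kbar : DNichols n :=
  ofDual ((basis n).coord (0, ∅) - (basis n).coord (1, ∅))

/-- `ξ̄_i = ξ_i* + (K ξ_i)*`. -/
noncomputable def xibar (i : Fin n) : DNichols n :=
  ofDual ((basis n).coord (0, {i}) + (basis n).coord (1, {i}))

/-- The word `w = ξ_{i₁} ⋯ ξ_{iₖ}` for `S = {i₁ < ⋯ < iₖ}`. -/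
noncomputable def word (S : Finset (Fin n)) : DNichols n := orderedProd xi S

/-- The word `w̄ = ξ̄_{i₁} ⋯ ξ̄_{iₖ}` for `S = {i₁ < ⋯ < iₖ}`. -/
noncomputable def wordBar (S : Finset (Fin n)) : DNichols n := orderedProd xibar S

/-- The comultiplication of `H*` opposite to the transpose of the multiplication: it sends `φ` to
`∑ φ₂ ⊗ φ₁`, where `φ(x y) = ∑ φ₁(x) φ₂(y)`. -/
noncomputable def comulDual : Module.Dual ℂ (Nichols n) →ₗ[ℂ]
    Module.Dual ℂ (Nichols n) ⊗[ℂ] Module.Dual ℂ (Nichols n) :=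
  ∑ b : Fin 2 × Finset (Fin n), ∑ c : Fin 2 × Finset (Fin n),
    (LinearMap.applyₗ (basis n b * basis n c)).smulRight
      ((basis n).coord c ⊗ₜ[ℂ] (basis n).coord b)

/-- The comultiplication of the double: `φ ⊗ h ↦ ∑ (φ₂ ⊗ h₁) ⊗ (φ₁ ⊗ h₂)`. -/
noncomputable def comul : DNichols n →ₗ[ℂ] DNichols n ⊗[ℂ] DNichols n :=
  (TensorProduct.tensorTensorTensorComm ℂ (Module.Dual ℂ (Nichols n))
    (Module.Dual ℂ (Nichols n)) (Nichols n) (Nichols n)).toLinearMap ∘ₗ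
    TensorProduct.map comulDual Coalgebra.comul

/-- The antipode of the double: `φ ⊗ h ↦ (ε ⊗ s(h)) (φ ∘ s⁻¹ ⊗ 1)`. -/
noncomputable def antipode : DNichols n →ₗ[ℂ] DNichols n :=
  TensorProduct.lift (LinearMap.mk₂ ℂ
    (fun (φ : Module.Dual ℂ (Nichols n)) (h : Nichols n) =>
      ofNichols (HopfAlgebra.antipode ℂ h) * ofDual (φ ∘ₗ antipodeInv))
    (fun _ _ _ => by rw [LinearMap.add_comp, map_add, mul_add])
    (fun _ _ _ => by rw [LinearMap.smul_comp, map_smul, mul_smul_comm])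
    (fun _ _ _ => by rw [map_add, map_add, add_mul])
    (fun _ _ _ => by rw [map_smul, map_smul, smul_mul_assoc]))

/-- The canonical universal `R`-matrix `∑_b b ⊗ b*` of the double. -/
noncomputable def R (n : ℕ) : DNichols n ⊗[ℂ] DNichols n :=
  ∑ b : Fin 2 × Finset (Fin n), ofNichols (basis n b) ⊗ₜ[ℂ] ofDual ((basis n).coord b)

/-- The `R`-matrix with its two legs exchanged. -/
noncomputable def R21 (n : ℕ) : DNichols n ⊗[ℂ] DNichols n := TensorProduct.comm ℂ _ _ (R n)

/-- The ribbon element `ν = (1 + K - K̄ + K K̄) ∑_w ((-1)^⌊(|w| + 1) / 2⌋ / 2) w w̄`. -/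
noncomputable def nu (n : ℕ) : DNichols n :=
  (1 + K - Kbar + K * Kbar) *
    ∑ S : Finset (Fin n), ((-1 : ℂ) ^ ((S.card + 1) / 2) / 2) • (word S * wordBar S)

/-- The two-sided integral `Λ = (1 + K + K̄ + K K̄) ξ₁ ⋯ ξ_n ξ̄₁ ⋯ ξ̄_n / 2` of the double. -/
noncomputable def integral (n : ℕ) : DNichols n :=
  (1 / 2 : ℂ) • ((1 + K + Kbar + K * Kbar) *
    (word Finset.univ * wordBar Finset.univ))

/-- An integral of the dual of the double: the product `φ ⊗ h ↦ φ(Λ_H) λ_H(h)`, where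
`Λ_H = (1 + K) ξ₁ ⋯ ξ_n` and `λ_H = (ξ₁ ⋯ ξ_n)*` are integrals of `H` and of `H*`. -/
noncomputable def cointegralAux (n : ℕ) : DNichols n →ₗ[ℂ] ℂ :=
  LinearMap.mul' ℂ ℂ ∘ₗ TensorProduct.map
    (LinearMap.applyₗ ((1 + Nichols.K) * orderedProd Nichols.xi Finset.univ))
    ((basis n).coord (0, Finset.univ))

/-- The integral `λ` of the dual of the double, normalised by `λ(Λ) = 1`. For even `n` it is
`2 (ξ₁ ⋯ ξ_n ξ̄₁ ⋯ ξ̄_n)*` in the dual of the basis `K ^ a * K̄ ^ b * w * w̄'`. -/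
noncomputable def cointegral (n : ℕ) : DNichols n →ₗ[ℂ] ℂ :=
  (cointegralAux n (integral n))⁻¹ • cointegralAux n

/-- The map `x ↦ (id ⊗ λ)(R⁻¹ (1 ⊗ x) R₂₁⁻¹)`. -/
noncomputable def SLM (n : ℕ) : DNichols n →ₗ[ℂ] DNichols n :=
  (TensorProduct.rid ℂ (DNichols n)).toLinearMap ∘ₗ (cointegral n).lTensor (DNichols n) ∘ₗ
    LinearMap.mulLeft ℂ (Ring.inverse (R n)) ∘ₗ LinearMap.mulRight ℂ (Ring.inverse (R21 n)) ∘ₗ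
    TensorProduct.mk ℂ (DNichols n) (DNichols n) 1

/-- The map `x ↦ ν x`. -/
noncomputable def TLM (n : ℕ) : DNichols n →ₗ[ℂ] DNichols n := LinearMap.mulLeft ℂ (nu n)

/-- The trace map `τ(x) = ∑ s(Λ₂) x Λ₁ G⁻¹`, with the balancing element `G = K = K⁻¹`. -/
noncomputable def traceMap (n : ℕ) : DNichols n →ₗ[ℂ] DNichols n :=
  TensorProduct.lift (LinearMap.mk₂ ℂ
    (fun a b : DNichols n => LinearMap.mulLeft ℂ (antipode b) ∘ₗ LinearMap.mulRight ℂ (a * K))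
    (fun _ _ _ => by ext; simp [add_mul, mul_add, mul_assoc])
    (fun _ _ _ => by ext; simp [mul_assoc])
    (fun _ _ _ => by ext; simp [add_mul])
    (fun _ _ _ => by ext; simp)) (comul (integral n))

/-- The Higman ideal: the image of the trace map. -/
noncomputable def higman (n : ℕ) : Submodule ℂ (DNichols n) := LinearMap.range (traceMap n)

/-- The span of the elements `(1 + K K̄) w w̄'` with `|w| + |w'|` even. -/
noncomputable def zLambda (n : ℕ) : Submodule ℂ (DNichols n) :=
  Submodule.span ℂ {z | ∃ S T : Finset (Fin n), Even (S.card + T.card) ∧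
    z = (1 + K * Kbar) * (word S * wordBar T)}

/-- The center of the double. -/
noncomputable def center (n : ℕ) : Submodule ℂ (DNichols n) :=
  Subalgebra.toSubmodule (Subalgebra.center ℂ (DNichols n))

end DNichols

namespace WeilTwo

/-- The group `(ℤ/2)²`. -/
abbrev M : Type := ZMod 2 × ZMod 2

/-- The quadratic form `q = 2 Q`, where `Q(x, y) = (x² + x y + y²) / 2` in `ℚ/ℤ`. -/
def q (x : M) : ZMod 2 := x.1 ^ 2 + x.1 * x.2 + x.2 ^ 2

/-- The polar form of `q`. -/
def polar (x y : M) : ZMod 2 := q (x + y) - q x - q y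

/-- The action `f ↦ e^{2πi Q} f` of `t`. -/
noncomputable def weilT : Module.End ℂ (M → ℂ) :=
  LinearMap.pi fun x => ZMod.stdAddChar (q x) • LinearMap.proj x

/-- The Gauss sum `∑_x e^{2πi Q(x)}`. -/
noncomputable def gaussSum : ℂ := ∑ x : M, ZMod.stdAddChar (q x)

/-- The action `(s⁻¹ f)(x) = (gaussSum / |M|) ∑_y e^{2πi B(x, y)} f(y)` of `s⁻¹`, which is equal
to `s` modulo `2`. -/
noncomputable def weilS : Module.End ℂ (M → ℂ) :=
  LinearMap.pi fun x => (gaussSum / Fintype.card M) •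
    ∑ y : M, ZMod.stdAddChar (polar x y) • LinearMap.proj y

theorem sum_M (f : M → ℂ) : ∑ x, f x = f (0, 0) + f (0, 1) + f (1, 0) + f (1, 1) := by
  rw [Fintype.sum_prod_type]
  have h : ∀ g : ZMod 2 → ℂ, ∑ x, g x = g 0 + g 1 := fun g => Fin.sum_univ_two g
  rw [h, h, h]
  ring

theorem forall_M {P : M → Prop} (h00 : P (0, 0)) (h01 : P (0, 1)) (h10 : P (1, 0))
    (h11 : P (1, 1)) (x : M) : P x := by
  obtain ⟨a, b⟩ := x
  have h : ∀ c : ZMod 2, c = 0 ∨ c = 1 := by decide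
  rcases h a with rfl | rfl <;> rcases h b with rfl | rfl <;> assumption

theorem char_zero' : (ZMod.stdAddChar (0 : ZMod 2) : ℂ) = 1 := AddChar.map_zero_eq_one _

theorem char_one' : (ZMod.stdAddChar (1 : ZMod 2) : ℂ) = -1 := by
  have h := ZMod.stdAddChar_coe (N := 2) 1
  rw [Int.cast_one] at h
  rw [h]
  push_cast
  rw [← Complex.exp_pi_mul_I]
  congr 1
  ring

theorem gaussSum_eq : gaussSum = -2 := by
  rw [gaussSum, sum_M]
  rw [show q (0, 0) = 0 by decide, show q (0, 1) = 1 by decide, show q (1, 0) = 1 by decide,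
    show q (1, 1) = 1 by decide, char_zero', char_one']
  norm_num

theorem weilT_apply (f : M → ℂ) (x : M) : weilT f x = ZMod.stdAddChar (q x) * f x := rfl

theorem weilS_apply (f : M → ℂ) (x : M) : weilS f x = -(1 / 2) *
    ∑ y : M, ZMod.stdAddChar (polar x y) * f y := by
  have hM : (Fintype.card M : ℂ) = 4 := by
    rw [show Fintype.card M = 4 from rfl]; norm_num
  simp only [weilS, LinearMap.pi_apply, LinearMap.smul_apply, LinearMap.sum_apply,
    LinearMap.proj_apply, smul_eq_mul, gaussSum_eq, hM]
  norm_num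

theorem weilT_values (f : M → ℂ) : weilT f (0, 0) = f (0, 0) ∧ weilT f (0, 1) = -f (0, 1) ∧
    weilT f (1, 0) = -f (1, 0) ∧ weilT f (1, 1) = -f (1, 1) := by
  simp only [weilT_apply]
  rw [show q (0, 0) = 0 by decide, show q (0, 1) = 1 by decide, show q (1, 0) = 1 by decide,
    show q (1, 1) = 1 by decide, char_zero', char_one']
  refine ⟨?_, ?_, ?_, ?_⟩ <;> ring

theorem weilS_values (f : M → ℂ) :
    weilS f (0, 0) = -(1 / 2) * (f (0, 0) + f (0, 1) + f (1, 0) + f (1, 1)) ∧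
    weilS f (0, 1) = -(1 / 2) * (f (0, 0) + f (0, 1) - f (1, 0) - f (1, 1)) ∧
    weilS f (1, 0) = -(1 / 2) * (f (0, 0) - f (0, 1) + f (1, 0) - f (1, 1)) ∧
    weilS f (1, 1) = -(1 / 2) * (f (0, 0) - f (0, 1) - f (1, 0) + f (1, 1)) := by
  have h : ∀ x y : M, polar x y = x.1 * y.2 + x.2 * y.1 := by decide
  simp only [weilS_apply, sum_M, h]
  simp only [mul_zero, mul_one, add_zero, zero_add, show (1 + 1 : ZMod 2) = 0 by decide,
    char_zero', char_one']
  refine ⟨?_, ?_, ?_, ?_⟩ <;> ring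

theorem weilT_mul_self : weilT * weilT = 1 := by
  refine LinearMap.ext fun f => funext (forall_M ?_ ?_ ?_ ?_) <;>
    simp [weilT_values]

theorem weilS_mul_self : weilS * weilS = 1 := by
  refine LinearMap.ext fun f => funext (forall_M ?_ ?_ ?_ ?_) <;>
    simp [weilS_values] <;> ring

theorem weil_braid : weilS * (weilT * weilS) = weilT * (weilS * weilT) := by
  refine LinearMap.ext fun f => funext (forall_M ?_ ?_ ?_ ?_) <;>
    simp [weilS_values, weilT_values] <;> ring

/-- The operator of `g = (a b; c d)`: it is `t ^ b` if `c = 0`, and otherwise `t ^ a * s * t ^ d`. -/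
noncomputable def weilOp (g : SL(2, ZMod 2)) : Module.End ℂ (M → ℂ) :=
  if g 1 0 = 0 then weilT ^ (g 0 1).val else weilT ^ (g 0 0).val * weilS * weilT ^ (g 1 1).val

theorem weilOp_mul (g h : SL(2, ZMod 2)) : weilOp (g * h) = weilOp g * weilOp h := by
  have hz : ∀ c : ZMod 2, c = 0 ∨ c = 1 := by decide
  have hg := g.det_coe
  have hh := h.det_coe
  rw [Matrix.det_fin_two] at hg hh
  simp only [weilOp, Matrix.SpecialLinearGroup.coe_mul, Matrix.mul_apply, Fin.sum_univ_two]
  have e2 : (1 + 1 : ZMod 2) = 0 := by decide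
  have e1 : (0 - 1 : ZMod 2) = 1 := by decide
  have b' : weilS * (weilT * weilS) = weilT * (weilS * weilT) := weil_braid
  have tt : ∀ x, weilT * (weilT * x) = x := fun x => by rw [← mul_assoc, weilT_mul_self, one_mul]
  have ss : ∀ x, weilS * (weilS * x) = x := fun x => by rw [← mul_assoc, weilS_mul_self, one_mul]
  have b2 : ∀ x, weilS * (weilT * (weilS * x)) = weilT * (weilS * (weilT * x)) := fun x => by
    rw [← mul_assoc weilT, ← mul_assoc, weil_braid]; simp only [mul_assoc]
  rcases hz (g 0 0) with a1 | a1 <;> rcases hz (g 0 1) with a2 | a2 <;>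
  rcases hz (g 1 0) with a3 | a3 <;> rcases hz (g 1 1) with a4 | a4 <;>
  simp only [a1, a2, a3, a4, mul_zero, mul_one, sub_self, sub_zero, zero_ne_one,
    e1] at hg <;>
  rcases hz (h 0 0) with b1 | b1 <;> rcases hz (h 0 1) with b2' | b2' <;>
  rcases hz (h 1 0) with b3 | b3 <;> rcases hz (h 1 1) with b4 | b4 <;>
  simp only [b1, b2', b3, b4, mul_zero, mul_one, sub_self, sub_zero, zero_ne_one,
    e1] at hh <;>
  simp [a1, a2, a3, a4, b1, b2', b3, b4, e2, mul_assoc, tt, ss, b2, b', weilT_mul_self,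
    weilS_mul_self, ZMod.val_one]

/-- The Weil representation of `SL(2, ℤ/2)` attached to `(M, Q)`. -/
noncomputable def weilRep : Representation ℂ SL(2, ZMod 2) (M → ℂ) where
  toFun := weilOp
  map_one' := by simp [weilOp]
  map_mul' := weilOp_mul

/-- The functions on `M` that are invariant under the isometry `(x, y) ↦ (y, x + y)` of order
three. Identifying `M` with the field with four elements and `q` with its norm, it is the
multiplication by a generator of the group of elements of norm one. -/
noncomputable def invariants : Submodule ℂ (M → ℂ) :=
  LinearMap.eqLocus (LinearMap.funLeft ℂ ℂ fun x : M => (x.2, x.1 + x.2)) LinearMap.id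

/-- The Weil representation pulled back to `SL(2, ℤ)`. -/
noncomputable def weilRepInt : Representation ℂ SL(2, ℤ) (M → ℂ) :=
  weilRep.comp (Matrix.SpecialLinearGroup.map (Int.castRingHom (ZMod 2)))

theorem mem_invariants (f : M → ℂ) :
    f ∈ invariants ↔ f (0, 1) = f (1, 0) ∧ f (0, 1) = f (1, 1) := by
  rw [invariants, LinearMap.mem_eqLocus, funext_iff]
  have h2 : (1 + 1 : ZMod 2) = 0 := by decide
  constructor
  · intro h
    have h1 := h (1, 0)
    have h3 := h (0, 1)
    simp [LinearMap.funLeft] at h1 h3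
    exact ⟨h1, h3.symm⟩
  · rintro ⟨h1, h3⟩
    refine forall_M ?_ ?_ ?_ ?_ <;> simp [LinearMap.funLeft, h2, ← h1, ← h3]

theorem weilT_mem {f : M → ℂ} (hf : f ∈ invariants) : weilT f ∈ invariants := by
  rw [mem_invariants] at *
  obtain ⟨_, h2, h3, h4⟩ := weilT_values f
  rw [h2, h3, h4, ← hf.1, ← hf.2]
  exact ⟨rfl, rfl⟩

theorem weilS_mem {f : M → ℂ} (hf : f ∈ invariants) : weilS f ∈ invariants := by
  rw [mem_invariants] at *
  obtain ⟨_, h2, h3, h4⟩ := weilS_values f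
  rw [h2, h3, h4, ← hf.1, ← hf.2]
  constructor <;> ring

theorem weilOp_mem (g : SL(2, ZMod 2)) {f : M → ℂ} (hf : f ∈ invariants) :
    weilOp g f ∈ invariants := by
  have hT : ∀ k : ℕ, ∀ f ∈ invariants, (weilT ^ k) f ∈ invariants := by
    intro k
    induction k with
    | zero => exact fun f hf => hf
    | succ k ih => intro f hf; rw [pow_succ']; exact weilT_mem (ih f hf)
  unfold weilOp
  split_ifs
  · exact hT _ f hf
  · exact hT _ _ (weilS_mem (hT _ f hf))

/-- The representation `N₁` of `SL(2, ℤ)` of level two: the invariant functions in the Weil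
representation attached to `(M, Q)`. -/
noncomputable def N1 : Subrepresentation weilRepInt where
  toSubmodule := invariants
  apply_mem_toSubmodule _ _ hf := weilOp_mem _ hf

end WeilTwo

namespace ModularRep

/-- The standard representation of `SL(2, ℤ)` on `ℂ²`. -/
noncomputable def std : Representation ℂ SL(2, ℤ) (Fin 2 → ℂ) where
  toFun g := Matrix.toLin' ((g : Matrix (Fin 2) (Fin 2) ℤ).map (Int.castRingHom ℂ))
  map_one' := by simp [Module.End.one_eq_id]
  map_mul' g h := by
    rw [Matrix.SpecialLinearGroup.coe_mul, Matrix.map_mul, Matrix.toLin'_mul]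
    rfl

/-- The `k`-th tensor power of the standard representation; it is trivial for `k = 0`. -/
noncomputable def stdPow (k : ℕ) : Representation ℂ SL(2, ℤ) (⨂[ℂ] _ : Fin k, (Fin 2 → ℂ)) :=
  PiTensorProduct.mapMonoidHom.comp (MonoidHom.pi fun _ => std)

/-- The index set with `n.choose k * 2 ^ (n - k)` elements for each even `k ≤ n`. -/
abbrev EvenIndex (n : ℕ) : Type :=
  (k : {k : Fin (n + 1) // Even (k : ℕ)}) × Fin (n.choose k * 2 ^ (n - (k : ℕ)))

/-- The direct sum, over the even `k ≤ n`, of `n.choose k * 2 ^ (n - k)` copies of the `k`-th tensor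
power of the standard representation. -/
noncomputable def evenSum (n : ℕ) : Representation ℂ SL(2, ℤ)
    (DirectSum (EvenIndex n) fun i => ⨂[ℂ] _ : Fin (i.1 : ℕ), (Fin 2 → ℂ)) :=
  Representation.directSum fun i : EvenIndex n => stdPow (i.1 : ℕ)

end ModularRep

/-!
The element `C = K K̄` of the double is central with `C² = 1`, so the double is the product of the
blocks cut out by the idempotents `e₊ = (1 + C) / 2` and `e₋ = (1 - C) / 2`. Besides the
anticommutations, the only relation between the odd generators is
`ξᵢ ξ̄ⱼ + ξ̄ⱼ ξᵢ = δᵢⱼ (1 - C)`: they generate an exterior algebra over `e₊` and a Clifford algebra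
over `e₋`. All computations take place in an abstract algebra `A` with generators subject to these
relations (`DoubleGens A n`). At each site `i` there are four letters, `1`, `ξᵢ`, `ξ̄ᵢ` and
`γᵢ = (ξᵢ ξ̄ᵢ - ξ̄ᵢ ξᵢ) / 2`, and the elements `e_± K ^ a x₁ ⋯ xₙ`, where `xᵢ` is a letter at `i`, form
a basis, called monomials here. In this basis everything factorizes over the sites:

* The center is spanned by the central monomials (`DoubleGens.center_eq`). These are `e₊ x₁ ⋯ xₙ`
  with an even number of odd letters, and the three elements `z₀ = e₊ K γ₁ ⋯ γₙ`, `z₁ = e₋` and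
  `z₂ = e₋ K γ₁ ⋯ γₙ`.
* The trace map kills all monomials but three, which it sends to nonzero multiples of `z₀`, `z₁` and
  `z₂`; so these span the Higman ideal (`DNichols.higman_eq`). The other central monomials span
  `Z_Λ` (`DNichols.zLambda_eq`).
* The ribbon element is the product of `(1 + K - K̄ + K K̄) / 2` and of the factors `1 - ξᵢ ξ̄ᵢ`
  (`DNichols.nu_eq`). Multiplication by it fixes `z₀`, exchanges `z₁` and `z₂`, and multiplies the
  letter at each site of `e₊ x₁ ⋯ xₙ` by `1 - γᵢ`.
* The `R`-matrix is the product of a group-like part and of the factors `1 + K ξᵢ ⊗ ξ̄ᵢ`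
  (`DNichols.R_eq`), and the integral is a Berezin integral, which reads off the coefficient of the
  product of all `ξ̄ᵢ ξᵢ` (`DNichols.isBerezin_cointegral`). Therefore `(-1) ^ m` times the
  Lyubashenko–Majid map exchanges `z₀` and `z₁`, fixes `z₂`, and on `e₊ x₁ ⋯ xₙ` replaces `γᵢ` by
  `-1`, `1` by `γᵢ`, and keeps `ξᵢ` and `ξ̄ᵢ`.

Hence on `e₊ x₁ ⋯ xₙ` the letters `1` and `γᵢ` at a site span a copy of the standard representation,
while `ξᵢ` and `ξ̄ᵢ` span two trivial ones. Choosing the `k` sites of the first kind and one of the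
two odd letters at each other site, with `n - k` (equivalently `k`) even, gives the decomposition of
`Z_Λ` (`DoubleGens.evenMap`). On the span of `z₀`, `z₁`, `z₂` the two generators act by
transpositions; the invariant vector `z₀ + z₁ + z₂` and the remaining two-dimensional part give the
trivial representation and `N₁` (`DoubleGens.higMap`). Since `S` and `T` already come from these
representations, no relation of `SL(2, ℤ)` has to be checked on the center: the representation on
the center is obtained by transport along the linear isomorphism given by the two maps.
-/

/-! ### Ordered products -/

namespace OrderedProducts

variable {ι A : Type*} [Ring A] [Algebra ℂ A]

theorem mul_prod_of_smul (L : List ι) (x : ι → A) (u : A) (s : ι → ℂ)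
    (h : ∀ i ∈ L, u * x i = s i • (x i * u)) :
    u * (L.map x).prod = (L.map s).prod • ((L.map x).prod * u) := by
  induction L with
  | nil => simp
  | cons i L ih =>
    simp only [List.map_cons, List.prod_cons]
    rw [← mul_assoc, h i (by simp), smul_mul_assoc, mul_assoc,
      ih fun j hj => h j (by simp [hj]), mul_smul_comm, smul_smul, mul_assoc]

theorem prod_mul_prod {A : Type*} [Ring A] (L : List ι) (hL : L.Nodup) (x y : ι → A)
    (h : ∀ i j, i ≠ j → Commute (y i) (x j)) :
    (L.map x).prod * (L.map y).prod = (L.map fun i => x i * y i).prod := by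
  induction L with
  | nil => simp
  | cons i L ih =>
    rw [List.nodup_cons] at hL
    simp only [List.map_cons, List.prod_cons]
    have hc : Commute (y i) (L.map x).prod := by
      apply Commute.list_prod_right
      intro z hz
      obtain ⟨j, hj, rfl⟩ := List.mem_map.mp hz
      exact h i j (by rintro rfl; exact hL.1 hj)
    rw [← ih hL.2, mul_assoc, ← mul_assoc _ (y i), ← hc.eq]
    simp only [mul_assoc]

/-- The exponent `k (k - 1) / 2` counts the transpositions that unshuffle `x₁ y₁ ⋯ x_k y_k` into
`x₁ ⋯ x_k y₁ ⋯ y_k`. -/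
theorem prod_mul_filter (L : List ι) (hL : L.Nodup) (x y : ι → A) (P : ι → Prop)
    [DecidablePred P] (h : ∀ i j, i ≠ j → y i * x j = -(x j * y i)) :
    (L.map fun i => if P i then x i * y i else 1).prod =
      (-1 : ℂ) ^ ((L.countP P) * (L.countP P - 1) / 2) •
        ((L.map fun i => if P i then x i else 1).prod *
          (L.map fun i => if P i then y i else 1).prod) := by
  induction L with
  | nil => simp
  | cons i L ih =>
    rw [List.nodup_cons] at hL
    simp only [List.map_cons, List.prod_cons]
    rw [ih hL.2]
    by_cases hi : P i
    · rw [if_pos hi, if_pos hi, if_pos hi, List.countP_cons_of_pos (by simpa using hi)]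
      have hc : y i * (L.map fun j => if P j then x j else 1).prod =
          (-1 : ℂ) ^ (L.countP P) • ((L.map fun j => if P j then x j else 1).prod * y i) := by
        rw [mul_prod_of_smul L _ (y i) (fun j => if P j then -1 else 1)]
        · congr 1
          clear ih hL
          induction L with
          | nil => simp
          | cons j L ih => by_cases hj : P j <;> simp [hj, ih, pow_succ]
        · intro j hj
          have hij : i ≠ j := by rintro rfl; exact hL.1 hj
          by_cases hPj : P j <;> simp [hPj, h i j hij]
      set k := L.countP P
      have e1 : (k + 1) * (k + 1 - 1) / 2 = k * (k - 1) / 2 + k := by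
        have h2 : (k + 1) * (k + 1 - 1) = k * (k - 1) + 2 * k := by
          cases k with
          | zero => rfl
          | succ k => simp only [Nat.add_sub_cancel]; ring
        rw [h2, Nat.add_mul_div_left _ _ two_pos]
      rw [e1, pow_add, mul_smul_comm, mul_smul]
      congr 1
      rw [mul_assoc, ← mul_assoc (y i), hc, smul_mul_assoc, mul_smul_comm]
      simp only [mul_assoc]
    · simp only [if_neg hi, one_mul]
      rw [List.countP_cons_of_neg (by simpa using hi)]

variable {n : ℕ}

/-- The product `x 0 * x 1 * ⋯ * x (n - 1)`. -/
def oprod {A : Type*} [Monoid A] (x : Fin n → A) : A := ((List.finRange n).map x).prod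

theorem oprod_eq_mkPiAlgebraFin (x : Fin n → A) :
    oprod x = MultilinearMap.mkPiAlgebraFin ℂ n A x := by
  rw [MultilinearMap.mkPiAlgebraFin_apply, List.ofFn_eq_map, oprod]

theorem orderedProd_eq_oprod {A : Type*} [Monoid A] (x : Fin n → A) (S : Finset (Fin n)) :
    Nichols.orderedProd x S = oprod fun i => if i ∈ S then x i else 1 := rfl

theorem oprod_one {A : Type*} [Monoid A] : oprod (fun _ : Fin n => (1 : A)) = 1 := by
  simp [oprod]

theorem oprod_sum {κ : Type*} [Fintype κ] [DecidableEq κ] (x : Fin n → κ → A) :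
    oprod (fun i => ∑ k, x i k) = ∑ r : Fin n → κ, oprod fun i => x i (r i) := by
  simp only [oprod_eq_mkPiAlgebraFin]
  exact MultilinearMap.map_sum _ x

theorem oprod_one_add (z : Fin n → A) :
    oprod (fun i => 1 + z i) = ∑ S : Finset (Fin n), Nichols.orderedProd z S := by
  simp only [orderedProd_eq_oprod, oprod_eq_mkPiAlgebraFin]
  rw [show (fun i => 1 + z i) = z + 1 by ext i; simp [add_comm], MultilinearMap.map_add_univ]
  refine Finset.sum_congr rfl fun S _ => ?_
  congr 1

theorem oprod_smul (c : Fin n → ℂ) (x : Fin n → A) :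
    oprod (fun i => c i • x i) = (∏ i, c i) • oprod x := by
  simp only [oprod_eq_mkPiAlgebraFin]
  exact MultilinearMap.map_smul_univ _ c x

theorem oprod_mul_oprod {A : Type*} [Ring A] (x y : Fin n → A)
    (h : ∀ i j, i ≠ j → Commute (y i) (x j)) :
    oprod x * oprod y = oprod fun i => x i * y i :=
  prod_mul_prod _ (List.nodup_finRange n) x y h

theorem mul_oprod_of_smul (x : Fin n → A) (u : A) (s : Fin n → ℂ)
    (h : ∀ i, u * x i = s i • (x i * u)) : u * oprod x = (∏ i, s i) • (oprod x * u) := by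
  rw [oprod, mul_prod_of_smul _ x u s fun i _ => h i]
  rw [← List.ofFn_eq_map, List.prod_ofFn]

/-- If `u v i = v i' u` at every site, then `u` passes through the ordered product. -/
theorem mul_oprod_comm {A : Type*} [Ring A] (u : A) (x y : Fin n → A)
    (h : ∀ i, u * x i = y i * u) :
    u * oprod x = oprod y * u := by
  unfold oprod
  induction List.finRange n with
  | nil => simp
  | cons i L ih =>
    simp only [List.map_cons, List.prod_cons]
    rw [← mul_assoc, h, mul_assoc, ih, mul_assoc]

theorem mul_oprod_congr {A : Type*} [Ring A] (u : A) (hu : ∀ w, Commute u w) (x y : Fin n → A)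
    (h : ∀ i, u * x i = u * y i) : u * oprod x = u * oprod y := by
  unfold oprod
  induction List.finRange n with
  | nil => rfl
  | cons i L ih =>
    simp only [List.map_cons, List.prod_cons]
    rw [← mul_assoc, h, (hu _).eq, mul_assoc, ih, ← mul_assoc, ← (hu _).eq, mul_assoc]

theorem orderedProd_mul (x y : Fin n → A) (S : Finset (Fin n))
    (h : ∀ i j, i ≠ j → y i * x j = -(x j * y i)) :
    Nichols.orderedProd (fun i => x i * y i) S =
      (-1 : ℂ) ^ (S.card * (S.card - 1) / 2) •
        (Nichols.orderedProd x S * Nichols.orderedProd y S) := by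
  have e : (List.finRange n).countP (fun i => decide (i ∈ S)) = S.card := by
    rw [List.countP_eq_length_filter, ← List.toFinset_card_of_nodup
      ((List.nodup_finRange n).filter _)]
    congr 1
    ext i
    simp
  have := prod_mul_filter (List.finRange n) (List.nodup_finRange n) x y (· ∈ S) h
  rw [e] at this
  exact this

theorem oprod_mul (x y : Fin n → A) (h : ∀ i j, i ≠ j → y i * x j = -(x j * y i)) :
    oprod (fun i => x i * y i) = (-1 : ℂ) ^ (n * (n - 1) / 2) • (oprod x * oprod y) := by
  have := orderedProd_mul x y Finset.univ h
  simpa only [orderedProd_eq_oprod, Finset.mem_univ, if_true, Finset.card_univ,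
    Fintype.card_fin] using this

theorem oprod_const {A : Type*} [Monoid A] (a : A) : oprod (fun _ : Fin n => a) = a ^ n := by
  simp [oprod]

theorem oprod_tmul {B : Type*} [Ring B] [Algebra ℂ B] (x : Fin n → A) (y : Fin n → B) :
    oprod (fun i => x i ⊗ₜ[ℂ] y i) = oprod x ⊗ₜ[ℂ] oprod y := by
  unfold oprod
  induction List.finRange n with
  | nil => rfl
  | cons i L ih =>
    simp only [List.map_cons, List.prod_cons, ih, Algebra.TensorProduct.tmul_mul_tmul]

theorem map_oprod {A B : Type*} [Monoid A] [Monoid B] (f : A →* B) (x : Fin n → A) :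
    f (oprod x) = oprod fun i => f (x i) := by
  rw [oprod, map_list_prod, List.map_map, oprod]
  rfl

/-- The ordered product as a product before, at, and after the site `i`. -/
theorem oprod_split {A : Type*} [Monoid A] (i : Fin n) : ∃ L₁ L₂ : List (Fin n),
    (i ∉ L₁ ∧ i ∉ L₂ ∧ (∀ s : Fin n → ℂ, ∏ j ∈ Finset.univ.erase i, s j =
      (L₁.map s).prod * (L₂.map s).prod)) ∧ ∀ x : Fin n → A,
    oprod x = (L₁.map x).prod * x i * (L₂.map x).prod := by
  obtain ⟨L₁, L₂, h⟩ := List.append_of_mem (List.mem_finRange i)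
  have hnd := List.nodup_finRange n
  rw [h, List.nodup_append] at hnd
  obtain ⟨h1, h2, h3⟩ := hnd
  rw [List.nodup_cons] at h2
  have hi1 : i ∉ L₁ := fun hi => h3 i hi i (by simp) rfl
  refine ⟨L₁, L₂, ⟨hi1, h2.1, fun s => ?_⟩, fun x => ?_⟩
  · rw [← List.prod_append, ← List.map_append, ← List.prod_toFinset]
    · congr 1
      ext j
      have := List.mem_finRange j
      rw [h] at this
      simp only [List.mem_append, List.mem_cons] at this
      simp only [Finset.mem_erase, Finset.mem_univ, and_true, List.mem_toFinset, List.mem_append]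
      constructor
      · tauto
      · rintro (hj | hj) rfl
        · exact hi1 hj
        · exact h2.1 hj
    · rw [List.nodup_append]
      exact ⟨h1, h2.2, fun a ha b hb => h3 a ha b (by simp [hb])⟩
  · rw [oprod, h]
    simp [mul_assoc]

end OrderedProducts

/-! ### The double in terms of generators and relations -/

open OrderedProducts

/-- Generators of an algebra of dimension `4 ^ (n + 1)` that satisfy the relations of the double of
the Nichols Hopf algebra. The odd generators are indexed by a flag: `ξ true i` stands for `ξ_i`, and
`ξ false i` for `ξ̄_i`. -/
structure DoubleGens (A : Type*) [Ring A] [Algebra ℂ A] (n : ℕ) where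
  /-- The group-like generator `K`. -/
  K : A
  /-- The group-like generator `K̄`. -/
  Kb : A
  /-- The odd generators. -/
  ξ : Bool → Fin n → A
  K_mul_K : K * K = 1
  Kb_mul_Kb : Kb * Kb = 1
  K_mul_Kb : K * Kb = Kb * K
  K_mul_ξ : ∀ b i, K * ξ b i = -(ξ b i * K)
  Kb_mul_ξ : ∀ b i, Kb * ξ b i = -(ξ b i * Kb)
  ξ_mul_ξ : ∀ b c i j, i ≠ j → ξ b i * ξ c j = -(ξ c j * ξ b i)
  ξ_sq : ∀ b i, ξ b i * ξ b i = 0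
  ξ_anticomm : ∀ i, ξ true i * ξ false i + ξ false i * ξ true i = 1 - K * Kb
  adjoin_eq_top : Algebra.adjoin ℂ ({K, Kb} ∪ Set.range fun p : Bool × Fin n => ξ p.1 p.2) = ⊤
  finrank_eq : Module.finrank ℂ A = 4 * 4 ^ n

/-- A letter of a monomial at one site: `(1, 0)` stands for `ξ_i`, `(0, 1)` for `ξ̄_i`, and `(1, 1)`
for their normalised commutator. -/
abbrev Letter : Type := Bool × Bool

/-- The sign `1` or `-1` of a flag. -/
def sg (b : Bool) : ℂ := if b then 1 else -1

@[simp] theorem sg_true : sg true = 1 := rfl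
@[simp] theorem sg_false : sg false = -1 := rfl
@[simp] theorem sg_not (b : Bool) : sg (!b) = -sg b := by cases b <;> simp
@[simp] theorem sg_mul_self (b : Bool) : sg b * sg b = 1 := by cases b <;> simp

/-- The parity sign of a letter. -/
def sgnL (l : Letter) : ℂ := sg (l.1 == l.2)

theorem sgnL_mul_self (l : Letter) : sgnL l * sgnL l = 1 := sg_mul_self _

/-- The parity sign of a monomial. -/
def parity {n : ℕ} (g : Fin n → Letter) : ℂ := ∏ i, sgnL (g i)

/-- The parity sign of a monomial with the letter at the site `i` omitted. -/
def parityErase {n : ℕ} (g : Fin n → Letter) (i : Fin n) : ℂ :=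
  ∏ j ∈ Finset.univ.erase i, sgnL (g j)

theorem parity_eq {n : ℕ} (g : Fin n → Letter) (i : Fin n) :
    parity g = sgnL (g i) * parityErase g i :=
  (Finset.mul_prod_erase _ _ (Finset.mem_univ i)).symm

theorem parity_mul_self {n : ℕ} (g : Fin n → Letter) : parity g * parity g = 1 := by
  rw [parity, ← Finset.prod_mul_distrib]
  simp [sgnL_mul_self]

namespace DoubleGens

variable {A : Type*} [Ring A] [Algebra ℂ A] {n : ℕ} (D : DoubleGens A n)

/-- The central group-like element `C = K K̄`. -/
def C : A := D.K * D.Kb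

theorem K_mul_C : D.K * D.C = D.Kb := by rw [C, ← mul_assoc, D.K_mul_K, one_mul]

theorem C_mul_K : D.C * D.K = D.Kb := by rw [C, D.K_mul_Kb, mul_assoc, D.K_mul_K, mul_one]

theorem C_mul_C : D.C * D.C = 1 := by
  rw [C, mul_assoc, ← mul_assoc D.Kb, ← D.K_mul_Kb, mul_assoc, D.Kb_mul_Kb, mul_one, D.K_mul_K]

theorem C_mul_ξ (b : Bool) (i : Fin n) : D.C * D.ξ b i = D.ξ b i * D.C := by
  rw [C, mul_assoc, D.Kb_mul_ξ, mul_neg, ← mul_assoc, D.K_mul_ξ, neg_mul, neg_neg, mul_assoc]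

/-- An element that commutes with the generators is central. -/
theorem commute_of_gens {z : A} (hK : Commute z D.K) (hKb : Commute z D.Kb)
    (hξ : ∀ b i, Commute z (D.ξ b i)) (w : A) : Commute z w := by
  have h : w ∈ Algebra.adjoin ℂ ({D.K, D.Kb} ∪ Set.range fun p : Bool × Fin n => D.ξ p.1 p.2) := by
    rw [D.adjoin_eq_top]; trivial
  induction h using Algebra.adjoin_induction with
  | mem w hw =>
    rcases hw with (rfl | rfl) | ⟨⟨b, i⟩, rfl⟩
    exacts [hK, hKb, hξ b i]
  | algebraMap r => exact (Algebra.commutes r z).symm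
  | add _ _ _ _ h1 h2 => exact h1.add_right h2
  | mul _ _ _ _ h1 h2 => exact h1.mul_right h2

theorem commute_C (w : A) : Commute D.C w :=
  D.commute_of_gens (D.C_mul_K.trans D.K_mul_C.symm)
    (by rw [Commute, SemiconjBy, C, mul_assoc, D.Kb_mul_Kb, ← mul_assoc, ← D.K_mul_Kb, mul_assoc,
      D.Kb_mul_Kb]) D.C_mul_ξ w

/-- The central idempotents `e_± = (1 ± C) / 2`. -/
noncomputable def e (s : Bool) : A := (1 / 2 : ℂ) • (1 + sg s • D.C)

theorem commute_e (s : Bool) (w : A) : Commute (D.e s) w :=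
  ((Commute.one_left w).add_left ((D.commute_C w).smul_left _)).smul_left _

theorem C_mul_e (s : Bool) : D.C * D.e s = sg s • D.e s := by
  rw [e, mul_smul_comm, mul_add, mul_smul_comm, D.C_mul_C, mul_one, smul_comm]
  congr 1
  rw [smul_add, smul_smul, sg_mul_self, one_smul, add_comm]

theorem e_mul_C (s : Bool) : D.e s * D.C = sg s • D.e s := by rw [← D.C_mul_e, D.commute_C]

theorem e_mul_e (s t : Bool) : D.e s * D.e t = if s = t then D.e s else 0 := by
  conv_lhs => rw [e]
  rw [smul_mul_assoc, add_mul, one_mul, smul_mul_assoc, D.C_mul_e]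
  cases s <;> cases t <;> simp [← two_smul ℂ (D.e _), smul_smul]

theorem e_mul_self (s : Bool) : D.e s * D.e s = D.e s := by rw [e_mul_e, if_pos rfl]

theorem e_add_e : D.e true + D.e false = 1 := by
  simp only [e, ← smul_add, sg_true, sg_false, one_smul, neg_smul]
  rw [show (1 : A) + D.C + (1 + -D.C) = (2 : ℂ) • 1 by rw [two_smul]; abel, smul_smul]
  norm_num

theorem e_mul_Kb (s : Bool) : D.e s * D.Kb = sg s • (D.e s * D.K) := by
  rw [← D.C_mul_K, ← mul_assoc, e_mul_C, smul_mul_assoc]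

theorem one_sub_C : 1 - D.C = (2 : ℂ) • D.e false := by
  rw [e, smul_smul]; norm_num [sub_eq_add_neg]

/-- The normalised commutator `γ_i = (ξ_i ξ̄_i - ξ̄_i ξ_i) / 2`. -/
noncomputable def γ (i : Fin n) : A :=
  (1 / 2 : ℂ) • (D.ξ true i * D.ξ false i - D.ξ false i * D.ξ true i)

theorem ξ_mul_ξ_not (b : Bool) (i : Fin n) :
    D.ξ b i * D.ξ (!b) i = sg b • D.γ i + D.e false := by
  have h := D.ξ_anticomm i
  have h2 : D.e false = (1 / 2 : ℂ) • (D.ξ true i * D.ξ false i + D.ξ false i * D.ξ true i) := by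
    rw [h, ← C, one_sub_C, smul_smul]; norm_num
  rw [h2, γ]
  cases b
  · simp only [Bool.not_false, sg_false]; module
  · simp only [Bool.not_true, sg_true]; module

theorem ξ_mul_ξ_not' (b : Bool) (i : Fin n) :
    D.ξ (!b) i * D.ξ b i = D.e false - sg b • D.γ i := by
  have := D.ξ_mul_ξ_not (!b) i
  rw [Bool.not_not] at this
  rw [this, sg_not, neg_smul]; abel

theorem γ_eq (b : Bool) (i : Fin n) :
    D.γ i = sg b • (D.ξ b i * D.ξ (!b) i - D.e false) := by
  rw [ξ_mul_ξ_not, add_sub_cancel_right, smul_smul, sg_mul_self, one_smul]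

theorem γ_mul_ξ (b : Bool) (i : Fin n) : D.γ i * D.ξ b i = sg b • (D.e false * D.ξ b i) := by
  have h : D.γ i = sg b • (D.e false - D.ξ (!b) i * D.ξ b i) := by
    rw [ξ_mul_ξ_not', sub_sub_cancel, smul_smul, sg_mul_self, one_smul]
  rw [h, smul_mul_assoc, sub_mul, mul_assoc, D.ξ_sq, mul_zero, sub_zero]

theorem ξ_mul_γ (b : Bool) (i : Fin n) : D.ξ b i * D.γ i = -(sg b • (D.e false * D.ξ b i)) := by
  rw [γ_eq D b, mul_smul_comm, mul_sub, ← mul_assoc, D.ξ_sq, zero_mul, zero_sub, smul_neg,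
    D.commute_e]

theorem γ_mul_γ (i : Fin n) : D.γ i * D.γ i = D.e false := by
  have h3 := D.ξ_mul_ξ_not true i
  simp only [Bool.not_true, sg_true, one_smul] at h3
  have h1 := D.γ_mul_ξ true i
  rw [sg_true, one_smul] at h1
  calc D.γ i * D.γ i = D.γ i * (D.ξ true i * D.ξ false i - D.e false) := by
        rw [h3, add_sub_cancel_right]
    _ = D.e false * (D.γ i + D.e false) - D.e false * D.γ i := by
        rw [mul_sub, ← mul_assoc, h1, mul_assoc, h3, D.commute_e false (D.γ i)]
    _ = D.e false := by rw [mul_add, D.e_mul_self, add_sub_cancel_left]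

theorem K_mul_γ (i : Fin n) : D.K * D.γ i = D.γ i * D.K := by
  have h : ∀ b c, D.K * (D.ξ b i * D.ξ c i) = D.ξ b i * D.ξ c i * D.K := fun b c => by
    rw [← mul_assoc, D.K_mul_ξ, neg_mul, mul_assoc, D.K_mul_ξ, mul_neg, neg_neg, mul_assoc]
  rw [γ, mul_smul_comm, smul_mul_assoc, mul_sub, sub_mul, h, h]

theorem ξ_commute_γ (b : Bool) {i j : Fin n} (hij : i ≠ j) :
    D.ξ b i * D.γ j = D.γ j * D.ξ b i := by
  have h : ∀ c d, D.ξ b i * (D.ξ c j * D.ξ d j) = D.ξ c j * D.ξ d j * D.ξ b i := fun c d => by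
    rw [← mul_assoc, D.ξ_mul_ξ _ _ _ _ hij, neg_mul, mul_assoc, D.ξ_mul_ξ _ _ _ _ hij, mul_neg,
      neg_neg, mul_assoc]
  rw [γ, mul_smul_comm, smul_mul_assoc, mul_sub, sub_mul, h, h]

/-- The element of the algebra given by a letter at a site. -/
noncomputable def letter (i : Fin n) : Letter → A
  | (false, false) => 1
  | (true, true) => D.γ i
  | (true, false) => D.ξ true i
  | (false, true) => D.ξ false i

@[simp] theorem letter_ff (i : Fin n) : D.letter i (false, false) = 1 := rfl
@[simp] theorem letter_tt (i : Fin n) : D.letter i (true, true) = D.γ i := rfl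
@[simp] theorem letter_tf (i : Fin n) : D.letter i (true, false) = D.ξ true i := rfl
@[simp] theorem letter_ft (i : Fin n) : D.letter i (false, true) = D.ξ false i := rfl

theorem letter_odd (i : Fin n) (b : Bool) : D.letter i (b, !b) = D.ξ b i := by cases b <;> rfl

theorem K_mul_letter (i : Fin n) (l : Letter) :
    D.K * D.letter i l = sgnL l • (D.letter i l * D.K) := by
  rcases l with ⟨_ | _, _ | _⟩ <;> simp [sgnL, K_mul_γ, K_mul_ξ]

theorem ξ_mul_letter (b : Bool) {i j : Fin n} (hij : i ≠ j) (l : Letter) :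
    D.ξ b i * D.letter j l = sgnL l • (D.letter j l * D.ξ b i) := by
  rcases l with ⟨_ | _, _ | _⟩ <;> simp [sgnL, D.ξ_commute_γ b hij, D.ξ_mul_ξ _ _ _ _ hij]

/-- The monomial with the letter `g i` at the site `i`. -/
noncomputable def X (g : Fin n → Letter) : A := oprod fun i => D.letter i (g i)

theorem K_mul_X (g : Fin n → Letter) : D.K * D.X g = parity g • (D.X g * D.K) :=
  mul_oprod_of_smul _ _ _ fun i => D.K_mul_letter i (g i)

/-- A monomial seen from the site `i`: the odd elements at `i` pass the letters on either side up to
signs, whose product is the parity of the letters at the other sites. -/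
theorem X_split (g : Fin n → Letter) (i : Fin n) : ∃ (P Q : A) (s t : ℂ),
    s * s = 1 ∧ t * t = 1 ∧ s * t = parityErase g i ∧
    (∀ l, D.X (Function.update g i l) = P * D.letter i l * Q) ∧
    (∀ b, D.ξ b i * P = s • (P * D.ξ b i)) ∧ (∀ b, Q * D.ξ b i = t • (D.ξ b i * Q)) ∧
    D.X g = P * D.letter i (g i) * Q ∧ D.K * P = s • (P * D.K) := by
  obtain ⟨L₁, L₂, ⟨h1, h2, h3⟩, h⟩ := oprod_split (A := A) i
  have hsq : ∀ L : List (Fin n), (L.map fun j => sgnL (g j)).prod *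
      (L.map fun j => sgnL (g j)).prod = 1 := fun L => by
    rw [← List.prod_map_mul]
    simp [sgnL_mul_self]
  have hX : ∀ l, D.X (Function.update g i l) = (L₁.map fun j => D.letter j (g j)).prod *
      D.letter i l * (L₂.map fun j => D.letter j (g j)).prod := fun l => by
    rw [X, h]
    congr 1
    · congr 1
      · congr 1
        refine List.map_congr_left fun j hj => ?_
        rw [Function.update_of_ne (by rintro rfl; exact h1 hj)]
      · rw [Function.update_self]
    · congr 1
      refine List.map_congr_left fun j hj => ?_
      rw [Function.update_of_ne (by rintro rfl; exact h2 hj)]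
  have hmul : ∀ L : List (Fin n), i ∉ L → ∀ b, D.ξ b i * (L.map fun j => D.letter j (g j)).prod =
      (L.map fun j => sgnL (g j)).prod • ((L.map fun j => D.letter j (g j)).prod * D.ξ b i) :=
    fun L hL b => mul_prod_of_smul L _ _ _ fun j hj =>
      D.ξ_mul_letter b (by rintro rfl; exact hL hj) _
  refine ⟨_, _, _, _, hsq L₁, hsq L₂, (h3 fun j => sgnL (g j)).symm, hX, hmul L₁ h1, ?_, ?_, ?_⟩
  · intro b
    rw [hmul L₂ h2 b, smul_smul, hsq, one_smul]
  · rw [← hX, Function.update_eq_self]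
  · exact mul_prod_of_smul L₁ _ _ _ fun j _ => D.K_mul_letter j (g j)

/-- The power of `K` given by a flag. -/
def Kp (a : Bool) : A := if a then D.K else 1

@[simp] theorem Kp_true : D.Kp true = D.K := rfl
@[simp] theorem Kp_false : D.Kp false = 1 := rfl

theorem K_mul_Kp (a : Bool) : D.K * D.Kp a = D.Kp (!a) := by
  cases a <;> simp [D.K_mul_K]

theorem Kp_mul_K (a : Bool) : D.Kp a * D.K = D.Kp (!a) := by
  cases a <;> simp [D.K_mul_K]

theorem ξ_mul_Kp (b : Bool) (i : Fin n) (a : Bool) :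
    D.ξ b i * D.Kp a = sg (!a) • (D.Kp a * D.ξ b i) := by
  cases a <;> simp [D.K_mul_ξ]

/-- Indices of the monomial basis: the sign of `C`, the exponent of `K`, and the letters. -/
abbrev Idx (n : ℕ) : Type := Bool × Bool × (Fin n → Letter)

/-- The monomial `e_± K ^ a X_g`. -/
noncomputable def mono (p : Idx n) : A := D.e p.1 * (D.Kp p.2.1 * D.X p.2.2)

theorem K_mul_mono (s a : Bool) (g : Fin n → Letter) :
    D.K * D.mono (s, a, g) = D.mono (s, !a, g) := by
  rw [mono, ← mul_assoc, ← D.commute_e s, mul_assoc, ← mul_assoc D.K, K_mul_Kp, mono]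

theorem mono_mul_K (s a : Bool) (g : Fin n → Letter) :
    D.mono (s, a, g) * D.K = parity g • D.mono (s, !a, g) := by
  have h : D.X g * D.K = parity g • (D.K * D.X g) := by
    rw [K_mul_X, smul_smul, parity_mul_self, one_smul]
  rw [mono, mul_assoc, mul_assoc, h, mono, mul_smul_comm, mul_smul_comm, ← mul_assoc _ D.K,
    Kp_mul_K]

theorem Kb_mul_mono (s a : Bool) (g : Fin n → Letter) :
    D.Kb * D.mono (s, a, g) = sg s • D.mono (s, !a, g) := by
  rw [← K_mul_mono, mono, ← mul_assoc, ← D.commute_e s, e_mul_Kb, smul_mul_assoc, D.commute_e s,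
    mul_assoc]

theorem mono_mul_Kb (s a : Bool) (g : Fin n → Letter) :
    D.mono (s, a, g) * D.Kb = (sg s * parity g) • D.mono (s, !a, g) := by
  have h : D.mono (s, a, g) * D.Kb = sg s • (D.mono (s, a, g) * D.K) := by
    rw [mono, mul_assoc, (D.commute_e s _).eq, mul_assoc, ← (D.commute_e s _).eq, e_mul_Kb,
      mul_smul_comm, (D.commute_e s _).eq, ← mul_assoc, ← (D.commute_e s _).eq]
    simp only [mul_assoc]
  rw [h, mono_mul_K, smul_smul]

/-- The terms of the product of an odd generator and a letter. -/
theorem e_mul_ξ_mul_letter (s b : Bool) (i : Fin n) (l : Letter) : ∃ c d : ℂ, ∃ l₁ l₂ : Letter,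
    D.e s * (D.ξ b i * D.letter i l) =
      c • (D.e s * D.letter i l₁) + d • (D.e s * D.letter i l₂) := by
  have hes : ∃ m : ℂ, D.e s * D.e false = m • D.e s := by
    cases s
    · exact ⟨1, by rw [e_mul_self, one_smul]⟩
    · exact ⟨0, by rw [e_mul_e]; simp⟩
  obtain ⟨m, hm⟩ := hes
  rcases l with ⟨l, l'⟩
  by_cases hl : l = l'
  · subst hl
    cases l
    · refine ⟨1, 0, (b, !b), (b, !b), ?_⟩
      rw [letter_odd]; simp
    · refine ⟨-(sg b * m), 0, (b, !b), (b, !b), ?_⟩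
      rw [letter_odd, letter_tt, ξ_mul_γ, mul_neg, mul_smul_comm, ← mul_assoc, hm, smul_mul_assoc]
      module
  · obtain rfl : l' = !l := by cases l <;> cases l' <;> simp_all
    rw [letter_odd]
    by_cases hb : b = l
    · subst hb
      exact ⟨0, 0, (b, b), (b, b), by rw [D.ξ_sq]; simp⟩
    · obtain rfl : l = !b := by cases l <;> cases b <;> simp_all
      refine ⟨sg b, m, (true, true), (false, false), ?_⟩
      rw [ξ_mul_ξ_not, mul_add, mul_smul_comm, hm]
      simp

theorem span_mono : Submodule.span ℂ (Set.range D.mono) = ⊤ := by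
  set M := Submodule.span ℂ (Set.range D.mono)
  have hstable : ∀ u : A, (∀ p, u * D.mono p ∈ M) → ∀ z ∈ M, u * z ∈ M := by
    intro u hu z hz
    induction hz using Submodule.span_induction with
    | zero => simp
    | add a b _ _ ha hb => rw [mul_add]; exact add_mem ha hb
    | smul r a _ ha => rw [mul_smul_comm]; exact Submodule.smul_mem _ _ ha
    | mem a ha => obtain ⟨p, rfl⟩ := ha; exact hu p
  have hmem : ∀ p, D.mono p ∈ M := fun p => Submodule.subset_span ⟨p, rfl⟩
  have hgen : ∀ w : A, ∀ z ∈ M, w * z ∈ M := by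
    intro w
    have h : w ∈ Algebra.adjoin ℂ
        ({D.K, D.Kb} ∪ Set.range fun p : Bool × Fin n => D.ξ p.1 p.2) := by
      rw [D.adjoin_eq_top]; trivial
    induction h using Algebra.adjoin_induction with
    | mem w hw =>
      rcases hw with (rfl | rfl) | ⟨⟨b, i⟩, rfl⟩
      · exact hstable _ fun ⟨s, a, g⟩ => by rw [K_mul_mono]; exact hmem _
      · exact hstable _ fun ⟨s, a, g⟩ => by
          rw [Kb_mul_mono]; exact Submodule.smul_mem _ _ (hmem _)
      · refine hstable _ fun ⟨s, a, g⟩ => ?_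
        obtain ⟨P, Q, σ, τ, -, -, -, hX, hP, -, hg, -⟩ := D.X_split g i
        obtain ⟨c, d, l₁, l₂, hl⟩ := D.e_mul_ξ_mul_letter s b i (g i)
        have key : D.ξ b i * D.mono (s, a, g) = (sg (!a) * σ) •
            (D.Kp a * P * (D.e s * (D.ξ b i * D.letter i (g i))) * Q) := by
          rw [mono, ← mul_assoc, ← D.commute_e s, mul_assoc, ← mul_assoc (D.ξ b i), ξ_mul_Kp, hg]
          simp only [smul_mul_assoc, mul_smul_comm, mul_assoc, mul_smul]
          rw [← mul_assoc (D.ξ b i) P, hP]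
          simp only [smul_mul_assoc, mul_smul_comm, ← mul_assoc, ← (D.commute_e s _).eq]
        have hterm : ∀ l, D.Kp a * P * (D.e s * D.letter i l) * Q ∈ M := fun l => by
          have := hmem (s, a, Function.update g i l)
          rw [mono, hX] at this
          simp only [← mul_assoc, ← (D.commute_e s _).eq] at this ⊢
          exact this
        rw [key, hl]
        simp only [mul_add, add_mul, mul_smul_comm, smul_mul_assoc]
        exact Submodule.smul_mem _ _ (add_mem (Submodule.smul_mem _ _ (hterm _))
          (Submodule.smul_mem _ _ (hterm _)))
    | algebraMap r =>
      intro z hz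
      rw [← Algebra.smul_def]
      exact Submodule.smul_mem _ _ hz
    | add _ _ _ _ h1 h2 => intro z hz; rw [add_mul]; exact add_mem (h1 z hz) (h2 z hz)
    | mul _ _ _ _ h1 h2 => intro z hz; rw [mul_assoc]; exact h1 _ (h2 z hz)
  have hone : (1 : A) ∈ M := by
    have h : ∀ s, D.e s ∈ M := fun s => by
      have := hmem (s, false, fun _ => (false, false))
      simpa [mono, X, oprod_one] using this
    rw [← D.e_add_e]
    exact add_mem (h true) (h false)
  rw [eq_top_iff]
  intro z _
  simpa using hgen z 1 hone

/-- The monomials `e_± K ^ a X_g` form a basis. -/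
noncomputable def basis : Module.Basis (Idx n) ℂ A :=
  basisOfTopLeSpanOfCardEqFinrank D.mono D.span_mono.ge (by
    rw [D.finrank_eq]
    simp only [Fintype.card_prod, Fintype.card_bool, Fintype.card_pi, Finset.prod_const,
      Finset.card_univ, Fintype.card_fin]
    ring)

theorem basis_apply (p : Idx n) : D.basis p = D.mono p := by
  simp [basis]

end DoubleGens

/-! ### The center -/

namespace DoubleGens

/-- Whether a letter contains the generator with the given flag. -/
def hasBit (b : Bool) (l : Letter) : Bool := if b then l.1 else l.2

/-- Adjoin the generator with the given flag to a letter. -/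
def setBit (b : Bool) (l : Letter) : Letter := if b then (true, l.2) else (l.1, true)

/-- The coefficient in the product of an odd generator and a letter in the exterior algebra. -/
def extCoeff (b : Bool) (l : Letter) : ℂ := if hasBit b l then 0 else if l = (false, false) then 1
  else sg b

variable {A : Type*} [Ring A] [Algebra ℂ A] {n : ℕ} (D : DoubleGens A n)

theorem e_true_mul_e_false : D.e true * D.e false = 0 := by rw [e_mul_e]; simp

theorem e_mul_mono (s t a : Bool) (g : Fin n → Letter) :
    D.e s * D.mono (t, a, g) = if s = t then D.mono (t, a, g) else 0 := by
  rw [mono, ← mul_assoc, e_mul_e]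
  split_ifs with h
  · rw [h]
  · rw [zero_mul]

theorem e_true_mul_ξ_mul_letter (b : Bool) (i : Fin n) (l : Letter) :
    D.e true * (D.ξ b i * D.letter i l) = extCoeff b l • (D.e true * D.letter i (setBit b l)) ∧
    D.e true * (D.letter i l * D.ξ b i) =
      (sgnL l * extCoeff b l) • (D.e true * D.letter i (setBit b l)) := by
  have h0 := D.e_true_mul_e_false
  have hγ : D.e true * (D.ξ true i * D.ξ false i) = D.e true * D.γ i := by
    have := D.ξ_mul_ξ_not true i
    simp only [Bool.not_true, sg_true, one_smul] at this
    rw [this, mul_add, h0, add_zero]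
  have hγ' : D.e true * (D.ξ false i * D.ξ true i) = -(D.e true * D.γ i) := by
    have := D.ξ_mul_ξ_not false i
    simp only [Bool.not_false, sg_false, neg_smul, one_smul] at this
    rw [this, mul_add, h0, add_zero, mul_neg]
  have h1 : ∀ b, D.e true * (D.ξ b i * D.γ i) = 0 := fun b => by
    rw [ξ_mul_γ, mul_neg, mul_smul_comm, ← mul_assoc, h0]; simp
  have h2 : ∀ b, D.e true * (D.γ i * D.ξ b i) = 0 := fun b => by
    rw [γ_mul_ξ, mul_smul_comm, ← mul_assoc, h0]; simp
  rcases l with ⟨_ | _, _ | _⟩ <;> cases b <;>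
    simp [extCoeff, hasBit, setBit, sgnL, hγ, hγ', h1, h2, D.ξ_sq]

/-- In the sector `C = 1` the algebra is an exterior algebra extended by `K`. -/
theorem ξ_mul_mono_true (b : Bool) (i : Fin n) (a : Bool) (g : Fin n → Letter) : ∃ σ : ℂ,
    σ * σ = 1 ∧ D.ξ b i * D.mono (true, a, g) = (sg (!a) * σ * extCoeff b (g i)) •
      D.mono (true, a, Function.update g i (setBit b (g i))) ∧
    D.mono (true, a, g) * D.ξ b i = (parity g * σ * extCoeff b (g i)) •
      D.mono (true, a, Function.update g i (setBit b (g i))) := by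
  obtain ⟨P, Q, σ, τ, hσ, hτ, hστ, hX, hP, hQ, hg, -⟩ := D.X_split g i
  obtain ⟨h1, h2⟩ := D.e_true_mul_ξ_mul_letter b i (g i)
  have hmono : D.mono (true, a, Function.update g i (setBit b (g i))) =
      D.Kp a * P * (D.e true * D.letter i (setBit b (g i))) * Q := by
    rw [mono, hX]
    simp only [← mul_assoc, ← (D.commute_e true _).eq]
  refine ⟨σ, hσ, ?_, ?_⟩
  · have key : D.ξ b i * D.mono (true, a, g) = (sg (!a) * σ) •
        (D.Kp a * P * (D.e true * (D.ξ b i * D.letter i (g i))) * Q) := by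
      rw [mono, ← mul_assoc, ← D.commute_e true, mul_assoc, ← mul_assoc (D.ξ b i), ξ_mul_Kp, hg]
      simp only [smul_mul_assoc, mul_smul_comm, mul_assoc, mul_smul]
      rw [← mul_assoc (D.ξ b i) P, hP]
      simp only [smul_mul_assoc, mul_smul_comm, ← mul_assoc, ← (D.commute_e true _).eq]
    rw [key, h1, hmono]
    simp only [smul_mul_assoc, mul_smul_comm, smul_smul]
  · have key : D.mono (true, a, g) * D.ξ b i = τ •
        (D.Kp a * P * (D.e true * (D.letter i (g i) * D.ξ b i)) * Q) := by
      rw [mono, hg]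
      simp only [mul_assoc]
      rw [hQ]
      simp only [mul_smul_comm, ← mul_assoc, ← (D.commute_e true _).eq]
    have hτ' : τ = σ * parityErase g i := by rw [← hστ, ← mul_assoc, hσ, one_mul]
    rw [key, h2, hmono, parity_eq g i, hτ']
    simp only [smul_mul_assoc, mul_smul_comm, smul_smul]
    congr 1
    ring

theorem setBit_injective : ∀ (b : Bool) (l l' : Letter), hasBit b l = false →
    ¬hasBit b l' = true → setBit b l = setBit b l' → l' = l := by
  decide

theorem repr_eq_zero_of_diagonal (T : A →ₗ[ℂ] A) (μ : Idx n → ℂ)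
    (hT : ∀ p, T (D.mono p) = μ p • D.mono p) {z : A} (hz : T z = z) {p : Idx n} (hp : μ p ≠ 1) :
    D.basis.repr z p = 0 := by
  have h : D.basis.coord p ∘ₗ T = μ p • D.basis.coord p := by
    refine D.basis.ext fun q => ?_
    rw [LinearMap.comp_apply, basis_apply, hT, ← basis_apply]
    by_cases hq : q = p
    · subst hq; simp
    · simp [hq]
  have h2 := LinearMap.congr_fun h z
  simp only [LinearMap.comp_apply, hz, LinearMap.smul_apply, smul_eq_mul,
    Module.Basis.coord_apply] at h2
  have h3 : (μ p - 1) * D.basis.repr z p = 0 := by linear_combination -h2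
  exact (mul_eq_zero.mp h3).resolve_left (sub_ne_zero.mpr hp)

/-- The indices of the monomials that span the Higman ideal. -/
def higIdx (j : Fin 3) : Idx n :=
  ![(true, true, fun _ => (true, true)), (false, false, fun _ => (false, false)),
    (false, true, fun _ => (true, true))] j

/-- The indices of the central monomials. -/
def CentralIdx (p : Idx n) : Prop :=
  (p.1 = true ∧ p.2.1 = false ∧ parity p.2.2 = 1) ∨ ∃ j, p = higIdx j

variable {D} {z : A} (hz : ∀ w, Commute z w)
include hz

theorem parity_of_central {p : Idx n} (hp : D.basis.repr z p ≠ 0) : parity p.2.2 = 1 := by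
  by_contra h
  refine hp (D.repr_eq_zero_of_diagonal (LinearMap.mulLeft ℂ D.K ∘ₗ LinearMap.mulRight ℂ D.K)
    (fun p => parity p.2.2) ?_ ?_ h)
  · rintro ⟨s, a, g⟩
    rw [LinearMap.comp_apply, LinearMap.mulRight_apply, LinearMap.mulLeft_apply, mono_mul_K,
      mul_smul_comm, K_mul_mono, Bool.not_not]
  · rw [LinearMap.comp_apply, LinearMap.mulRight_apply, LinearMap.mulLeft_apply, (hz D.K).eq,
      ← mul_assoc, D.K_mul_K, one_mul]

/-- In the sector `C = -1` a central element is fixed by `z ↦ (ξ_i z ξ̄_i + ξ̄_i z ξ_i) / 2`, which is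
diagonal on monomials. -/
theorem letter_of_central_false {a : Bool} {g : Fin n → Letter}
    (hp : D.basis.repr z (false, a, g) ≠ 0) (i : Fin n) : g i = (a, a) := by
  have step : ∀ i, sg (!a) * parityErase g i *
      (if (g i).1 = (g i).2 then sg (!(g i).1) else 0) = 1 := by
    intro i
    by_contra h
    refine hp (D.repr_eq_zero_of_diagonal (LinearMap.mulLeft ℂ (D.e true) +
      LinearMap.mulLeft ℂ ((1 / 2 : ℂ) • D.e false) ∘ₗ
        (LinearMap.mulLeft ℂ (D.ξ true i) ∘ₗ LinearMap.mulRight ℂ (D.ξ false i) +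
        LinearMap.mulLeft ℂ (D.ξ false i) ∘ₗ LinearMap.mulRight ℂ (D.ξ true i)))
      (fun p => if p.1 then 1 else sg (!p.2.1) * parityErase p.2.2 i *
        (if (p.2.2 i).1 = (p.2.2 i).2 then sg (!(p.2.2 i).1) else 0)) ?_ ?_ (by simpa using h))
    · rintro ⟨s, a, g⟩
      simp only [LinearMap.add_apply, LinearMap.comp_apply, LinearMap.mulRight_apply,
        LinearMap.mulLeft_apply]
      rw [e_mul_mono]
      have hcomm : ∀ b c, (1 / 2 : ℂ) • D.e false * (D.ξ b i * (D.mono (s, a, g) * D.ξ c i)) =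
          (1 / 2 : ℂ) • (D.ξ b i * (D.e false * D.mono (s, a, g) * D.ξ c i)) := fun b c => by
        rw [smul_mul_assoc, ← mul_assoc, (D.commute_e false _).eq, mul_assoc, ← mul_assoc]
        simp only [mul_assoc]
      rw [mul_add, hcomm, hcomm, e_mul_mono]
      cases s
      · simp only [Bool.true_eq_false, if_false, if_true, zero_add, Bool.false_eq_true]
        obtain ⟨P, Q, σ, τ, hσ, hτ, hστ, hX, hP, hQ, hg, -⟩ := D.X_split g i
        have key : ∀ b, D.ξ b i * (D.mono (false, a, g) * D.ξ (!b) i) =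
            (sg (!a) * parityErase g i) •
            (D.Kp a * P * (D.e false * (D.ξ b i * D.letter i (g i) * D.ξ (!b) i)) * Q) := fun b => by
          rw [mono, hg, ← hστ]
          simp only [mul_assoc]
          rw [hQ, ← mul_assoc, ← (D.commute_e false _).eq, mul_assoc, ← mul_assoc (D.ξ b i),
            ξ_mul_Kp]
          simp only [smul_mul_assoc, mul_smul_comm, mul_assoc, mul_smul]
          rw [← mul_assoc (D.ξ b i) P, hP]
          simp only [smul_mul_assoc, mul_smul_comm, ← mul_assoc, ← (D.commute_e false _).eq]
          rw [smul_comm τ, smul_comm τ σ]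
        have h1 := key true
        have h2 := key false
        simp only [Bool.not_true, Bool.not_false] at h1 h2
        rw [h1, h2, ← smul_add, ← smul_add, ← add_mul, ← mul_add, ← mul_add]
        have local_eq : D.e false * (D.ξ true i * D.letter i (g i) * D.ξ false i +
            D.ξ false i * D.letter i (g i) * D.ξ true i) = (2 * if (g i).1 = (g i).2 then
              sg (!(g i).1) else 0 : ℂ) • (D.e false * D.letter i (g i)) := by
          have hsum : D.ξ true i * D.ξ false i + D.ξ false i * D.ξ true i = (2 : ℂ) • D.e false := by
            rw [D.ξ_anticomm, ← C, one_sub_C]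
          rcases h : g i with ⟨_ | _, _ | _⟩
          · simp [hsum, D.e_mul_self]
          · simp only [letter_ft]
            rw [mul_assoc _ _ (D.ξ false i), D.ξ_sq]; simp
          · simp only [letter_tf]
            rw [mul_assoc (D.ξ false i), D.ξ_sq]; simp
          · simp only [letter_tt]
            have h1 := D.ξ_mul_γ true i
            have h2 := D.ξ_mul_γ false i
            rw [h1, h2, neg_mul, neg_mul, smul_mul_assoc, smul_mul_assoc, mul_assoc, mul_assoc]
            simp only [sg_true, sg_false, one_smul, neg_smul, neg_neg]
            have e1 := D.ξ_mul_ξ_not true i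
            have e2 := D.ξ_mul_ξ_not false i
            simp only [Bool.not_true, Bool.not_false, sg_true, sg_false, one_smul,
              neg_smul] at e1 e2
            rw [e1, e2, ← mul_neg, ← mul_add, ← mul_assoc, D.e_mul_self, ← smul_mul_assoc]
            simp only [if_true, Bool.not_true, sg_false]
            rw [smul_mul_assoc, ← mul_smul_comm]
            congr 1
            module
        rw [local_eq, mono, hg]
        simp only [smul_mul_assoc, mul_smul_comm, smul_smul, mul_assoc]
        rw [← mul_assoc P (D.e false), ← (D.commute_e false P).eq]
        simp only [mul_assoc]
        rw [← mul_assoc (D.Kp a) (D.e false), ← (D.commute_e false (D.Kp a)).eq]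
        simp only [mul_assoc]
        congr 1
        ring
      · simp
    · simp only [LinearMap.add_apply, LinearMap.comp_apply, LinearMap.mulRight_apply,
        LinearMap.mulLeft_apply]
      rw [(hz (D.ξ true i)).eq, (hz (D.ξ false i)).eq, ← mul_assoc, ← mul_assoc, ← add_mul,
        D.ξ_anticomm, ← C, one_sub_C, smul_mul_assoc, smul_mul_assoc, mul_smul_comm, ← mul_assoc,
        D.e_mul_self, smul_smul, ← smul_mul_assoc, ← add_mul]
      norm_num [D.e_add_e]
  have heven : ∀ i, (g i).1 = (g i).2 := by
    intro i
    by_contra h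
    have := step i
    rw [if_neg h] at this
    simp at this
  have hpar : parityErase g i = 1 := by
    refine Finset.prod_eq_one fun j _ => ?_
    rw [sgnL, heven j]; simp
  have h := step i
  rw [hpar, if_pos (heven i), mul_one] at h
  ext
  · cases a <;> cases h1 : (g i).1 <;> simp [h1] at h <;> simp
    all_goals norm_num at h
  · rw [← heven]
    cases a <;> cases h1 : (g i).1 <;> simp [h1] at h <;> simp
    all_goals norm_num at h

/-- In the sector `C = 1` only the top element of the exterior algebra absorbs the sign with which
`K` passes the odd generators. -/
theorem letter_of_central_true {g : Fin n → Letter}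
    (hp : D.basis.repr z (true, true, g) ≠ 0) (i : Fin n) : g i = (true, true) := by
  have hpar := parity_of_central hz hp
  have key : ∀ b, hasBit b (g i) = true := by
    intro b
    by_contra hb
    rw [Bool.not_eq_true] at hb
    obtain ⟨σ, hσ, h1, h2⟩ := D.ξ_mul_mono_true b i true g
    have hc : extCoeff b (g i) ≠ 0 := by
      rw [extCoeff, hb]
      cases b <;> simp
      split_ifs <;> simp
    have hσ0 : σ ≠ 0 := by rintro rfl; simp at hσ
    set f : A →ₗ[ℂ] ℂ := D.basis.coord (true, true, Function.update g i (setBit b (g i))) ∘ₗ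
      LinearMap.mulLeft ℂ (D.e true) ∘ₗ
        (LinearMap.mulLeft ℂ (D.ξ b i) - LinearMap.mulRight ℂ (D.ξ b i)) with hf
    have h : f = (-2 * σ * extCoeff b (g i)) • D.basis.coord (true, true, g) := by
      refine D.basis.ext fun q => ?_
      obtain ⟨s, a, g'⟩ := q
      rw [LinearMap.smul_apply, Module.Basis.coord_apply, Module.Basis.repr_self, hf,
        LinearMap.comp_apply, LinearMap.comp_apply, LinearMap.sub_apply, LinearMap.mulRight_apply,
        LinearMap.mulLeft_apply, LinearMap.mulLeft_apply, basis_apply]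
      by_cases hq : (s, a, g') = ((true, true, g) : Idx n)
      · rw [hq, h1, h2, ← sub_smul, mul_smul_comm, e_mul_mono, if_pos rfl, map_smul, ← basis_apply,
          Module.Basis.coord_apply, Module.Basis.repr_self, Finsupp.single_eq_same,
          Finsupp.single_eq_same, hpar]
        simp only [Bool.not_true, sg_false, smul_eq_mul]
        ring
      · rw [Finsupp.single_eq_of_ne (Ne.symm hq), smul_zero]
        cases s
        · rw [mul_sub, ← mul_assoc, (D.commute_e true (D.ξ b i)).eq, mul_assoc,
            ← mul_assoc (D.e true), e_mul_mono]
          simp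
        · obtain ⟨σ', -, h1', h2'⟩ := D.ξ_mul_mono_true b i a g'
          rw [h1', h2', ← sub_smul, mul_smul_comm, e_mul_mono, if_pos rfl, map_smul, ← basis_apply,
            Module.Basis.coord_apply, Module.Basis.repr_self]
          by_cases hb' : hasBit b (g' i)
          · simp [extCoeff, hb']
          · rw [Finsupp.single_eq_of_ne, smul_zero]
            intro heq
            simp only [Prod.mk.injEq, true_and] at heq
            obtain ⟨rfl, heq⟩ := heq
            apply hq
            simp only [Prod.mk.injEq, true_and]
            funext j
            by_cases hj : j = i
            · subst hj
              have := congrFun heq j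
              rw [Function.update_self, Function.update_self] at this
              exact setBit_injective b _ _ hb hb' this
            · have := congrFun heq j
              rw [Function.update_of_ne hj, Function.update_of_ne hj] at this
              exact this.symm
    have h0 : f z = 0 := by
      rw [hf, LinearMap.comp_apply, LinearMap.comp_apply, LinearMap.sub_apply,
        LinearMap.mulRight_apply, LinearMap.mulLeft_apply (R := ℂ) (D.ξ b i), (hz _).eq, sub_self]
      simp
    rw [h, LinearMap.smul_apply, smul_eq_mul, mul_eq_zero] at h0
    rcases h0 with h0 | h0
    · simp [hc, hσ0] at h0
    · exact hp h0
  have h1 := key true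
  have h2 := key false
  simp only [hasBit] at h1 h2
  ext <;> simpa using ‹_›

theorem centralIdx_of_central {p : Idx n} (hp : D.basis.repr z p ≠ 0) : CentralIdx p := by
  obtain ⟨s, a, g⟩ := p
  cases s
  · right
    have h := funext (letter_of_central_false hz hp)
    cases a
    · exact ⟨1, by rw [h]; rfl⟩
    · exact ⟨2, by rw [h]; rfl⟩
  · cases a
    · exact Or.inl ⟨rfl, rfl, parity_of_central hz hp⟩
    · exact Or.inr ⟨0, by rw [funext (letter_of_central_true hz hp)]; rfl⟩

omit hz

variable (D)

theorem parity_const_even (b : Bool) : parity (fun _ : Fin n => (b, b)) = 1 := by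
  refine Finset.prod_eq_one fun j _ => ?_
  simp [sgnL]

theorem parity_of_centralIdx {p : Idx n} (hp : CentralIdx p) : parity p.2.2 = 1 := by
  rcases hp with h | ⟨j, rfl⟩
  · exact h.2.2
  · fin_cases j <;> exact parity_const_even _

theorem commute_mono {p : Idx n} (hp : CentralIdx p) (w : A) : Commute (D.mono p) w := by
  have hpar := parity_of_centralIdx hp
  obtain ⟨s, a, g⟩ := p
  refine D.commute_of_gens ?_ ?_ (fun b i => ?_) w
  · rw [Commute, SemiconjBy, mono_mul_K, K_mul_mono, hpar, one_smul]
  · rw [Commute, SemiconjBy, mono_mul_Kb, Kb_mul_mono, hpar, mul_one]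
  · rcases hp with ⟨hs, ha, -⟩ | ⟨j, hj⟩
    · obtain rfl : s = true := hs
      obtain rfl : a = false := ha
      obtain ⟨σ, -, h1, h2⟩ := D.ξ_mul_mono_true b i false g
      rw [Commute, SemiconjBy, h1, h2, hpar]
      simp
    · rw [hj]
      fin_cases j
      · obtain ⟨σ, -, h1, h2⟩ := D.ξ_mul_mono_true b i true (fun _ => (true, true))
        have hc : extCoeff b (true, true) = 0 := by cases b <;> simp [extCoeff, hasBit]
        simp only [hc, mul_zero, zero_smul] at h1 h2
        exact h2.trans h1.symm
      · have : D.mono (higIdx 1) = D.e false := by simp [higIdx, mono, X, oprod_one]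
        exact this ▸ D.commute_e false _
      · change Commute (D.mono (false, true, fun _ => (true, true))) _
        obtain ⟨P, Q, σ, τ, hσ, hτ, hστ, -, hP, hQ, hg, -⟩ := D.X_split (fun _ => (true, true)) i
        have hpe : parityErase (fun _ : Fin n => ((true, true) : Letter)) i = 1 :=
          Finset.prod_eq_one fun j _ => by simp [sgnL]
        have hστ' : τ = σ := by
          rw [hpe] at hστ
          calc τ = (σ * σ) * τ := by rw [hσ, one_mul]
            _ = σ := by rw [mul_assoc, hστ, mul_one]
        have hγ : D.ξ b i * D.γ i = -(D.γ i * D.ξ b i) := by rw [ξ_mul_γ, γ_mul_ξ]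
        rw [Commute, SemiconjBy, mono, hg]
        simp only [mul_assoc, Kp_true, letter_tt]
        rw [hQ, ← mul_assoc (D.ξ b i) (D.e false), ← (D.commute_e false _).eq, hστ']
        simp only [mul_assoc]
        rw [← mul_assoc (D.ξ b i) D.K, show D.ξ b i * D.K = -(D.K * D.ξ b i) by
          rw [D.K_mul_ξ, neg_neg]]
        simp only [neg_mul, mul_neg, mul_assoc]
        rw [← mul_assoc (D.ξ b i) P, hP]
        simp only [smul_mul_assoc, mul_smul_comm, mul_assoc]
        rw [← mul_assoc (D.ξ b i) (D.γ i), hγ]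
        simp [mul_assoc]

end DoubleGens

/-! ### The ribbon element -/

namespace DoubleGens

variable {A : Type*} [Ring A] [Algebra ℂ A] {n : ℕ} (D : DoubleGens A n)

theorem e_mul_oprod_congr (s : Bool) (x y : Fin n → A) (h : ∀ i, D.e s * x i = D.e s * y i) :
    D.e s * oprod x = D.e s * oprod y :=
  mul_oprod_congr _ (D.commute_e s) x y h

theorem commute_γ_γ (i j : Fin n) : Commute (D.γ i) (D.γ j) := by
  by_cases hij : i = j
  · rw [hij]
  · have h : ∀ b c, Commute (D.ξ b i * D.ξ c i) (D.γ j) := fun b c =>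
      Commute.mul_left (D.ξ_commute_γ b hij) (D.ξ_commute_γ c hij)
    rw [γ]
    exact ((h _ _).sub_left (h _ _)).smul_left _

/-- The ribbon element. -/
noncomputable def ribbon : A := (1 / 2 : ℂ) • ((1 + D.K - D.Kb + D.K * D.Kb) *
  oprod fun i => 1 - D.ξ true i * D.ξ false i)

theorem one_sub_ξ_mul_ξ (i : Fin n) :
    1 - D.ξ true i * D.ξ false i = 1 - D.γ i - D.e false := by
  have := D.ξ_mul_ξ_not true i
  simp only [Bool.not_true, sg_true, one_smul] at this
  rw [this]; abel

theorem e_true_mul_ribbon : D.e true * D.ribbon = D.e true * oprod fun i => 1 - D.γ i := by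
  have h1 : D.e true * (1 + D.K - D.Kb + D.K * D.Kb) = (2 : ℂ) • D.e true := by
    rw [mul_add, mul_sub, mul_add, e_mul_Kb, ← C, e_mul_C]
    simp only [sg_true, one_smul, mul_one, two_smul]
    abel
  rw [ribbon, mul_smul_comm, ← mul_assoc, h1, smul_mul_assoc, smul_smul,
    D.e_mul_oprod_congr true _ (fun i => 1 - D.γ i)]
  · norm_num
  · intro i
    rw [one_sub_ξ_mul_ξ, mul_sub, e_true_mul_e_false, sub_zero]

theorem e_false_mul_ribbon (hn : Even n) : D.e false * D.ribbon = D.mono (higIdx 2) := by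
  have h1 : D.e false * (1 + D.K - D.Kb + D.K * D.Kb) = (2 : ℂ) • (D.K * D.e false) := by
    rw [mul_add, mul_sub, mul_add, e_mul_Kb, ← C, e_mul_C, ← (D.commute_e false _).eq]
    simp only [sg_false, one_smul, mul_one, two_smul, neg_smul]
    abel
  rw [ribbon, mul_smul_comm, ← mul_assoc, h1, smul_mul_assoc, smul_smul, mul_assoc,
    D.e_mul_oprod_congr false _ (fun i => (-1 : ℂ) • D.γ i), oprod_smul]
  · rw [← mul_assoc, ← (D.commute_e false _).eq, mul_assoc]
    simp [hn.neg_one_pow, higIdx, mono, X]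
  · intro i
    rw [one_sub_ξ_mul_ξ, mul_sub, mul_sub, e_mul_self]
    simp

theorem ribbon_mul_even (x : Fin n → A) (hx : ∀ i j, i ≠ j → Commute (x i) (D.γ j)) :
    D.ribbon * (D.e true * oprod x) = D.e true * oprod fun i => (1 - D.γ i) * x i := by
  rw [← mul_assoc, ← (D.commute_e true _).eq, e_true_mul_ribbon, mul_assoc, oprod_mul_oprod]
  intro i j hij
  exact (Commute.one_right _).sub_right (hx i j hij)

theorem ribbon_mul_hig_zero : D.ribbon * D.mono (higIdx 0) = D.mono (higIdx 0) := by
  have h : D.mono (higIdx 0) = (D.e true * oprod fun i => D.γ i) * D.K := by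
    change D.e true * (D.K * oprod fun i => D.γ i) = _
    rw [mul_oprod_comm D.K _ _ D.K_mul_γ, mul_assoc]
  rw [h, ← mul_assoc, ribbon_mul_even]
  · rw [D.e_mul_oprod_congr true]
    intro i
    rw [sub_mul, D.γ_mul_γ, mul_sub, e_true_mul_e_false, sub_zero, one_mul]
  · exact fun i j _ => D.commute_γ_γ i j

theorem mono_hig_one : D.mono (higIdx 1) = D.e false := by
  simp [higIdx, mono, X, oprod_one]

theorem ribbon_mul_hig_one (hn : Even n) :
    D.ribbon * D.mono (higIdx 1) = D.mono (higIdx 2) := by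
  rw [mono_hig_one, ← (D.commute_e false _).eq, e_false_mul_ribbon D hn]

theorem ribbon_mul_hig_two (hn : Even n) :
    D.ribbon * D.mono (higIdx 2) = D.mono (higIdx 1) := by
  have h : D.mono (higIdx 2) = D.e false * D.mono (higIdx 2) := by
    change _ = D.e false * D.mono (false, true, _)
    rw [e_mul_mono, if_pos rfl]; rfl
  rw [h, ← mul_assoc, ← (D.commute_e false _).eq, e_false_mul_ribbon D hn, mono_hig_one]
  change D.e false * (D.K * oprod fun i => D.γ i) * (D.e false * (D.K * oprod fun i => D.γ i)) = _
  have hK := mul_oprod_comm D.K _ _ D.K_mul_γ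
  rw [mul_assoc, ← mul_assoc _ (D.e false), ← (D.commute_e false _).eq, mul_assoc, ← mul_assoc,
    e_mul_self, hK, mul_assoc _ D.K, ← hK, ← mul_assoc D.K, D.K_mul_K, one_mul,
    oprod_mul_oprod _ _ fun i j _ => D.commute_γ_γ i j,
    D.e_mul_oprod_congr false _ (fun _ => 1), oprod_one, mul_one]
  intro i
  rw [D.γ_mul_γ, e_mul_self, mul_one]

/-! ### The trace map and the Higman ideal -/

/-- Remove the generator with the given flag from a letter. -/
def clearBit (b : Bool) (l : Letter) : Letter := if b then (false, l.2) else (l.1, false)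

/-- The group-like generator that occurs in the coproduct of an odd generator. -/
def grp (b : Bool) : A := if b then D.K else D.Kb

/-- The adjoint action of an odd generator. -/
noncomputable def adξ (b : Bool) (i : Fin n) : Module.End ℂ A :=
  LinearMap.mulRight ℂ (D.ξ b i) -
    LinearMap.mulLeft ℂ (D.grp b * D.ξ b i) * LinearMap.mulRight ℂ (D.grp b)

/-- The adjoint action of `1 + K`, or of `1 + K̄`. -/
noncomputable def adGrp (b : Bool) : Module.End ℂ A :=
  1 + LinearMap.mulLeft ℂ (D.grp b) * LinearMap.mulRight ℂ (D.grp b)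

/-- The effect of the adjoint action of an odd generator on a letter. -/
def adLetter (a b : Bool) (l : Letter) : Letter := if a then clearBit (!b) l else setBit b l

/-- The condition under which the adjoint action of an odd generator does not kill a monomial. -/
def AdCond (s a b : Bool) (l : Letter) : Prop :=
  if a then s = false ∧ hasBit (!b) l = true else hasBit b l = false

theorem grp_mul_mono (s a b : Bool) (g : Fin n → Letter) :
    D.grp b * D.mono (s, a, g) * D.grp b = parity g • D.mono (s, a, g) := by
  cases b
  · simp only [grp, Bool.false_eq_true, if_false]
    rw [mul_assoc, mono_mul_Kb, mul_smul_comm, Kb_mul_mono, smul_smul, Bool.not_not, mul_right_comm,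
      sg_mul_self, one_mul]
  · simp only [grp, if_true]
    rw [mul_assoc, mono_mul_K, mul_smul_comm, K_mul_mono, Bool.not_not]

theorem adGrp_mono (s a b : Bool) (g : Fin n → Letter) :
    D.adGrp b (D.mono (s, a, g)) = (1 + parity g) • D.mono (s, a, g) := by
  rw [adGrp, LinearMap.add_apply, Module.End.mul_apply, Module.End.one_apply,
    LinearMap.mulRight_apply, LinearMap.mulLeft_apply, ← mul_assoc, grp_mul_mono, add_smul, one_smul]

theorem grp_mul_ξ (b c : Bool) (i : Fin n) : D.grp b * D.ξ c i = -(D.ξ c i * D.grp b) := by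
  cases b
  exacts [D.Kb_mul_ξ c i, D.K_mul_ξ c i]

/-- The adjoint action of an odd generator changes the letter at its own site only. -/
theorem adξ_mono (s a b : Bool) (g : Fin n → Letter) (i : Fin n) : ∃ t : ℂ,
    (t ≠ 0 ↔ AdCond s a b (g i)) ∧
    D.adξ b i (D.mono (s, a, g)) = t • D.mono (s, a, Function.update g i (adLetter a b (g i))) := by
  obtain ⟨P, Q, σ, τ, hσ, hτ, hστ, hX, hP, hQ, hg, -⟩ := D.X_split g i
  have hτ0 : τ ≠ 0 := by rintro rfl; simp at hτ
  have key : D.adξ b i (D.mono (s, a, g)) = τ • (D.Kp a * P * (D.e s * (D.letter i (g i) * D.ξ b i +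
      (sgnL (g i) * sg (!a)) • (D.ξ b i * D.letter i (g i)))) * Q) := by
    have h1 : D.adξ b i (D.mono (s, a, g)) = D.mono (s, a, g) * D.ξ b i +
        parity g • (D.ξ b i * D.mono (s, a, g)) := by
      have h2 : D.grp b * D.ξ b i * (D.mono (s, a, g) * D.grp b) =
          -(D.ξ b i * (D.grp b * D.mono (s, a, g) * D.grp b)) := by
        rw [grp_mul_ξ]; simp only [neg_mul, mul_assoc]
      rw [adξ, LinearMap.sub_apply, Module.End.mul_apply, LinearMap.mulRight_apply,
        LinearMap.mulRight_apply, LinearMap.mulLeft_apply, h2, grp_mul_mono, mul_smul_comm,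
        sub_neg_eq_add]
    have h3 : D.mono (s, a, g) * D.ξ b i = τ •
        (D.Kp a * P * (D.e s * (D.letter i (g i) * D.ξ b i)) * Q) := by
      rw [mono, hg]
      simp only [mul_assoc]
      rw [hQ]
      simp only [mul_smul_comm, ← mul_assoc, ← (D.commute_e s _).eq]
    have h4 : D.ξ b i * D.mono (s, a, g) = (sg (!a) * σ) •
        (D.Kp a * P * (D.e s * (D.ξ b i * D.letter i (g i))) * Q) := by
      rw [mono, ← mul_assoc, ← D.commute_e s, mul_assoc, ← mul_assoc (D.ξ b i), ξ_mul_Kp, hg]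
      simp only [smul_mul_assoc, mul_smul_comm, mul_assoc, mul_smul]
      rw [← mul_assoc (D.ξ b i) P, hP]
      simp only [smul_mul_assoc, mul_smul_comm, ← mul_assoc, ← (D.commute_e s _).eq]
    rw [h1, h3, h4, parity_eq g i, ← hστ, mul_add, mul_add, add_mul, smul_add]
    simp only [smul_mul_assoc, mul_smul_comm, smul_smul]
    congr 2
    linear_combination (sgnL (g i) * τ * sg (!a)) * hσ
  have hmono : ∀ l, D.mono (s, a, Function.update g i l) =
      D.Kp a * P * (D.e s * D.letter i l) * Q := fun l => by
    rw [mono, hX]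
    simp only [← mul_assoc, ← (D.commute_e s _).eq]
  have hlocal : ∃ t : ℂ, (t ≠ 0 ↔ AdCond s a b (g i)) ∧ D.e s * (D.letter i (g i) * D.ξ b i +
      (sgnL (g i) * sg (!a)) • (D.ξ b i * D.letter i (g i))) =
        t • (D.e s * D.letter i (adLetter a b (g i))) := by
    generalize g i = l
    have hes : ∃ m : ℂ, (m ≠ 0 ↔ s = false) ∧ ∀ z, D.e s * (D.e false * z) = m • (D.e s * z) := by
      cases s
      · exact ⟨1, by simp, fun z => by rw [← mul_assoc, e_mul_self, one_smul]⟩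
      · exact ⟨0, by simp, fun z => by rw [← mul_assoc, e_true_mul_e_false]; simp⟩
    obtain ⟨m, hm0, hm⟩ := hes
    have hm1 : D.e s * D.e false = m • D.e s := by simpa using hm 1
    have e1 := D.ξ_mul_ξ_not b i
    have e2 := D.ξ_mul_ξ_not' b i
    have e3 := D.γ_mul_ξ b i
    have e4 := D.ξ_mul_γ b i
    have hsgb : sg b ≠ 0 := by cases b <;> simp
    rcases l with ⟨l, l'⟩
    by_cases hl : l = l'
    · subst hl
      cases l <;> cases a
      · refine ⟨2, ?_, ?_⟩
        · cases b <;> simp [AdCond, hasBit]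
        · have : adLetter false b (false, false) = (b, !b) := by cases b <;> rfl
          rw [this, letter_odd]
          simp [sgnL, two_smul, mul_add]
      · refine ⟨0, ?_, ?_⟩
        · cases b <;> simp [AdCond, hasBit]
        · simp [sgnL]
      · refine ⟨0, ?_, ?_⟩
        · cases b <;> simp [AdCond, hasBit]
        · simp [sgnL, e3, e4]
      · refine ⟨2 * sg b * m, ?_, ?_⟩
        · rw [AdCond, if_pos rfl, ← hm0]
          cases b <;> simp [hasBit]
        · have : adLetter true b (true, true) = (b, !b) := by cases b <;> rfl
          rw [this, letter_odd, letter_tt, e3, e4]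
          simp only [sgnL, beq_self_eq_true, Bool.not_true, sg_true, sg_false, one_mul, neg_smul,
            one_smul, neg_neg]
          rw [← two_smul ℂ, smul_smul, mul_smul_comm, hm, smul_smul]
    · obtain rfl : l' = !l := by cases l <;> cases l' <;> simp_all
      rw [letter_odd]
      have hs : sgnL (l, !l) = -1 := by cases l <;> simp [sgnL]
      rw [hs]
      by_cases hb : l = b
      · subst hb
        refine ⟨0, ?_, ?_⟩
        · cases l <;> cases a <;> simp [AdCond, hasBit]
        · rw [D.ξ_sq]; simp
      · obtain rfl : l = !b := by cases l <;> cases b <;> simp_all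
        rw [e1, e2]
        cases a
        · refine ⟨-2 * sg b, ?_, ?_⟩
          · cases b <;> simp [AdCond, hasBit]
          · have : adLetter false b (!b, !!b) = (true, true) := by cases b <;> rfl
            rw [this, letter_tt, ← mul_smul_comm]
            congr 1
            simp only [Bool.not_false, sg_true]
            module
        · refine ⟨2 * m, ?_, ?_⟩
          · rw [AdCond, if_pos rfl, ← hm0]
            cases b <;> simp [hasBit]
          · have : adLetter true b (!b, !!b) = (false, false) := by cases b <;> rfl
            rw [this, letter_ff, mul_one, mul_smul (2 : ℂ) m, ← hm1]
            refine Eq.trans ?_ (mul_smul_comm (2 : ℂ) (D.e s) (D.e false))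
            congr 1
            simp only [Bool.not_true, sg_false]
            module
  obtain ⟨t, ht, h⟩ := hlocal
  refine ⟨τ * t, ?_, ?_⟩
  · rw [← ht]; simp [hτ0]
  · rw [key, h, hmono]
    simp only [smul_mul_assoc, mul_smul_comm, smul_smul]

theorem adξ_list_mono (s a b : Bool) (L : List (Fin n)) (hL : L.Nodup) (g : Fin n → Letter) :
    ∃ t : ℂ, (t ≠ 0 ↔ ∀ i ∈ L, AdCond s a b (g i)) ∧
    (L.map (D.adξ b)).reverse.prod (D.mono (s, a, g)) =
      t • D.mono (s, a, fun i => if i ∈ L then adLetter a b (g i) else g i) := by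
  induction L generalizing g with
  | nil => exact ⟨1, by simp, by simp⟩
  | cons i L ih =>
    rw [List.nodup_cons] at hL
    obtain ⟨t, ht, h⟩ := D.adξ_mono s a b g i
    obtain ⟨t', ht', h'⟩ := ih hL.2 (Function.update g i (adLetter a b (g i)))
    have hne : ∀ j ∈ L, j ≠ i := by rintro j hj rfl; exact hL.1 hj
    refine ⟨t * t', ?_, ?_⟩
    · rw [mul_ne_zero_iff, ht, ht', List.forall_mem_cons]
      refine and_congr_right fun _ => forall₂_congr fun j hj => ?_
      rw [Function.update_of_ne (hne j hj)]
    · rw [List.map_cons, List.reverse_cons, List.prod_append, List.prod_singleton,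
        Module.End.mul_apply, h, map_smul, h', smul_smul]
      congr 4
      funext j
      by_cases hj : j = i
      · subst hj; simp [hL.1]
      · simp [hj]

/-- The trace map, written as a product of adjoint actions of the generators. -/
noncomputable def trMap : A →ₗ[ℂ] A :=
  (1 / 2 : ℂ) • (LinearMap.mulRight ℂ D.K * ((List.finRange n).map (D.adξ true)).reverse.prod *
    D.adGrp true * ((List.finRange n).map (D.adξ false)).reverse.prod * D.adGrp false :
      Module.End ℂ A)

theorem trMap_mono (s a : Bool) (g : Fin n → Letter) : ∃ t₁ t₂ : ℂ,
    (t₁ ≠ 0 ↔ ∀ i, AdCond s a false (g i)) ∧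
    (t₂ ≠ 0 ↔ ∀ i, AdCond s a true (adLetter a false (g i))) ∧
    D.trMap (D.mono (s, a, g)) = ((1 / 2) * ((1 + parity g) * t₁ *
      (1 + parity fun i => adLetter a false (g i)) * t₂ *
        parity fun i => adLetter a true (adLetter a false (g i)))) •
      D.mono (s, !a, fun i => adLetter a true (adLetter a false (g i))) := by
  obtain ⟨t₁, h₁, e₁⟩ := D.adξ_list_mono s a false _ (List.nodup_finRange n) g
  simp only [List.mem_finRange, if_true] at e₁
  obtain ⟨t₂, h₂, e₂⟩ := D.adξ_list_mono s a true _ (List.nodup_finRange n)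
    (fun i => adLetter a false (g i))
  simp only [List.mem_finRange, if_true] at e₂
  simp only [List.mem_finRange, forall_const] at h₁ h₂
  refine ⟨t₁, t₂, h₁, h₂, ?_⟩
  simp only [trMap, LinearMap.smul_apply, Module.End.mul_apply]
  rw [adGrp_mono, map_smul, e₁, smul_smul, map_smul, adGrp_mono, smul_smul, map_smul, e₂,
    smul_smul, map_smul, LinearMap.mulRight_apply, mono_mul_K, smul_smul, smul_smul]
  congr 1
  ring

theorem parity_const_odd (hn : Even n) (b : Bool) : parity (fun _ : Fin n => (b, !b)) = 1 := by
  rw [parity, Finset.prod_const, Finset.card_univ, Fintype.card_fin, sgnL]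
  cases b <;> exact hn.neg_one_pow

/-- The trace map sends monomials to multiples of monomials. It kills all of them except those with the
letter `1` at all sites and no `K`, one in each sector, and `K γ₁ ⋯ γₙ` in the sector `C = -1`. -/
theorem range_trMap (hpos : 0 < n) (hn : Even n) : LinearMap.range D.trMap =
    Submodule.span ℂ (Set.range fun j => D.mono (higIdx j)) := by
  apply le_antisymm
  · rw [LinearMap.range_eq_map, ← D.span_mono, Submodule.map_span, Submodule.span_le]
    rintro _ ⟨_, ⟨⟨s, a, g⟩, rfl⟩, rfl⟩
    obtain ⟨t₁, t₂, h₁, h₂, h⟩ := D.trMap_mono s a g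
    rw [SetLike.mem_coe, h]
    by_cases h1 : t₁ = 0
    · simp [h1]
    by_cases h2 : t₂ = 0
    · simp [h2]
    apply Submodule.smul_mem
    apply Submodule.subset_span
    have h1 := h₁.mp h1
    have h2 := h₂.mp h2
    have hg : ∀ i, adLetter a true (adLetter a false (g i)) = (!a, !a) := fun i => by
      have h1 := h1 i
      have h2 := h2 i
      generalize g i = l at *
      rcases l with ⟨_ | _, _ | _⟩ <;> cases a <;>
        simp_all [AdCond, adLetter, hasBit, setBit, clearBit]
    simp only [hg]
    cases a <;> cases s
    · exact ⟨2, rfl⟩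
    · exact ⟨0, rfl⟩
    · exact ⟨1, rfl⟩
    · have := h1 ⟨0, hpos⟩
      simp [AdCond] at this
  · have key : ∀ s a : Bool, (a = true → s = false) →
        D.mono (s, !a, fun _ => (!a, !a)) ∈ LinearMap.range D.trMap := by
      intro s a hsa
      obtain ⟨t₁, t₂, h₁, h₂, h⟩ := D.trMap_mono s a fun _ => (a, a)
      have h1 : t₁ ≠ 0 := h₁.mpr fun i => by
        cases a <;> simp_all [AdCond, hasBit]
      have h2 : t₂ ≠ 0 := h₂.mpr fun i => by
        cases a <;> simp_all [AdCond, hasBit, adLetter, setBit, clearBit]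
      have e1 : adLetter a false (a, a) = (false, !false) := by cases a <;> rfl
      have e2 : adLetter a true (false, !false) = (!a, !a) := by cases a <;> rfl
      simp only [e1, e2, parity_const_even, parity_const_odd hn] at h
      refine ⟨(2 * t₁ * t₂)⁻¹ • D.mono (s, a, fun _ => (a, a)), ?_⟩
      rw [map_smul, h, smul_smul, show (2 * t₁ * t₂)⁻¹ *
        (1 / 2 * ((1 + 1) * t₁ * (1 + 1) * t₂ * 1)) = 1 by field_simp; norm_num, one_smul]
    rw [Submodule.span_le]
    rintro _ ⟨j, rfl⟩
    fin_cases j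
    · exact key true false (by simp)
    · exact key false true (by simp)
    · exact key false false (by simp)

end DoubleGens

/-! ### The Lyubashenko–Majid map -/

namespace DoubleGens

variable {A : Type*} [Ring A] [Algebra ℂ A] {n : ℕ} (D : DoubleGens A n)

/-- The part of the `R`-matrix that involves the group-like elements only. -/
noncomputable def R₀ : A ⊗[ℂ] A :=
  (1 / 2 : ℂ) • (1 + D.K ⊗ₜ 1 + 1 ⊗ₜ D.Kb - D.K ⊗ₜ D.Kb)

/-- The part `R₀` of the `R`-matrix with its two legs exchanged. -/
noncomputable def R₀' : A ⊗[ℂ] A :=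
  (1 / 2 : ℂ) • (1 + 1 ⊗ₜ D.K + D.Kb ⊗ₜ 1 - D.Kb ⊗ₜ D.K)

/-- The nilpotent part of the factor of the `R`-matrix at a site. -/
def Z (i : Fin n) : A ⊗[ℂ] A := (D.K * D.ξ true i) ⊗ₜ D.ξ false i

/-- The element `Z i` with its two legs exchanged. -/
def Z' (i : Fin n) : A ⊗[ℂ] A := D.ξ false i ⊗ₜ (D.K * D.ξ true i)

/-- The conjugate of `-Z' i` by `R₀`. -/
def Z'' (i : Fin n) : A ⊗[ℂ] A := (D.K * D.ξ false i) ⊗ₜ (D.C * D.ξ true i)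

/-- The `R`-matrix, factored over the sites. -/
noncomputable def Rm : A ⊗[ℂ] A := D.R₀ * oprod fun i => 1 + D.Z i

/-- The factor of `R⁻¹ R₂₁⁻¹` at a site. -/
noncomputable def G (i : Fin n) : A ⊗[ℂ] A := (1 - D.Z i) * (1 + D.Z'' i)

theorem Kξ_mul_Kξ (b c : Bool) (i j : Fin n) :
    D.K * D.ξ b i * (D.K * D.ξ c j) = -(D.ξ b i * D.ξ c j) := by
  rw [D.K_mul_ξ, neg_mul, mul_assoc, ← mul_assoc D.K, D.K_mul_K, one_mul]

theorem commute_Z {i j : Fin n} (hij : i ≠ j) : Commute (D.Z i) (D.Z j) := by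
  rw [Commute, SemiconjBy, Z, Z, Algebra.TensorProduct.tmul_mul_tmul,
    Algebra.TensorProduct.tmul_mul_tmul, Kξ_mul_Kξ, Kξ_mul_Kξ, D.ξ_mul_ξ _ _ _ _ hij,
    D.ξ_mul_ξ false false i j hij]
  simp [TensorProduct.neg_tmul, TensorProduct.tmul_neg]

theorem Z_sq (i : Fin n) : D.Z i * D.Z i = 0 := by
  rw [Z, Algebra.TensorProduct.tmul_mul_tmul, D.ξ_sq, TensorProduct.tmul_zero]

theorem R₀_sq : D.R₀ * D.R₀ = 1 := by
  have e1 : (1 : A ⊗[ℂ] A) = 1 ⊗ₜ 1 := rfl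
  rw [R₀, smul_mul_smul_comm, e1]
  simp only [mul_add, add_mul, mul_sub, sub_mul, Algebra.TensorProduct.tmul_mul_tmul, mul_one,
    one_mul, D.K_mul_K, D.Kb_mul_Kb]
  module

theorem R₀_mul_Z' (i : Fin n) : D.R₀ * (1 - D.Z' i) = (1 + D.Z'' i) * D.R₀ := by
  have h1 : D.K * D.ξ false i * D.K = -D.ξ false i := by
    rw [D.K_mul_ξ, neg_mul, mul_assoc, D.K_mul_K, mul_one]
  have h2 : D.Kb * (D.K * D.ξ true i) = D.C * D.ξ true i := by
    rw [← mul_assoc, ← D.K_mul_Kb, C]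
  have h3 : D.C * D.ξ true i * D.Kb = -(D.K * D.ξ true i) := by
    have : D.ξ true i * D.Kb = -(D.Kb * D.ξ true i) := by rw [D.Kb_mul_ξ, neg_neg]
    rw [mul_assoc, this, mul_neg, ← mul_assoc, C, mul_assoc D.K, D.Kb_mul_Kb, mul_one]
  have e1 : (1 : A ⊗[ℂ] A) = 1 ⊗ₜ 1 := rfl
  have key : D.R₀ * D.Z' i = -(D.Z'' i * D.R₀) := by
    rw [R₀, Z', Z'', smul_mul_assoc, mul_smul_comm, e1, ← smul_neg]
    congr 1
    simp only [mul_add, add_mul, mul_sub, sub_mul, Algebra.TensorProduct.tmul_mul_tmul, mul_one,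
      one_mul, h1, h2, h3, TensorProduct.neg_tmul, TensorProduct.tmul_neg]
    abel
  rw [mul_sub, add_mul, mul_one, one_mul, key, sub_neg_eq_add]

theorem Rm_mul : D.Rm * ((oprod fun i => 1 - D.Z i) * D.R₀) = 1 ∧
    (oprod fun i => 1 - D.Z i) * D.R₀ * D.Rm = 1 := by
  have h1 : (oprod fun i => 1 + D.Z i) * (oprod fun i => 1 - D.Z i) = 1 := by
    rw [oprod_mul_oprod]
    · refine Eq.trans (congrArg oprod (funext fun i => ?_)) (oprod_one (n := n))
      simp only [mul_sub, add_mul, mul_one, one_mul, Z_sq]; abel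
    · intro i j hij
      exact (Commute.one_left _).sub_left ((Commute.one_right _).add_right (D.commute_Z hij))
  have h2 : (oprod fun i => 1 - D.Z i) * (oprod fun i => 1 + D.Z i) = 1 := by
    rw [oprod_mul_oprod]
    · refine Eq.trans (congrArg oprod (funext fun i => ?_)) (oprod_one (n := n))
      simp only [mul_add, sub_mul, mul_one, one_mul, Z_sq]; abel
    · intro i j hij
      exact (Commute.one_left _).add_left ((Commute.one_right _).sub_right (D.commute_Z hij))
  constructor
  · rw [Rm, mul_assoc, ← mul_assoc _ _ D.R₀, h1, one_mul, R₀_sq]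
  · rw [Rm, mul_assoc, ← mul_assoc D.R₀, R₀_sq, one_mul, h2]

theorem commute_Z_Z'' {i j : Fin n} (hij : i ≠ j) : Commute (D.Z'' i) (D.Z j) := by
  rw [Commute, SemiconjBy, Z, Z'', Algebra.TensorProduct.tmul_mul_tmul,
    Algebra.TensorProduct.tmul_mul_tmul, Kξ_mul_Kξ, Kξ_mul_Kξ, mul_assoc,
    D.ξ_mul_ξ _ _ _ _ hij, D.ξ_mul_ξ true false i j hij, ← mul_assoc (D.ξ false j), ← D.C_mul_ξ]
  simp [TensorProduct.neg_tmul, TensorProduct.tmul_neg, mul_assoc]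

/-- Conjugation by `R₀` turns `R⁻¹ R₂₁⁻¹` into a product over the sites. -/
theorem inverse_Rm_mul_inverse : Ring.inverse D.Rm *
    Ring.inverse (TensorProduct.comm ℂ A A D.Rm) = oprod D.G * (D.R₀ * D.R₀') := by
  have hc : ∀ z, TensorProduct.comm ℂ A A z = Algebra.TensorProduct.comm ℂ A A z := fun _ => rfl
  have hinv : Ring.inverse D.Rm = (oprod fun i => 1 - D.Z i) * D.R₀ :=
    Ring.inverse_unit ⟨D.Rm, _, D.Rm_mul.1, D.Rm_mul.2⟩
  have hinv' : Ring.inverse (TensorProduct.comm ℂ A A D.Rm) =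
      (oprod fun i => 1 - D.Z' i) * D.R₀' := by
    have h : Algebra.TensorProduct.comm ℂ A A ((oprod fun i => 1 - D.Z i) * D.R₀) =
        (oprod fun i => 1 - D.Z' i) * D.R₀' := by
      rw [map_mul]
      congr 1
      · rw [← MonoidHom.coe_coe (Algebra.TensorProduct.comm ℂ A A), map_oprod]
        congr 1
        funext i
        simp [Z, Z']
      · simp [R₀, R₀']
    rw [← h, hc]
    exact Ring.inverse_unit ⟨Algebra.TensorProduct.comm ℂ A A D.Rm, _,
      by rw [← map_mul, D.Rm_mul.1, map_one], by rw [← map_mul, D.Rm_mul.2, map_one]⟩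
  rw [hinv, hinv', mul_assoc, ← mul_assoc D.R₀, mul_oprod_comm D.R₀ _ _ D.R₀_mul_Z', mul_assoc,
    ← mul_assoc, oprod_mul_oprod]
  · rfl
  · intro i j hij
    exact ((Commute.one_right _).sub_right
      ((Commute.one_left _).add_left (D.commute_Z_Z'' hij)))

theorem e_tmul_e_mul_R₀ (s t : Bool) : D.e s ⊗ₜ[ℂ] D.e t * (D.R₀ * D.R₀') =
    (D.e s * D.Kp (!t)) ⊗ₜ[ℂ] (D.e t * D.Kp (!s)) := by
  have h : D.e s ⊗ₜ[ℂ] D.e t * D.R₀' = D.e s ⊗ₜ[ℂ] D.e t * ((1 / 2 : ℂ) •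
      (1 + 1 ⊗ₜ D.K + sg s • D.K ⊗ₜ 1 - sg s • D.K ⊗ₜ D.K)) := by
    rw [R₀', mul_smul_comm, mul_smul_comm]
    congr 1
    simp only [mul_add, mul_sub, Algebra.TensorProduct.tmul_mul_tmul, mul_one, e_mul_Kb,
      TensorProduct.smul_tmul', mul_smul_comm]
  have h' : D.e s ⊗ₜ[ℂ] D.e t * D.R₀ = D.e s ⊗ₜ[ℂ] D.e t * ((1 / 2 : ℂ) •
      (1 + D.K ⊗ₜ 1 + sg t • 1 ⊗ₜ D.K - sg t • D.K ⊗ₜ D.K)) := by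
    rw [R₀, mul_smul_comm, mul_smul_comm]
    congr 1
    simp only [mul_add, mul_sub, Algebra.TensorProduct.tmul_mul_tmul, mul_one, e_mul_Kb,
      TensorProduct.tmul_smul, mul_smul_comm]
  have hcomm : ∀ w, Commute (D.e s ⊗ₜ[ℂ] D.e t) w := fun w => by
    induction w with
    | zero => exact Commute.zero_right _
    | add x y hx hy => exact hx.add_right hy
    | tmul x y =>
      rw [Commute, SemiconjBy, Algebra.TensorProduct.tmul_mul_tmul,
        Algebra.TensorProduct.tmul_mul_tmul, (D.commute_e s x).eq, (D.commute_e t y).eq]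
  have e1 : (1 : A ⊗[ℂ] A) = 1 ⊗ₜ 1 := rfl
  rw [← mul_assoc, h', mul_assoc, (hcomm _).eq, mul_assoc, ← (hcomm _).eq, h, ← mul_assoc,
    ← (hcomm _).eq, mul_assoc, smul_mul_smul_comm, mul_smul_comm, e1]
  simp only [mul_add, add_mul, mul_sub, sub_mul, Algebra.TensorProduct.tmul_mul_tmul, mul_one,
    one_mul, D.K_mul_K, smul_mul_assoc, mul_smul_comm]
  cases s <;> cases t <;> simp only [sg_true, sg_false, Bool.not_true, Bool.not_false, Kp_true,
    Kp_false, mul_one] <;> module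

theorem commute_one_tmul {z : A} (hz : ∀ w, Commute z w) (w : A ⊗[ℂ] A) :
    Commute ((1 : A) ⊗ₜ[ℂ] z) w := by
  induction w with
  | zero => exact Commute.zero_right _
  | add x y hx hy => exact hx.add_right hy
  | tmul x y =>
    rw [Commute, SemiconjBy, Algebra.TensorProduct.tmul_mul_tmul,
      Algebra.TensorProduct.tmul_mul_tmul, (hz y).eq, one_mul, mul_one]

/-- Letters of the monomial basis in which `γ_i` is replaced by `ξ̄_i ξ_i`. -/
noncomputable def letter' (i : Fin n) : Letter → A
  | (true, true) => D.ξ false i * D.ξ true i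
  | l => D.letter i l

@[simp] theorem letter'_ff (i : Fin n) : D.letter' i (false, false) = 1 := rfl
@[simp] theorem letter'_tt (i : Fin n) :
    D.letter' i (true, true) = D.ξ false i * D.ξ true i := rfl
@[simp] theorem letter'_tf (i : Fin n) : D.letter' i (true, false) = D.ξ true i := rfl
@[simp] theorem letter'_ft (i : Fin n) : D.letter' i (false, true) = D.ξ false i := rfl

/-- Monomials in which the full letter is `ξ̄_i ξ_i`. -/
noncomputable def X' (h : Fin n → Letter) : A := oprod fun i => D.letter' i (h i)

/-- The parity flag of a letter. -/
def odd (l : Letter) : Bool := l.1 != l.2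

theorem sgnL_eq (l : Letter) : sgnL l = sg (!odd l) := by
  rcases l with ⟨_ | _, _ | _⟩ <;> rfl

/-- Half of the eigenvalue of `1 - C` in a sector. -/
def half (t : Bool) : ℂ := if t then 0 else 1

/-- The coefficients in the first leg of the factor of `(1 ⊗ x) R⁻¹ R₂₁⁻¹` at a site, where `x` has
the letter `l` and the second leg has the letter `r`. -/
noncomputable def coeffS (t : Bool) (i : Fin n) : Letter → Letter → A
  | (false, false), (false, false) => 1
  | (false, false), (false, true) => -(D.K * D.ξ true i)
  | (false, false), (true, false) => sg t • (D.K * D.ξ false i)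
  | (false, false), (true, true) => sg t • (D.ξ true i * D.ξ false i)
  | (true, true), (false, false) => half t • 1
  | (true, true), (false, true) => half t • (D.K * D.ξ true i)
  | (true, true), (true, false) => (half t * sg t) • (D.K * D.ξ false i)
  | (true, true), (true, true) => -1 - (half t * sg t) • (D.ξ true i * D.ξ false i)
  | (true, false), (false, false) => -((2 * half t) • D.ξ true i)
  | (true, false), (false, true) => 0
  | (true, false), (true, false) =>
      D.K + (2 * half t * sg t) • (D.K * (D.ξ true i * D.ξ false i))
  | (true, false), (true, true) => D.ξ true i
  | (false, true), (false, false) => 0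
  | (false, true), (false, true) => D.K
  | (false, true), (true, false) => 0
  | (false, true), (true, true) => sg t • D.ξ false i

theorem e_mul_e_false (t : Bool) : D.e t * D.e false = half t • D.e t := by
  cases t <;> simp [half, e_mul_e]

theorem one_tmul_e_mul_G (t : Bool) (i : Fin n) (l : Letter) :
    (1 : A) ⊗ₜ[ℂ] D.e t * (D.Kp (odd l) ⊗ₜ D.letter i l * D.G i) =
      (1 : A) ⊗ₜ[ℂ] D.e t * ∑ r, D.coeffS t i l r ⊗ₜ D.letter' i r := by
  have hK : ∀ z, D.K * (D.K * z) = z := fun z => by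
    rw [← mul_assoc, D.K_mul_K, one_mul]
  have e1 : (1 : A ⊗[ℂ] A) = 1 ⊗ₜ 1 := rfl
  set x := D.ξ true i with hx
  set y := D.ξ false i with hy
  have hxy : x * y = (2 : ℂ) • D.e false - y * x := by
    rw [← one_sub_C, C, ← D.ξ_anticomm i, add_sub_cancel_right]
  have hxx : x * x = 0 := D.ξ_sq _ _
  have hyy : y * y = 0 := D.ξ_sq _ _
  have hG : (1 : A) ⊗ₜ[ℂ] D.e t * D.G i = (1 : A) ⊗ₜ[ℂ] D.e t *
      (1 ⊗ₜ 1 - (D.K * x) ⊗ₜ y + sg t • (D.K * y) ⊗ₜ x + sg t • (x * y) ⊗ₜ (y * x)) := by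
    have h2 : D.e t * (D.C * x) = sg t • (D.e t * x) := by
      rw [← mul_assoc, e_mul_C, smul_mul_assoc]
    have h3 : D.e t * (y * (D.C * x)) = sg t • (D.e t * (y * x)) := by
      rw [← mul_assoc y, ← D.C_mul_ξ, mul_assoc, ← mul_assoc, e_mul_C, smul_mul_assoc]
    have h4 : D.K * x * (D.K * y) = -(x * y) := D.Kξ_mul_Kξ true false i i
    rw [G, Z, Z'', sub_mul, mul_add, mul_add, e1]
    simp only [mul_add, mul_sub, Algebra.TensorProduct.tmul_mul_tmul, mul_one, one_mul, ← hx, ← hy,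
      mul_smul_comm]
    rw [h2, h3, h4]
    simp only [TensorProduct.neg_tmul, TensorProduct.tmul_smul]
    module
  have hcomm := commute_one_tmul (A := A) (D.commute_e t)
  have hexp : (1 : A) ⊗ₜ[ℂ] D.e t * (D.Kp (odd l) ⊗ₜ D.letter i l * D.G i) =
      D.Kp (odd l) ⊗ₜ[ℂ] (D.e t * D.letter i l) - (D.Kp (odd l) * (D.K * x)) ⊗ₜ[ℂ]
        (D.e t * (D.letter i l * y)) + sg t • (D.Kp (odd l) * (D.K * y)) ⊗ₜ[ℂ]
        (D.e t * (D.letter i l * x)) + sg t • (D.Kp (odd l) * (x * y)) ⊗ₜ[ℂ]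
        (D.e t * (D.letter i l * (y * x))) := by
    rw [← mul_assoc, (hcomm _).eq, mul_assoc, hG]
    have : ∀ w, D.letter i l * (D.e t * w) = D.e t * (D.letter i l * w) := fun w => by
      rw [← mul_assoc, ← (D.commute_e t _).eq, mul_assoc]
    simp only [mul_add, mul_sub, Algebra.TensorProduct.tmul_mul_tmul, mul_one, one_mul,
      mul_smul_comm, this]
    rw [← (D.commute_e t _).eq]
  have hee := D.e_mul_e_false t
  have hez : ∀ w, D.e t * (D.e false * w) = half t • (D.e t * w) := fun w => by
    rw [← mul_assoc, hee, smul_mul_assoc]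
  have h1 : D.e t * (x * y) = (2 * half t) • D.e t - D.e t * (y * x) := by
    rw [hxy, mul_sub, mul_smul_comm, hee, smul_smul]
  have h2 : D.e t * (x * (y * x)) = (2 * half t) • (D.e t * x) := by
    rw [← mul_assoc x, hxy, sub_mul, mul_assoc y, hxx, mul_zero, sub_zero, smul_mul_assoc,
      mul_smul_comm, hez, smul_smul]
  have h3 : y * (y * x) = 0 := by rw [← mul_assoc, hyy, zero_mul]
  have hγ : ∀ w, D.e t * (D.γ i * w) = half t • (D.e t * w) - D.e t * (y * x * w) := fun w => by
    have := D.ξ_mul_ξ_not' true i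
    simp only [Bool.not_true, sg_true, one_smul] at this
    rw [show D.γ i = D.e false - y * x by rw [hx, hy, this]; abel, sub_mul, mul_sub, hez]
  have h4 : D.e t * (y * x * y) = (2 * half t) • (D.e t * y) := by
    rw [mul_assoc, hxy, mul_sub, ← mul_assoc y y x, hyy, zero_mul, sub_zero, mul_smul_comm,
      mul_smul_comm, ← (D.commute_e false _).eq, hez, smul_smul]
  have h5 : D.e t * (y * x * (y * x)) = (2 * half t) • (D.e t * (y * x)) := by
    rw [mul_assoc y, ← mul_assoc, (D.commute_e t y).eq, mul_assoc, h2, mul_smul_comm, ← mul_assoc,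
      ← (D.commute_e t y).eq, mul_assoc]
  have h6 : y * x * x = 0 := by rw [mul_assoc, hxx, mul_zero]
  have h7 : D.e t * D.γ i = half t • D.e t - D.e t * (y * x) := by simpa using hγ 1
  rw [hexp, Fintype.sum_prod_type]
  simp only [Fintype.sum_bool, mul_add, Algebra.TensorProduct.tmul_mul_tmul, one_mul]
  rcases l with ⟨_ | _, _ | _⟩
  · simp only [odd, coeffS, letter_ff, letter'_ff, letter'_tf, letter'_ft, letter'_tt, one_mul,
      mul_one, bne_self_eq_false, Kp_false, ← hx, ← hy, TensorProduct.neg_tmul,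
      ← TensorProduct.smul_tmul']
    module
  · simp only [odd, coeffS, letter_ft, letter'_ff, letter'_tf, letter'_ft, letter'_tt,
      mul_one, Bool.false_bne, Kp_true, ← hx, ← hy, TensorProduct.zero_tmul, hyy, h3, hK,
      ← TensorProduct.smul_tmul', mul_zero, TensorProduct.tmul_zero]
    module
  · simp only [odd, coeffS, letter_tf, letter'_ff, letter'_tf, letter'_ft, letter'_tt,
      mul_one, Bool.true_bne, Bool.not_false, Kp_true, ← hx, ← hy, TensorProduct.zero_tmul, hxx, hK,
      mul_zero, TensorProduct.tmul_zero, h1, h2, TensorProduct.tmul_sub, TensorProduct.tmul_smul,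
      TensorProduct.neg_tmul, TensorProduct.add_tmul, ← TensorProduct.smul_tmul']
    module
  · simp only [odd, coeffS, letter_tt, letter'_ff, letter'_tf, letter'_ft, letter'_tt, one_mul,
      mul_one, bne_self_eq_false, Kp_false, ← hx, ← hy, hγ, h4, h5, h6, h7, mul_zero,
      TensorProduct.neg_tmul, TensorProduct.sub_tmul, TensorProduct.tmul_sub,
      TensorProduct.tmul_smul, ← TensorProduct.smul_tmul', TensorProduct.tmul_zero]
    module

end DoubleGens

namespace DoubleGens

variable {A : Type*} [Ring A] [Algebra ℂ A] {n : ℕ} (D : DoubleGens A n)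

theorem K_mul_Kp_comm (a : Bool) : D.K * D.Kp a = D.Kp a * D.K := by
  rw [K_mul_Kp, Kp_mul_K]

/-- A monomial of even parity has an even number of odd letters, so the powers of `K` cancel. -/
theorem oprod_Kp_odd {g : Fin n → Letter} (hg : parity g = 1) :
    oprod (fun i => D.Kp (odd (g i))) = 1 := by
  have h : ∀ L : List (Fin n), ∃ b, (L.map fun i => D.Kp (odd (g i))).prod = D.Kp b ∧
      (L.map fun i => sgnL (g i)).prod = sg (!b) := by
    intro L
    induction L with
    | nil => exact ⟨false, rfl, rfl⟩
    | cons i L ih =>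
      obtain ⟨b, h1, h2⟩ := ih
      simp only [List.map_cons, List.prod_cons]
      rw [h1, h2, sgnL_eq]
      cases h : odd (g i)
      · exact ⟨b, by simp, by simp⟩
      · exact ⟨!b, D.K_mul_Kp b, by simp⟩
  obtain ⟨b, h1, h2⟩ := h (List.finRange n)
  rw [← List.ofFn_eq_map, List.prod_ofFn, ← parity, hg] at h2
  cases b
  · exact h1
  · norm_num at h2

/-- The power of `K` in the first leg makes the letters commute with the factors at other sites. -/
theorem commute_G_letter {i j : Fin n} (hij : i ≠ j) (l : Letter) :
    Commute (D.G i) (D.Kp (odd l) ⊗ₜ D.letter j l) := by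
  have h1 : ∀ b, D.K * D.ξ b i * D.Kp (odd l) = sgnL l • (D.Kp (odd l) * (D.K * D.ξ b i)) :=
    fun b => by
      rw [mul_assoc, ξ_mul_Kp, sgnL_eq, mul_smul_comm, ← mul_assoc, K_mul_Kp_comm, mul_assoc]
  have h2 : ∀ b, D.ξ b i * D.letter j l = sgnL l • (D.letter j l * D.ξ b i) := fun b =>
    D.ξ_mul_letter b hij l
  have hZ : Commute (D.Z i) (D.Kp (odd l) ⊗ₜ D.letter j l) := by
    rw [Commute, SemiconjBy, Z, Algebra.TensorProduct.tmul_mul_tmul,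
      Algebra.TensorProduct.tmul_mul_tmul, h1, h2, TensorProduct.smul_tmul_smul, sgnL_mul_self,
      one_smul]
  have hZ'' : Commute (D.Z'' i) (D.Kp (odd l) ⊗ₜ D.letter j l) := by
    rw [Commute, SemiconjBy, Z'', Algebra.TensorProduct.tmul_mul_tmul,
      Algebra.TensorProduct.tmul_mul_tmul, h1, mul_assoc, h2, mul_smul_comm, ← mul_assoc D.C,
      (D.commute_C _).eq, mul_assoc, TensorProduct.smul_tmul_smul, sgnL_mul_self, one_smul]
  exact ((Commute.one_left _).sub_left hZ).mul_left ((Commute.one_left _).add_left hZ'')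

/-- A linear functional that is the Berezin integral on each of the two sectors, in terms of
monomials whose full letter is `ξ̄_i ξ_i`, with a given value on the top monomials. -/
def IsBerezin (lam : A →ₗ[ℂ] ℂ) (c : ℂ) : Prop :=
  ∀ s a h, lam (D.e s * (D.Kp a * D.X' h)) = if a = false ∧ h = fun _ => (true, true) then c else 0

/-- The map `x ↦ (id ⊗ λ)(R⁻¹ (1 ⊗ x) R₂₁⁻¹)`. -/
noncomputable def Smap (lam : A →ₗ[ℂ] ℂ) : A →ₗ[ℂ] A :=
  (TensorProduct.rid ℂ A).toLinearMap ∘ₗ lam.lTensor A ∘ₗ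
    LinearMap.mulLeft ℂ (Ring.inverse D.Rm) ∘ₗ
      LinearMap.mulRight ℂ (Ring.inverse (TensorProduct.comm ℂ A A D.Rm)) ∘ₗ
        TensorProduct.mk ℂ A A 1

theorem K_mul_X' (g : Fin n → Letter) : D.X' g * D.K = parity g • (D.K * D.X' g) := by
  have h : D.K * D.X' g = parity g • (D.X' g * D.K) := by
    refine mul_oprod_of_smul _ _ _ fun i => ?_
    rcases h : g i with ⟨_ | _, _ | _⟩
    · simp [sgnL]
    · simp [sgnL, D.K_mul_ξ]
    · simp [sgnL, D.K_mul_ξ]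
    · rw [letter'_tt, ← mul_assoc, D.K_mul_ξ, neg_mul, mul_assoc, D.K_mul_ξ]
      simp [sgnL, mul_assoc]
  rw [h, smul_smul, parity_mul_self, one_smul]

/-- The operator `R⁻¹ R₂₁⁻¹` is a product over the sites, and the Berezin integral selects the full
letter of the second leg at every site. -/
theorem e_mul_Smap_mono {lam : A →ₗ[ℂ] ℂ} {c : ℂ} (hlam : D.IsBerezin lam c) (s t a : Bool)
    {g : Fin n → Letter} (hg : CentralIdx (t, a, g)) :
    D.e s * D.Smap lam (D.mono (t, a, g)) = if a = !s then c • (D.e s *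
      (oprod (fun i => D.coeffS t i (g i) (true, true)) * D.Kp (!t))) else 0 := by
  have hpar := parity_of_centralIdx hg
  have hcentral := D.commute_mono hg
  have hS : D.Smap lam (D.mono (t, a, g)) = TensorProduct.rid ℂ A (lam.lTensor A
      ((1 ⊗ₜ D.mono (t, a, g)) * (oprod D.G * (D.R₀ * D.R₀')))) := by
    rw [← inverse_Rm_mul_inverse, ← mul_assoc, (commute_one_tmul hcentral _).eq, mul_assoc]
    rfl
  have hmul : ∀ W, D.e s * TensorProduct.rid ℂ A (lam.lTensor A W) =
      TensorProduct.rid ℂ A (lam.lTensor A ((D.e s ⊗ₜ 1) * W)) := fun W => by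
    induction W with
    | zero => simp
    | add x y hx hy => simp only [map_add, mul_add, hx, hy]
    | tmul x y => simp
  have hone : (1 : A) ⊗ₜ[ℂ] D.X g = oprod fun i => D.Kp (odd (g i)) ⊗ₜ[ℂ] D.letter i (g i) := by
    rw [oprod_tmul, oprod_Kp_odd D hpar, X]
  have hsite : (1 : A) ⊗ₜ[ℂ] D.e t * (((1 : A) ⊗ₜ[ℂ] D.X g) * oprod D.G) =
      (1 : A) ⊗ₜ[ℂ] D.e t * ∑ r : Fin n → Letter,
        (oprod fun i => D.coeffS t i (g i) (r i)) ⊗ₜ[ℂ] D.X' r := by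
    rw [hone, oprod_mul_oprod _ _ fun i j hij => D.commute_G_letter hij _,
      mul_oprod_congr _ (commute_one_tmul (A := A) (D.commute_e t)) _
        (fun i => ∑ r, D.coeffS t i (g i) r ⊗ₜ[ℂ] D.letter' i r)
        (fun i => D.one_tmul_e_mul_G t i (g i)), oprod_sum]
    simp only [oprod_tmul, X']
  have hW : (D.e s ⊗ₜ[ℂ] (1 : A)) * ((1 ⊗ₜ D.mono (t, a, g)) * (oprod D.G * (D.R₀ * D.R₀'))) =
      ∑ r : Fin n → Letter, (D.e s * ((oprod fun i => D.coeffS t i (g i) (r i)) * D.Kp (!t))) ⊗ₜ[ℂ]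
        (D.e t * (D.Kp a * (D.X' r * D.Kp (!s)))) := by
    have hc : ∀ W, Commute ((1 : A) ⊗ₜ[ℂ] D.e t) W := commute_one_tmul (D.commute_e t)
    have hc' : ∀ W, Commute (D.e s ⊗ₜ[ℂ] (1 : A)) W := fun W => by
      induction W with
      | zero => exact Commute.zero_right _
      | add x y hx hy => exact hx.add_right hy
      | tmul x y =>
        rw [Commute, SemiconjBy, Algebra.TensorProduct.tmul_mul_tmul,
          Algebra.TensorProduct.tmul_mul_tmul, (D.commute_e s x).eq, one_mul, mul_one]
    have h1 : (1 : A) ⊗ₜ[ℂ] D.mono (t, a, g) =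
        ((1 : A) ⊗ₜ[ℂ] D.e t) * (((1 : A) ⊗ₜ[ℂ] D.Kp a) * ((1 : A) ⊗ₜ[ℂ] D.X g)) := by
      simp [mono]
    have h2 : D.e s ⊗ₜ[ℂ] D.e t = (D.e s ⊗ₜ[ℂ] (1 : A)) * ((1 : A) ⊗ₜ[ℂ] D.e t) := by simp
    have h3 : D.e s ⊗ₜ[ℂ] (1 : A) * ((1 ⊗ₜ D.mono (t, a, g)) * (oprod D.G * (D.R₀ * D.R₀'))) =
        ((1 : A) ⊗ₜ[ℂ] D.Kp a) * (((1 : A) ⊗ₜ[ℂ] D.e t * (((1 : A) ⊗ₜ[ℂ] D.X g) * oprod D.G)) *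
          (D.e s ⊗ₜ[ℂ] D.e t * (D.R₀ * D.R₀'))) := by
      have h4 : (1 : A) ⊗ₜ[ℂ] D.e t * ((1 : A) ⊗ₜ[ℂ] D.e t) = (1 : A) ⊗ₜ[ℂ] D.e t := by
        simp [e_mul_self]
      generalize D.R₀ * D.R₀' = W
      generalize oprod D.G = V
      rw [h1, h2, ← h4]
      generalize (1 : A) ⊗ₜ[ℂ] D.e t = u at *
      generalize D.e s ⊗ₜ[ℂ] (1 : A) = v at *
      generalize (1 : A) ⊗ₜ[ℂ] D.Kp a = k at *
      generalize (1 : A) ⊗ₜ[ℂ] D.X g = x at *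
      simp only [h4]
      have e1 := (hc' k).eq
      have e2 := (hc k).eq
      have e3 := (hc (x * V)).eq
      have e4 := (hc v).eq
      calc v * (u * (k * x) * (V * W)) = v * (u * k * (x * V * W)) := by simp only [mul_assoc]
        _ = v * k * (u * (x * V) * W) := by rw [e2]; simp only [mul_assoc]
        _ = k * (v * (u * (x * V)) * W) := by rw [e1]; simp only [mul_assoc]
        _ = k * (u * (x * V) * v * W) := by rw [(hc' (u * (x * V))).eq]
        _ = k * (u * u * (x * V) * v * W) := by rw [h4]
        _ = k * (u * (x * V) * u * v * W) := by
          rw [show u * u * (x * V) = u * (x * V) * u by rw [mul_assoc u, mul_assoc u, ← e3]]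
        _ = k * (u * (x * V) * (v * u * W)) := by rw [mul_assoc _ u v, e4]; simp only [mul_assoc]
    rw [h3, hsite, e_tmul_e_mul_R₀, Finset.mul_sum, Finset.sum_mul, Finset.mul_sum]
    refine Finset.sum_congr rfl fun r _ => ?_
    simp only [Algebra.TensorProduct.tmul_mul_tmul, one_mul]
    congr 1
    · rw [← mul_assoc, ← (D.commute_e s _).eq, mul_assoc]
    · have h5 : ∀ w, D.e t * (w * (D.e t * D.Kp (!s))) = D.e t * (w * D.Kp (!s)) := fun w => by
        rw [← mul_assoc w, ← (D.commute_e t w).eq, ← mul_assoc, ← mul_assoc, e_mul_self, mul_assoc]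
      rw [mul_assoc, h5, ← mul_assoc, ← (D.commute_e t _).eq, mul_assoc]
  rw [hS, hmul, hW, map_sum, map_sum]
  have hterm : ∀ r : Fin n → Letter, lam (D.e t * (D.Kp a * (D.X' r * D.Kp (!s)))) =
      if a = (!s) ∧ r = fun _ => (true, true) then c else 0 := by
    intro r
    cases s
    · have h : D.e t * (D.Kp a * (D.X' r * D.K)) =
          parity r • (D.e t * (D.Kp (!a) * D.X' r)) := by
        rw [K_mul_X', mul_smul_comm, mul_smul_comm, ← mul_assoc (D.Kp a), Kp_mul_K]
      simp only [Bool.not_false, Kp_true]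
      rw [h, map_smul, hlam]
      by_cases hr : r = fun _ => (true, true)
      · subst hr
        rw [parity_const_even, one_smul]
        cases a <;> simp
      · simp [hr]
    · simp only [Bool.not_true, Kp_false, mul_one]
      exact hlam t a r
  simp only [LinearMap.lTensor_tmul, TensorProduct.rid_tmul, hterm]
  split_ifs with ha
  · rw [Finset.sum_eq_single fun _ => (true, true)]
    · rw [if_pos ⟨ha, rfl⟩]
    · intro r _ hr
      rw [if_neg fun h => hr h.2, zero_smul]
    · simp
  · exact Finset.sum_eq_zero fun r _ => by rw [if_neg fun h => ha h.1, zero_smul]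

/-- The effect of the modular transformation on the letters in the sector `C = 1`. -/
def swapL (l : Letter) : Letter := if l.1 = l.2 then (!l.1, !l.1) else l

/-- The sign in the effect of the modular transformation on a letter. -/
def swapSign (l : Letter) : ℂ := if l = (true, true) then -1 else 1

variable {D} {lam : A →ₗ[ℂ] ℂ} {c : ℂ} (hlam : D.IsBerezin lam c)
include hlam

theorem Smap_even {g : Fin n → Letter} (hg : parity g = 1) :
    D.Smap lam (D.mono (true, false, g)) =
      (c * ∏ i, swapSign (g i)) • D.mono (true, false, fun i => swapL (g i)) := by
  have hc : CentralIdx (true, false, g) := Or.inl ⟨rfl, rfl, hg⟩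
  rw [← one_mul (D.Smap lam _), ← D.e_add_e, add_mul, D.e_mul_Smap_mono hlam _ _ _ hc,
    D.e_mul_Smap_mono hlam _ _ _ hc]
  simp only [Bool.not_true, Bool.not_false, if_true, Bool.false_eq_true, if_false, add_zero,
    Kp_false, mul_one]
  rw [mul_smul, D.e_mul_oprod_congr true _ (fun i => swapSign (g i) • D.letter i (swapL (g i))),
    oprod_smul, mul_smul_comm]
  · simp [mono, X]
  · intro i
    have h : D.e true * (D.ξ true i * D.ξ false i) = D.e true * D.γ i := by
      have := (D.e_true_mul_ξ_mul_letter true i (false, true)).1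
      simpa [extCoeff, hasBit, setBit] using this
    rcases g i with ⟨_ | _, _ | _⟩ <;> simp [coeffS, swapL, swapSign, half, h]

theorem Smap_hig_zero (hn : Even n) : D.Smap lam (D.mono (higIdx 0)) = c • D.mono (higIdx 1) := by
  have hc : CentralIdx (higIdx (n := n) 0) := Or.inr ⟨0, rfl⟩
  rw [← one_mul (D.Smap lam _), ← D.e_add_e, add_mul]
  change D.e true * D.Smap lam (D.mono (true, true, _)) +
    D.e false * D.Smap lam (D.mono (true, true, _)) = _
  rw [D.e_mul_Smap_mono hlam _ _ _ hc, D.e_mul_Smap_mono hlam _ _ _ hc, mono_hig_one]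
  simp only [coeffS, half, Bool.not_true, Bool.not_false, if_true, zero_mul, zero_smul, sub_zero,
    oprod_const, hn.neg_one_pow, Kp_false, mul_one, Bool.true_eq_false, if_false, zero_add]

theorem Smap_hig_one (hn : Even n) : D.Smap lam (D.mono (higIdx 1)) = c • D.mono (higIdx 0) := by
  have hc : CentralIdx (higIdx (n := n) 1) := Or.inr ⟨1, rfl⟩
  rw [← one_mul (D.Smap lam _), ← D.e_add_e, add_mul]
  change D.e true * D.Smap lam (D.mono (false, false, _)) +
    D.e false * D.Smap lam (D.mono (false, false, _)) = _
  rw [D.e_mul_Smap_mono hlam _ _ _ hc, D.e_mul_Smap_mono hlam _ _ _ hc]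
  simp only [coeffS, Bool.not_true, Bool.not_false, if_true, Bool.false_eq_true, if_false,
    add_zero, Kp_true]
  congr 1
  rw [← mul_assoc, D.e_mul_oprod_congr true _ (fun i => (-1 : ℂ) • D.γ i), oprod_smul, mul_assoc]
  · change _ = D.e true * (D.K * oprod fun i => D.γ i)
    rw [mul_oprod_comm D.K _ _ D.K_mul_γ]
    simp [hn.neg_one_pow]
  · intro i
    have := (D.e_true_mul_ξ_mul_letter true i (false, true)).1
    have h : D.e true * (D.ξ true i * D.ξ false i) = D.e true * D.γ i := by
      simpa [extCoeff, hasBit, setBit] using this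
    simp [h]

theorem Smap_hig_two : D.Smap lam (D.mono (higIdx 2)) = c • D.mono (higIdx 2) := by
  have hc : CentralIdx (higIdx (n := n) 2) := Or.inr ⟨2, rfl⟩
  rw [← one_mul (D.Smap lam _), ← D.e_add_e, add_mul]
  change D.e true * D.Smap lam (D.mono (false, true, _)) +
    D.e false * D.Smap lam (D.mono (false, true, _)) = _
  rw [D.e_mul_Smap_mono hlam _ _ _ hc, D.e_mul_Smap_mono hlam _ _ _ hc]
  simp only [coeffS, Bool.not_true, Bool.not_false, if_true, Bool.true_eq_false, if_false,
    zero_add, Kp_true]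
  congr 1
  rw [← mul_assoc, D.e_mul_oprod_congr false _ (fun i => D.γ i), mul_assoc]
  · change _ = D.e false * (D.K * oprod fun i => D.γ i)
    rw [mul_oprod_comm D.K _ _ D.K_mul_γ]
  · intro i
    have := D.ξ_mul_ξ_not true i
    simp only [Bool.not_true, sg_true, one_smul] at this
    simp only [half, Bool.false_eq_true, if_false, sg_false, neg_smul, one_smul, this,
      mul_sub, mul_neg, mul_add, mul_one, e_mul_self]
    abel

end DoubleGens

/-! ### The generators of the double of the Nichols Hopf algebra -/

namespace Nichols

variable {n : ℕ}

theorem conv_comp_xi_left (φ ψ : Module.Dual ℂ (Nichols n)) (i : Fin n) :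
    conv φ ψ ∘ₗ LinearMap.mulLeft ℂ (xi i) =
      conv (φ ∘ₗ LinearMap.mulLeft ℂ K) (ψ ∘ₗ LinearMap.mulLeft ℂ (xi i)) +
      conv (φ ∘ₗ LinearMap.mulLeft ℂ (xi i)) ψ := by
  ext x
  simp only [LinearMap.comp_apply, conv_apply, LinearMap.mulLeft_apply, Bialgebra.comul_mul,
    comul_xi, LinearMap.add_apply]
  induction Coalgebra.comul (R := ℂ) x with
  | zero => simp
  | add x y hx hy => simp only [mul_add, map_add, hx, hy]; ring
  | tmul x y => simp [add_mul]

theorem conv_one (φ ψ : Module.Dual ℂ (Nichols n)) : conv φ ψ 1 = φ 1 * ψ 1 := by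
  rw [conv_apply, Bialgebra.comul_one, Algebra.TensorProduct.one_def]
  simp

theorem conv_K_mul (φ ψ : Module.Dual ℂ (Nichols n)) (y : Nichols n) :
    conv φ ψ (K * y) = conv (φ ∘ₗ LinearMap.mulLeft ℂ K) (ψ ∘ₗ LinearMap.mulLeft ℂ K) y :=
  LinearMap.congr_fun (conv_comp_K_left φ ψ) y

theorem conv_xi_mul (φ ψ : Module.Dual ℂ (Nichols n)) (i : Fin n) (y : Nichols n) :
    conv φ ψ (xi i * y) =
      conv (φ ∘ₗ LinearMap.mulLeft ℂ K) (ψ ∘ₗ LinearMap.mulLeft ℂ (xi i)) y +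
      conv (φ ∘ₗ LinearMap.mulLeft ℂ (xi i)) ψ y :=
  LinearMap.congr_fun (conv_comp_xi_left φ ψ i) y

/-- A functional that vanishes at `1` vanishes, if multiplication by the generators preserves its
zeros. -/
theorem dual_eq_zero (f : Module.Dual ℂ (Nichols n)) (h1 : f 1 = 0)
    (hK : ∀ y, f y = 0 → f (K * y) = 0) (hxi : ∀ i y, f y = 0 → f (xi i * y) = 0) : f = 0 := by
  have h : ∀ x y, f y = 0 → f (x * y) = 0 := by
    intro x
    induction x using induct with
    | hK => exact hK
    | hxi i => exact hxi i
    | halg r => intro y hy; rw [← Algebra.smul_def, map_smul, hy, smul_zero]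
    | hadd a b ha hb => intro y hy; rw [add_mul, map_add, ha y hy, hb y hy, add_zero]
    | hmul a b ha hb => intro y hy; rw [mul_assoc]; exact ha _ (hb y hy)
  ext x
  simpa using h x 1 h1

/-- The character of `H` that sends `K` to `-1`. -/
noncomputable def kChar : Nichols n →ₐ[ℂ] ℂ :=
  lift (-1) (fun _ => 0) (by simp) (by simp) (by simp) (by simp)

/-- The element `K̄` of `H*`. -/
noncomputable def kFun : Module.Dual ℂ (Nichols n) := kChar.toLinearMap

/-- The two-dimensional representation of `H`, an extension of the counit by `kChar`, in which `ξ_i`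
acts by an elementary matrix and the other `ξ_j` act by `0`. -/
noncomputable def extRep (i : Fin n) : Nichols n →ₐ[ℂ] Matrix (Fin 2) (Fin 2) ℂ :=
  lift !![1, 0; 0, -1] (fun j => if j = i then !![0, 1; 0, 0] else 0)
    (by simp [Matrix.one_fin_two])
    (fun j => by split_ifs <;> simp [← Matrix.ext_iff, Fin.forall_fin_two])
    (fun j => by split_ifs <;> simp)
    (fun j k => by split_ifs <;> simp)

/-- The element `ξ̄_i` of `H*`: a matrix coefficient of the representation `extRep i`. -/
noncomputable def xFun (i : Fin n) : Module.Dual ℂ (Nichols n) :=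
  Matrix.entryLinearMap ℂ ℂ 0 1 ∘ₗ (extRep i).toLinearMap

theorem kFun_mul (x y : Nichols n) : kFun (x * y) = kFun x * kFun y := map_mul kChar x y
@[simp] theorem kFun_one : kFun (1 : Nichols n) = 1 := map_one kChar
@[simp] theorem kFun_K : kFun (K : Nichols n) = -1 := lift_K ..
@[simp] theorem kFun_xi (i : Fin n) : kFun (xi i : Nichols n) = 0 := lift_xi ..

theorem extRep_apply (i : Fin n) (x : Nichols n) :
    extRep i x = !![Coalgebra.counit (R := ℂ) x, xFun i x; 0, kFun x] := by
  have h : extRep i x 0 0 = Coalgebra.counit (R := ℂ) x ∧ extRep i x 1 0 = 0 ∧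
      extRep i x 1 1 = kFun x := by
    induction x using induct with
    | hK => simp [extRep, counit_K]
    | hxi j => rw [extRep, lift_xi, counit_xi, kFun_xi]; split_ifs <;> simp
    | halg r =>
      rw [AlgHom.commutes, Bialgebra.counit_algebraMap]
      refine ⟨?_, ?_, ?_⟩
      · simp [Matrix.algebraMap_matrix_apply]
      · simp [Matrix.algebraMap_matrix_apply]
      · rw [kFun, AlgHom.toLinearMap_apply, AlgHom.commutes]
        simp [Matrix.algebraMap_matrix_apply]
    | hadd a b ha hb => simp [ha, hb]
    | hmul a b ha hb =>
      simp [Matrix.mul_apply, Fin.sum_univ_two, ha, hb, kFun_mul]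
  ext a b
  fin_cases a <;> fin_cases b
  exacts [h.1, rfl, h.2.1, h.2.2]

theorem xFun_mul (i : Fin n) (x y : Nichols n) :
    xFun i (x * y) = Coalgebra.counit (R := ℂ) x * xFun i y + xFun i x * kFun y := by
  have h : extRep i (x * y) 0 1 = (extRep i x * extRep i y) 0 1 := by rw [map_mul]
  rw [extRep_apply, extRep_apply, extRep_apply] at h
  simpa [Matrix.mul_apply, Fin.sum_univ_two] using h

@[simp] theorem xFun_one (i : Fin n) : xFun i (1 : Nichols n) = 0 := by
  rw [xFun, LinearMap.comp_apply, AlgHom.toLinearMap_apply, map_one]; simp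

@[simp] theorem xFun_K (i : Fin n) : xFun i (K : Nichols n) = 0 := by
  rw [xFun, LinearMap.comp_apply, AlgHom.toLinearMap_apply, extRep, lift_K]; simp

theorem xFun_xi (i j : Fin n) : xFun i (xi j : Nichols n) = if j = i then 1 else 0 := by
  rw [xFun, LinearMap.comp_apply, AlgHom.toLinearMap_apply, extRep, lift_xi]; split_ifs <;> simp

theorem counit_comp_K : (Coalgebra.counit : Module.Dual ℂ (Nichols n)) ∘ₗ LinearMap.mulLeft ℂ K =
    Coalgebra.counit := by ext x; simp [counit_K]

theorem counit_comp_xi (i : Fin n) :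
    (Coalgebra.counit : Module.Dual ℂ (Nichols n)) ∘ₗ LinearMap.mulLeft ℂ (xi i) = 0 := by
  ext x; simp [counit_xi]

theorem kFun_comp_K : (kFun : Module.Dual ℂ (Nichols n)) ∘ₗ LinearMap.mulLeft ℂ K = -kFun := by
  ext x; simp [kFun_mul]

theorem kFun_comp_xi (i : Fin n) :
    (kFun : Module.Dual ℂ (Nichols n)) ∘ₗ LinearMap.mulLeft ℂ (xi i) = 0 := by
  ext x; simp [kFun_mul]

theorem xFun_comp_K (i : Fin n) : xFun i ∘ₗ LinearMap.mulLeft ℂ K = xFun i := by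
  ext x; simp [xFun_mul, counit_K]

theorem xFun_comp_xi (i j : Fin n) :
    xFun i ∘ₗ LinearMap.mulLeft ℂ (xi j) = if j = i then kFun else 0 := by
  ext x
  rw [LinearMap.comp_apply, LinearMap.mulLeft_apply, xFun_mul, counit_xi, xFun_xi]
  split_ifs <;> simp

theorem conv_kFun_kFun : conv kFun kFun = (Coalgebra.counit : Module.Dual ℂ (Nichols n)) := by
  rw [← sub_eq_zero]
  refine dual_eq_zero _ ?_ ?_ ?_
  · simp [conv_one]
  · intro y hy
    rw [LinearMap.sub_apply, conv_K_mul, kFun_comp_K]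
    simpa [counit_K] using hy
  · intro i y _
    rw [LinearMap.sub_apply, conv_xi_mul, kFun_comp_xi]
    simp [counit_xi]

theorem conv_kFun_xFun (i : Fin n) : conv kFun (xFun i) = -conv (xFun i) kFun := by
  rw [← add_eq_zero_iff_eq_neg]
  refine dual_eq_zero _ ?_ ?_ ?_
  · simp [conv_one]
  · intro y hy
    rw [LinearMap.add_apply, conv_K_mul, conv_K_mul, kFun_comp_K, xFun_comp_K]
    rw [LinearMap.add_apply] at hy
    simp only [map_neg, LinearMap.neg_apply]
    linear_combination -hy
  · intro j y _
    rw [LinearMap.add_apply, conv_xi_mul, conv_xi_mul, kFun_comp_xi, kFun_comp_K, xFun_comp_xi]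
    split_ifs <;> simp

theorem conv_xFun_xFun (i j : Fin n) : conv (xFun i) (xFun j) = -conv (xFun j) (xFun i) := by
  rw [← add_eq_zero_iff_eq_neg]
  refine dual_eq_zero _ ?_ ?_ ?_
  · simp [conv_one]
  · intro y hy
    rw [LinearMap.add_apply, conv_K_mul, conv_K_mul, xFun_comp_K, xFun_comp_K]
    exact hy
  · intro k y _
    rw [LinearMap.add_apply, conv_xi_mul, conv_xi_mul, xFun_comp_xi, xFun_comp_xi, xFun_comp_K,
      xFun_comp_K]
    split_ifs <;> simp [conv_kFun_xFun]

/-! ### The dual words -/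

/-- The convolution product of the `ξ̄_i` with `i ∈ T`, along a list. -/
noncomputable def barProd (T : Finset (Fin n)) : List (Fin n) → Module.Dual ℂ (Nichols n)
  | [] => Coalgebra.counit
  | i :: L => if i ∈ T then conv (xFun i) (barProd T L) else barProd T L

theorem barProd_comp_K (T : Finset (Fin n)) (L : List (Fin n)) :
    barProd T L ∘ₗ LinearMap.mulLeft ℂ K = barProd T L := by
  induction L with
  | nil => exact counit_comp_K
  | cons i L ih =>
    rw [barProd]
    split_ifs
    · rw [conv_comp_K_left, xFun_comp_K, ih]
    · exact ih

theorem barProd_comp_xi (T : Finset (Fin n)) (L : List (Fin n)) (j : Fin n) (hj : j ∉ L) :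
    barProd T L ∘ₗ LinearMap.mulLeft ℂ (xi j) = 0 := by
  induction L with
  | nil => exact counit_comp_xi j
  | cons i L ih =>
    rw [List.mem_cons, not_or] at hj
    rw [barProd]
    split_ifs
    · rw [conv_comp_xi_left, ih hj.2, xFun_comp_xi, if_neg hj.1]
      simp
    · exact ih hj.2

theorem conv_kFun_listProd (ψ : Module.Dual ℂ (Nichols n)) (S : Finset (Fin n))
    (L : List (Fin n)) : conv kFun ψ (listProd xi L S) =
      (-1) ^ (L.filter (· ∈ S)).length * ψ (listProd xi L S) := by
  induction L generalizing ψ with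
  | nil => simp [listProd, conv_one]
  | cons i L ih =>
    have hcons : (listProd xi (i :: L) S : Nichols n) =
        (if i ∈ S then xi i else 1) * listProd xi L S := by simp [listProd]
    rw [hcons]
    by_cases h : i ∈ S
    · rw [if_pos h, conv_xi_mul, kFun_comp_xi, kFun_comp_K]
      simp [h, ih, pow_succ]
    · simp [h, ih]

theorem conv_xFun_listProd (ψ : Module.Dual ℂ (Nichols n)) (S : Finset (Fin n))
    (L : List (Fin n)) (j : Fin n) (hj : j ∉ L) : conv (xFun j) ψ (listProd xi L S) = 0 := by
  induction L generalizing ψ with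
  | nil => simp [listProd, conv_one]
  | cons i L ih =>
    rw [List.mem_cons, not_or] at hj
    have hcons : (listProd xi (i :: L) S : Nichols n) =
        (if i ∈ S then xi i else 1) * listProd xi L S := by simp [listProd]
    rw [hcons]
    by_cases h : i ∈ S
    · rw [if_pos h, conv_xi_mul, xFun_comp_xi, xFun_comp_K, if_neg (Ne.symm hj.1), ih _ hj.2]
      simp
    · simp [h, ih _ hj.2]

theorem barProd_listProd (T S : Finset (Fin n)) (L : List (Fin n)) (hL : L.Nodup) :
    barProd T L (listProd xi L S) = if L.filter (· ∈ S) = L.filter (· ∈ T) then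
      (-1) ^ ((L.filter (· ∈ S)).length * ((L.filter (· ∈ S)).length - 1) / 2) else 0 := by
  induction L with
  | nil => simp [listProd, barProd]
  | cons i L ih =>
    rw [List.nodup_cons] at hL
    have hcons : (listProd xi (i :: L) S : Nichols n) =
        (if i ∈ S then xi i else 1) * listProd xi L S := by simp [listProd]
    have hne : ∀ (M : List (Fin n)) (U : Finset (Fin n)), i :: M ≠ L.filter (· ∈ U) := by
      intro M U h
      have : i ∈ L.filter (· ∈ U) := h ▸ List.mem_cons_self
      exact hL.1 (List.mem_of_mem_filter this)
    rw [hcons, barProd]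
    by_cases hS : i ∈ S <;> by_cases hT : i ∈ T
    · rw [if_pos hS, if_pos hT, conv_xi_mul, barProd_comp_xi _ _ _ hL.1, xFun_comp_xi, if_pos rfl,
        conv_kFun_listProd, ih hL.2]
      simp only [map_zero, LinearMap.zero_apply, zero_add, mul_ite, mul_zero, ← pow_add, hS, hT,
        decide_true, List.filter_cons_of_pos, List.cons.injEq, true_and, List.length_cons,
        Nat.add_sub_cancel]
      congr 2
      have h := Nat.triangle_succ (L.filter (· ∈ S)).length
      rw [Nat.add_sub_cancel] at h
      rw [h, add_comm]
    · rw [if_pos hS, if_neg hT]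
      have := LinearMap.congr_fun (barProd_comp_xi T L i hL.1) (listProd xi L S)
      rw [LinearMap.comp_apply, LinearMap.mulLeft_apply] at this
      rw [this]
      simp [hS, hT, hne]
    · rw [if_neg hS, if_pos hT, one_mul, conv_xFun_listProd _ _ _ _ hL.1]
      simp [hS, hT, (hne _ _).symm]
    · simp [hS, hT, ih hL.2]

end Nichols

namespace Nichols

variable {n : ℕ}

/-- The sign `(-1) ^ (k (k - 1) / 2)` of the reversal of `k` odd letters. -/
def revSign (k : ℕ) : ℂ := (-1) ^ (k * (k - 1) / 2)

theorem revSign_mul_self (k : ℕ) : revSign k * revSign k = 1 := by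
  rw [revSign, ← pow_add, ← two_mul, pow_mul]; norm_num

theorem K_pow_comp (φ : Module.Dual ℂ (Nichols n)) (h : φ ∘ₗ LinearMap.mulLeft ℂ K = φ)
    (a : Fin 2) (x : Nichols n) : φ (K ^ (a : ℕ) * x) = φ x := by
  have h' : φ (K * x) = φ x := LinearMap.congr_fun h x
  fin_cases a <;> simp [h']

/-- The functional `w̄_T`, the convolution product of the `ξ̄_i` with `i ∈ T` in increasing order. -/
noncomputable def barFun (T : Finset (Fin n)) : Module.Dual ℂ (Nichols n) :=
  barProd T (List.finRange n)

theorem filter_finRange_eq_iff (S T : Finset (Fin n)) :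
    (List.finRange n).filter (· ∈ S) = (List.finRange n).filter (· ∈ T) ↔ S = T := by
  constructor
  · intro h
    ext i
    have := congrArg (i ∈ ·) h
    simpa using this
  · rintro rfl; rfl

theorem length_filter_finRange (S : Finset (Fin n)) :
    ((List.finRange n).filter (· ∈ S)).length = S.card := by
  rw [← List.toFinset_card_of_nodup ((List.nodup_finRange n).filter _)]
  congr 1
  ext i; simp

theorem barFun_comp_K (T : Finset (Fin n)) : barFun T ∘ₗ LinearMap.mulLeft ℂ K = barFun T :=
  barProd_comp_K T _

theorem barFun_word (T : Finset (Fin n)) (a : Fin 2) (S : Finset (Fin n)) :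
    barFun T (word (a, S)) = if S = T then revSign S.card else 0 := by
  rw [word, K_pow_comp _ (barFun_comp_K T)]
  change barProd T _ (listProd xi (List.finRange n) S) = _
  rw [barProd_listProd _ _ _ (List.nodup_finRange n)]
  simp only [filter_finRange_eq_iff, length_filter_finRange, revSign]

theorem conv_kFun_word (ψ : Module.Dual ℂ (Nichols n)) (h : ψ ∘ₗ LinearMap.mulLeft ℂ K = ψ)
    (a : Fin 2) (S : Finset (Fin n)) : conv kFun ψ (word (a, S)) =
      (-1) ^ ((a : ℕ) + S.card) * ψ (word (a, S)) := by
  have h0 : conv kFun ψ (orderedProd xi S) = (-1) ^ S.card * ψ (orderedProd xi S) := by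
    have := conv_kFun_listProd ψ S (List.finRange n)
    rwa [length_filter_finRange] at this
  rw [word, K_pow_comp _ h]
  fin_cases a
  · simpa using h0
  · change conv kFun ψ (K ^ 1 * orderedProd xi S) = (-1) ^ (1 + S.card) * _
    rw [pow_one, conv_K_mul, kFun_comp_K, h, map_neg, LinearMap.neg_apply, LinearMap.neg_apply,
      h0, pow_add]
    ring

/-- The dual basis in terms of the dual words. -/
theorem coord_eq (a : Fin 2) (S : Finset (Fin n)) : (basis n).coord (a, S) =
    (revSign S.card / 2) • (barFun S + (-1 : ℂ) ^ ((a : ℕ) + S.card) • conv kFun (barFun S)) := by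
  refine (basis n).ext fun ⟨b, T⟩ => ?_
  rw [Module.Basis.coord_apply, Module.Basis.repr_self, basis_apply]
  simp only [LinearMap.smul_apply, LinearMap.add_apply,
    conv_kFun_word _ (barFun_comp_K S), barFun_word, smul_eq_mul]
  by_cases h : T = S
  · subst h
    have h2 := revSign_mul_self T.card
    have h3 : ((-1 : ℂ) ^ T.card) * (-1) ^ T.card = 1 := by rw [← mul_pow]; norm_num
    have h4 : (-1 : ℂ) ^ T.card * ((-1) ^ T.card * revSign T.card) = revSign T.card := by
      rw [← mul_assoc, h3, one_mul]
    simp only [if_true, pow_add]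
    fin_cases a <;> fin_cases b <;> simp [h4] <;> linear_combination -h2
  · rw [if_neg h, Finsupp.single_eq_of_ne (by simp [Ne.symm h])]
    simp

theorem barFun_empty : barFun ∅ = (Coalgebra.counit : Module.Dual ℂ (Nichols n)) := by
  have : ∀ L : List (Fin n), barProd ∅ L = Coalgebra.counit := fun L => by
    induction L with
    | nil => rfl
    | cons i L ih => simpa [barProd] using ih
  exact this _

theorem barFun_singleton (i : Fin n) : barFun {i} = xFun i := by
  have h : ∀ L : List (Fin n), L.Nodup →
      barProd {i} L = if i ∈ L then xFun i else Coalgebra.counit := fun L hL => by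
    induction L with
    | nil => rfl
    | cons j L ih =>
      rw [List.nodup_cons] at hL
      rw [barProd, ih hL.2]
      by_cases hj : j = i
      · subst hj
        simp [hL.1, conv_counit]
      · simp [hj, Ne.symm hj]
  rw [barFun, h _ (List.nodup_finRange n), if_pos (List.mem_finRange i)]

theorem coord_sub_coord : (basis n).coord (0, ∅) - (basis n).coord (1, ∅) = kFun := by
  rw [coord_eq, coord_eq, barFun_empty, conv_counit]
  simp [revSign]
  module

theorem coord_add_coord (i : Fin n) :
    (basis n).coord (0, {i}) + (basis n).coord (1, {i}) = xFun i := by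
  rw [coord_eq, coord_eq, barFun_singleton]
  simp [revSign]
  module

end Nichols

namespace DNichols

variable {n : ℕ}

theorem ofDual_mul (φ ψ : Module.Dual ℂ (Nichols n)) :
    ofDual φ * ofDual ψ = ofDual (Nichols.conv φ ψ) := by
  change Nichols.doubleMul (φ ⊗ₜ 1) (ψ ⊗ₜ 1) = _
  rw [Nichols.doubleMul_tmul, map_one, mul_one]
  rfl

theorem ofDual_counit : ofDual (Coalgebra.counit : Module.Dual ℂ (Nichols n)) = 1 := rfl

theorem ofDual_mul_ofNichols (φ : Module.Dual ℂ (Nichols n)) (h : Nichols n) :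
    ofDual φ * ofNichols h = mk φ h := by
  change Nichols.doubleMul (φ ⊗ₜ 1) (Coalgebra.counit ⊗ₜ h) = _
  rw [Nichols.doubleMul_tmul, map_one, mul_one, Nichols.mulDual_tmul, Nichols.conv_counit]
  rfl

/-- The inclusion of `H` into its double is a homomorphism. -/
noncomputable def ofNicholsHom : Nichols n →ₐ[ℂ] DNichols n :=
  AlgHom.ofLinearMap ofNichols rfl fun h k => by
    change _ = Nichols.doubleMul (Coalgebra.counit ⊗ₜ h) (Coalgebra.counit ⊗ₜ k)
    rw [Nichols.doubleMul_tmul, Module.End.mul_apply, Nichols.mulNichols_counit,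
      Nichols.mulDual_tmul, Nichols.counit_conv]
    rfl

theorem ofNichols_mul (h k : Nichols n) : ofNichols (h * k) = ofNichols h * ofNichols k :=
  map_mul ofNicholsHom h k

theorem ofNichols_one : ofNichols (1 : Nichols n) = 1 := rfl

theorem ofNichols_mul_ofDual (h : Nichols n) (φ : Module.Dual ℂ (Nichols n)) :
    ofNichols h * ofDual φ = Nichols.mulNichols h (φ ⊗ₜ 1) := by
  change Nichols.doubleMul (Coalgebra.counit ⊗ₜ h) (φ ⊗ₜ 1) = _
  rw [Nichols.doubleMul_tmul, Module.End.mul_apply]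
  generalize Nichols.mulNichols h (φ ⊗ₜ 1) = x
  induction x with
  | zero => exact map_zero _
  | add x y hx hy => rw [map_add, hx, hy]
  | tmul φ h => rw [Nichols.mulDual_tmul, Nichols.counit_conv]

theorem K_mul_ofDual (φ : Module.Dual ℂ (Nichols n)) : K * ofDual φ =
    ofDual (φ ∘ₗ LinearMap.mulLeft ℂ Nichols.K ∘ₗ LinearMap.mulRight ℂ Nichols.K) * K := by
  rw [K, ofNichols_mul_ofDual, ofDual_mul_ofNichols, Nichols.mulNichols_K]
  simp only [Module.End.mul_apply, Nichols.actLeft_tmul, Nichols.actMul_tmul,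
    Nichols.actRight_tmul, Nichols.antipodeInv_K, mul_one, LinearMap.comp_assoc]
  rfl

theorem xi_mul_ofDual (φ : Module.Dual ℂ (Nichols n)) (i : Fin n) : xi i * ofDual φ =
    ofDual (φ ∘ₗ LinearMap.mulLeft ℂ (Nichols.K * Nichols.xi i) ∘ₗ
      LinearMap.mulRight ℂ Nichols.K) * K +
    ofDual (φ ∘ₗ LinearMap.mulRight ℂ Nichols.K) * xi i +
    ofDual (φ ∘ₗ LinearMap.mulRight ℂ (Nichols.xi i)) := by
  rw [xi, K, ofNichols_mul_ofDual, ofDual_mul_ofNichols, ofDual_mul_ofNichols,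
    Nichols.mulNichols_xi]
  simp only [LinearMap.add_apply, Module.End.mul_apply, Nichols.actLeft_tmul, Nichols.actMul_tmul,
    Nichols.actRight_tmul, Nichols.antipodeInv_xi, mul_one, LinearMap.comp_assoc]
  rfl

theorem Kbar_eq : (Kbar : DNichols n) = ofDual Nichols.kFun := by
  rw [Kbar, Nichols.coord_sub_coord]

theorem xibar_eq (i : Fin n) : (xibar i : DNichols n) = ofDual (Nichols.xFun i) := by
  rw [xibar, Nichols.coord_add_coord]

theorem wordBar_eq (T : Finset (Fin n)) : wordBar T = ofDual (Nichols.barFun T) := by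
  have : ∀ L : List (Fin n), (L.map fun i => if i ∈ T then (xibar i : DNichols n) else 1).prod =
      ofDual (Nichols.barProd T L) := fun L => by
    induction L with
    | nil => exact ofDual_counit.symm
    | cons i L ih =>
      rw [List.map_cons, List.prod_cons, ih, Nichols.barProd]
      split_ifs
      · rw [xibar_eq, ofDual_mul]
      · rw [one_mul]
  exact this _

theorem word_eq (S : Finset (Fin n)) : word S = ofNichols (Nichols.orderedProd Nichols.xi S) := by
  change _ = ofNicholsHom _
  rw [Nichols.orderedProd, map_list_prod, List.map_map, word, Nichols.orderedProd]
  congr 2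
  funext i
  simp only [Function.comp_apply]
  split_ifs
  · rfl
  · rw [map_one]

theorem ofDual_coord (a : Fin 2) (S : Finset (Fin n)) : ofDual ((Nichols.basis n).coord (a, S)) =
    (Nichols.revSign S.card / 2) • (wordBar S + (-1 : ℂ) ^ ((a : ℕ) + S.card) •
      (Kbar * wordBar S)) := by
  rw [Nichols.coord_eq, map_smul, map_add, map_smul, wordBar_eq, Kbar_eq, ofDual_mul]

theorem ofNichols_mem_adjoin {s : Set (DNichols n)} (hK : K ∈ Algebra.adjoin ℂ s)
    (hxi : ∀ i, xi i ∈ Algebra.adjoin ℂ s) (h : Nichols n) :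
    ofNichols h ∈ Algebra.adjoin ℂ s := by
  induction h using Nichols.induct with
  | hK => exact hK
  | hxi i => exact hxi i
  | halg r =>
    change ofNicholsHom _ ∈ _
    rw [AlgHom.commutes]
    exact Subalgebra.algebraMap_mem _ r
  | hadd a b ha hb => rw [map_add]; exact add_mem ha hb
  | hmul a b ha hb => rw [ofNichols_mul]; exact mul_mem ha hb

theorem ofDual_mem_adjoin {s : Set (DNichols n)} (hK : Kbar ∈ Algebra.adjoin ℂ s)
    (hxi : ∀ i, xibar i ∈ Algebra.adjoin ℂ s) (φ : Module.Dual ℂ (Nichols n)) :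
    ofDual φ ∈ Algebra.adjoin ℂ s := by
  have hw : ∀ T, wordBar T ∈ Algebra.adjoin ℂ s := fun T => by
    refine list_prod_mem fun x hx => ?_
    obtain ⟨i, -, rfl⟩ := List.mem_map.mp hx
    split_ifs
    exacts [hxi i, one_mem _]
  rw [← (Nichols.basis n).sum_dual_apply_smul_coord φ, map_sum]
  refine sum_mem fun ⟨a, S⟩ _ => ?_
  rw [map_smul, ofDual_coord]
  exact Subalgebra.smul_mem _ (Subalgebra.smul_mem _ (add_mem (hw S)
    (Subalgebra.smul_mem _ (mul_mem hK (hw S)) _)) _) _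

/-- The double of the Nichols Hopf algebra is generated by `K, K̄, ξ_i, ξ̄_i`. -/
noncomputable def gens (n : ℕ) : DoubleGens (DNichols n) n where
  K := K
  Kb := Kbar
  ξ b i := if b then xi i else xibar i
  K_mul_K := by rw [K, ← ofNichols_mul, Nichols.K_mul_K, ofNichols_one]
  Kb_mul_Kb := by rw [Kbar_eq, ofDual_mul, Nichols.conv_kFun_kFun, ofDual_counit]
  K_mul_Kb := by
    rw [Kbar_eq, K_mul_ofDual]
    congr 2
    ext x
    simp [Nichols.kFun_mul]
  K_mul_ξ b i := by
    cases b
    · simp only [Bool.false_eq_true, if_false]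
      rw [xibar_eq, K_mul_ofDual, ← neg_mul, ← map_neg]
      congr 2
      ext x
      simp [Nichols.xFun_mul, Nichols.counit_K]
    · simp only [if_true]
      rw [K, xi, ← ofNichols_mul, ← ofNichols_mul, Nichols.K_mul_xi, map_neg]
  Kb_mul_ξ b i := by
    cases b
    · simp only [Bool.false_eq_true, if_false]
      rw [xibar_eq, Kbar_eq, ofDual_mul, ofDual_mul, Nichols.conv_kFun_xFun, map_neg]
    · simp only [if_true]
      rw [Kbar_eq, xi_mul_ofDual]
      have h1 : (Nichols.kFun : Module.Dual ℂ (Nichols n)) ∘ₗ LinearMap.mulLeft ℂ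
          (Nichols.K * Nichols.xi i) ∘ₗ LinearMap.mulRight ℂ Nichols.K = 0 := by
        ext x; simp [Nichols.kFun_mul]
      have h2 : (Nichols.kFun : Module.Dual ℂ (Nichols n)) ∘ₗ LinearMap.mulRight ℂ Nichols.K =
          -Nichols.kFun := by
        ext x; simp [Nichols.kFun_mul]
      have h3 : (Nichols.kFun : Module.Dual ℂ (Nichols n)) ∘ₗ
          LinearMap.mulRight ℂ (Nichols.xi i) = 0 := by
        ext x; simp [Nichols.kFun_mul]
      rw [h1, h2, h3]
      simp
  ξ_mul_ξ b c i j hij := by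
    have hmix : ∀ i j : Fin n, i ≠ j → (xi i * xibar j : DNichols n) = -(xibar j * xi i) := by
      intro i j hij
      rw [xibar_eq, xi_mul_ofDual]
      have h1 : Nichols.xFun j ∘ₗ LinearMap.mulLeft ℂ
          (Nichols.K * Nichols.xi i) ∘ₗ LinearMap.mulRight ℂ Nichols.K = 0 := by
        ext x; simp [Nichols.xFun_mul, Nichols.xFun_xi, hij, Nichols.counit_K, Nichols.counit_xi]
      have h2 : Nichols.xFun j ∘ₗ LinearMap.mulRight ℂ Nichols.K = -Nichols.xFun j := by
        ext x; simp [Nichols.xFun_mul]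
      have h3 : Nichols.xFun j ∘ₗ LinearMap.mulRight ℂ (Nichols.xi i) = 0 := by
        ext x; simp [Nichols.xFun_mul, Nichols.xFun_xi, hij]
      rw [h1, h2, h3]
      simp
    cases b <;> cases c <;> simp only [Bool.false_eq_true, if_false, if_true]
    · rw [xibar_eq, xibar_eq, ofDual_mul, ofDual_mul, Nichols.conv_xFun_xFun, map_neg]
    · rw [hmix _ _ (Ne.symm hij), neg_neg]
    · exact hmix _ _ hij
    · rw [xi, xi, ← ofNichols_mul, ← ofNichols_mul, Nichols.xi_mul_xi, map_neg]
  ξ_sq b i := by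
    cases b <;> simp only [Bool.false_eq_true, if_false, if_true]
    · rw [xibar_eq, ofDual_mul]
      have := Nichols.conv_xFun_xFun i i
      rw [eq_neg_iff_add_eq_zero, ← two_smul ℂ, smul_eq_zero_iff_right two_ne_zero] at this
      rw [this, map_zero]
    · rw [xi, ← ofNichols_mul, Nichols.xi_mul_self, map_zero]
  ξ_anticomm i := by
    simp only [Bool.false_eq_true, if_false, if_true]
    have h1 : Nichols.xFun i ∘ₗ LinearMap.mulLeft ℂ
        (Nichols.K * Nichols.xi i) ∘ₗ LinearMap.mulRight ℂ Nichols.K = -Nichols.kFun := by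
      ext x; simp [Nichols.xFun_mul, Nichols.xFun_xi, Nichols.kFun_mul, Nichols.counit_K,
        Nichols.counit_xi]
    have h2 : Nichols.xFun i ∘ₗ LinearMap.mulRight ℂ Nichols.K = -Nichols.xFun i := by
      ext x; simp [Nichols.xFun_mul]
    have h3 : Nichols.xFun i ∘ₗ LinearMap.mulRight ℂ (Nichols.xi i) = Coalgebra.counit := by
      ext x; simp [Nichols.xFun_mul, Nichols.xFun_xi]
    have h4 : ofDual Nichols.kFun * K = (K * ofDual Nichols.kFun : DNichols n) := by
      rw [K_mul_ofDual]
      congr 2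
      ext x
      simp [Nichols.kFun_mul]
    rw [xibar_eq, Kbar_eq, xi_mul_ofDual, h1, h2, h3, ofDual_counit, map_neg, map_neg, neg_mul,
      neg_mul, h4]
    abel
  adjoin_eq_top := by
    rw [eq_top_iff]
    rintro x -
    have hK : ∀ y ∈ ({K, Kbar} ∪ Set.range fun p : Bool × Fin n =>
        (if p.1 then xi p.2 else xibar p.2 : DNichols n)), y ∈ Algebra.adjoin ℂ ({K, Kbar} ∪
        Set.range fun p : Bool × Fin n => (if p.1 then xi p.2 else xibar p.2 : DNichols n)) :=
      fun y hy => Algebra.subset_adjoin hy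
    induction x using TensorProduct.induction_on with
    | zero => exact zero_mem _
    | add x y hx hy => exact add_mem hx hy
    | tmul φ h =>
      change mk φ h ∈ _
      rw [← ofDual_mul_ofNichols]
      exact mul_mem (ofDual_mem_adjoin (hK _ (by simp)) (fun i => hK _ (Or.inr ⟨(false, i), rfl⟩))
        φ) (ofNichols_mem_adjoin (hK _ (by simp)) (fun i => hK _ (Or.inr ⟨(true, i), rfl⟩)) h)
  finrank_eq := by
    change Module.finrank ℂ (Module.Dual ℂ (Nichols n) ⊗[ℂ] Nichols n) = _
    have h : Module.finrank ℂ (Nichols n) = 2 * 2 ^ n := by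
      rw [Module.finrank_eq_card_basis (Nichols.basis n)]
      simp
    have : Module.Finite ℂ (Nichols n) := Module.Finite.of_basis (Nichols.basis n)
    rw [Module.finrank_tensorProduct, Subspace.dual_finrank_eq, h,
      show (4 : ℕ) = 2 * 2 by norm_num, mul_pow]
    ring

end DNichols

/-! ### The `R`-matrix, the ribbon element and the integral of the double -/

namespace OrderedProducts

variable {A : Type*} [Ring A] [Algebra ℂ A] {n : ℕ}

theorem orderedProd_const {A : Type*} [Monoid A] (a : A) (S : Finset (Fin n)) :
    Nichols.orderedProd (fun _ => a) S = a ^ S.card := by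
  have : ∀ L : List (Fin n), (L.map fun i => if i ∈ S then a else 1).prod =
      a ^ (L.filter (· ∈ S)).length := fun L => by
    induction L with
    | nil => simp
    | cons i L ih =>
      rw [List.map_cons, List.prod_cons, ih]
      by_cases h : i ∈ S <;> simp [h, pow_succ']
  rw [← Nichols.length_filter_finRange, ← this]
  rfl

theorem orderedProd_tmul {B : Type*} [Ring B] [Algebra ℂ B] (x : Fin n → A) (y : Fin n → B)
    (S : Finset (Fin n)) : Nichols.orderedProd (fun i => x i ⊗ₜ[ℂ] y i) S =
      Nichols.orderedProd x S ⊗ₜ Nichols.orderedProd y S := by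
  simp only [orderedProd_eq_oprod, ← oprod_tmul]
  congr 1
  funext i
  split_ifs <;> rfl

theorem orderedProd_smul (c : ℂ) (x : Fin n → A) (S : Finset (Fin n)) :
    Nichols.orderedProd (fun i => c • x i) S = c ^ S.card • Nichols.orderedProd x S := by
  have h := oprod_smul (fun i => if i ∈ S then c else 1) fun i => if i ∈ S then x i else 1
  rw [orderedProd_eq_oprod, orderedProd_eq_oprod]
  convert h using 2
  · funext i
    split_ifs <;> simp
  · simp

/-- If the factors at different sites commute up to scalars, then an ordered product of products is a
multiple of the product of the ordered products. -/
theorem exists_oprod_mul (x y : Fin n → A)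
    (h : ∀ i j, i ≠ j → ∃ t : ℂ, y i * x j = t • (x j * y i)) :
    ∃ t : ℂ, oprod (fun i => x i * y i) = t • (oprod x * oprod y) := by
  have key : ∀ L : List (Fin n), L.Nodup → ∃ t : ℂ, (L.map fun i => x i * y i).prod =
      t • ((L.map x).prod * (L.map y).prod) := fun L hL => by
    induction L with
    | nil => exact ⟨1, by simp⟩
    | cons i L ih =>
      rw [List.nodup_cons] at hL
      obtain ⟨t, ht⟩ := ih hL.2
      choose! s hs using fun j => h i j
      have hy := mul_prod_of_smul L x (y i) s fun j hj => hs j (by rintro rfl; exact hL.1 hj)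
      refine ⟨t * (L.map s).prod, ?_⟩
      simp only [List.map_cons, List.prod_cons, ht]
      rw [mul_smul, mul_smul_comm]
      congr 1
      rw [mul_assoc, ← mul_assoc (y i), hy, smul_mul_assoc, mul_smul_comm]
      simp only [mul_assoc]
  exact key _ (List.nodup_finRange n)

end OrderedProducts

namespace DNichols

variable {n : ℕ}

theorem K_pow_mul_word (a : Fin 2) (S : Finset (Fin n)) :
    ofNichols (Nichols.word (a, S)) = K ^ (a : ℕ) * word S := by
  rw [Nichols.word, ofNichols_mul, word_eq]
  congr 1
  exact map_pow ofNicholsHom _ _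

theorem K_mul_xi (i : Fin n) : K * xi i = -(xi i * K : DNichols n) := (gens n).K_mul_ξ true i

theorem R_eq (n : ℕ) : R n = (gens n).Rm := by
  have hZ : ∀ S : Finset (Fin n), Nichols.orderedProd (gens n).Z S =
      Nichols.revSign S.card • ((K ^ S.card * word S) ⊗ₜ[ℂ] wordBar S) := fun S => by
    have h1 : Nichols.orderedProd (fun i : Fin n => K * xi i) S =
        Nichols.revSign S.card • (K ^ S.card * word S) := by
      rw [orderedProd_mul (fun _ => K) xi S fun i j _ => by rw [K_mul_xi, neg_neg],
        orderedProd_const]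
      rfl
    have h2 : Nichols.orderedProd (gens n).Z S = Nichols.orderedProd (fun i : Fin n => K * xi i) S
        ⊗ₜ wordBar S := orderedProd_tmul _ _ S
    rw [h2, h1, TensorProduct.smul_tmul']
  rw [R, DoubleGens.Rm, oprod_one_add, Finset.mul_sum, Fintype.sum_prod_type_right]
  refine Finset.sum_congr rfl fun S _ => ?_
  rw [hZ, Fin.sum_univ_two, Nichols.basis_apply, Nichols.basis_apply, K_pow_mul_word,
    K_pow_mul_word, ofDual_coord, ofDual_coord,
    DoubleGens.R₀]
  have hK : (gens n).K = K := rfl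
  have hKb : (gens n).Kb = Kbar := rfl
  have hKK : K * (K * word S) = word S := by
    rw [← mul_assoc, ← hK, (gens n).K_mul_K, one_mul]
  have e1 : (1 : DNichols n ⊗[ℂ] DNichols n) = 1 ⊗ₜ 1 := rfl
  rw [hK, hKb, e1]
  simp only [smul_mul_assoc, mul_smul_comm, add_mul, sub_mul,
    Algebra.TensorProduct.tmul_mul_tmul, one_mul, Fin.val_zero, Fin.val_one, pow_zero, pow_one,
    zero_add, TensorProduct.tmul_smul, TensorProduct.tmul_add]
  rcases Nat.even_or_odd S.card with h | h
  · have hK2 : (K : DNichols n) ^ S.card = 1 := by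
      obtain ⟨k, hk⟩ := h
      rw [hk, ← two_mul, pow_mul, pow_two, ← hK, (gens n).K_mul_K, one_pow]
    rw [hK2, h.neg_one_pow, pow_add, h.neg_one_pow, one_mul]
    module
  · have hK2 : (K : DNichols n) ^ S.card = K := by
      obtain ⟨k, hk⟩ := h
      rw [hk, pow_succ, pow_mul, pow_two, ← hK, (gens n).K_mul_K, one_pow, one_mul]
    rw [hK2, h.neg_one_pow, pow_add, h.neg_one_pow, hKK]
    module

theorem xibar_mul_xi {i j : Fin n} (hij : i ≠ j) : xibar i * xi j = -(xi j * xibar i : DNichols n) :=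
  (gens n).ξ_mul_ξ false true i j hij

theorem neg_one_pow_mul_revSign (k : ℕ) :
    (-1 : ℂ) ^ k * Nichols.revSign k = (-1) ^ ((k + 1) / 2) := by
  have h2 : ∀ m : ℕ, (-1 : ℂ) ^ (2 * m) = 1 := fun m => by rw [pow_mul]; norm_num
  rw [Nichols.revSign, ← pow_add]
  rcases Nat.even_or_odd' k with ⟨m, rfl | rfl⟩
  · have h3 : 2 * m * (2 * m - 1) / 2 = m * (2 * m - 1) := by
      rw [mul_assoc, Nat.mul_div_cancel_left _ two_pos]
    rw [h3, show (2 * m + 1) / 2 = m by omega]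
    rcases m with - | m
    · simp
    · rw [show 2 * (m + 1) + (m + 1) * (2 * (m + 1) - 1) = 2 * ((m + 1) + (m + 1) * m) + (m + 1) by
        rw [show 2 * (m + 1) - 1 = 2 * m + 1 by omega]; ring, pow_add, h2, one_mul]
  · have h3 : (2 * m + 1) * (2 * m + 1 - 1) / 2 = (2 * m + 1) * m := by
      rw [Nat.add_sub_cancel, mul_left_comm, Nat.mul_div_cancel_left _ two_pos]
    rw [h3, show (2 * m + 1 + 1) / 2 = m + 1 by omega,
      show 2 * m + 1 + (2 * m + 1) * m = 2 * (m * m + m) + (m + 1) by ring, pow_add, h2, one_mul]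

theorem nu_eq (n : ℕ) : nu n = (gens n).ribbon := by
  have h : ∀ S : Finset (Fin n), Nichols.orderedProd (fun i => -(xi i * xibar i : DNichols n)) S =
      ((-1 : ℂ) ^ ((S.card + 1) / 2)) • (word S * wordBar S) := fun S => by
    have h1 : (fun i => -(xi i * xibar i : DNichols n)) =
        fun i => (-1 : ℂ) • (xi i * xibar i) := by simp
    rw [h1, orderedProd_smul, orderedProd_mul xi xibar S fun i j hij => xibar_mul_xi hij, smul_smul]
    change (_ * Nichols.revSign _) • _ = _
    rw [neg_one_pow_mul_revSign]
    rfl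
  have h2 : (oprod fun i => 1 - (gens n).ξ true i * (gens n).ξ false i) =
      oprod fun i => 1 + -(xi i * xibar i : DNichols n) := by
    simp only [← sub_eq_add_neg]; rfl
  rw [DoubleGens.ribbon, h2, oprod_one_add, nu, ← mul_smul_comm, Finset.smul_sum]
  congr 1
  refine Finset.sum_congr rfl fun S _ => ?_
  rw [h, smul_smul]
  congr 1
  ring

theorem cointegralAux_mul (φ : Module.Dual ℂ (Nichols n)) (a : Fin 2) (S : Finset (Fin n)) :
    cointegralAux n (ofDual φ * (K ^ (a : ℕ) * word S)) =
      if a = 0 ∧ S = Finset.univ then φ (Nichols.word (0, Finset.univ)) +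
        φ (Nichols.word (1, Finset.univ)) else 0 := by
  rw [← K_pow_mul_word, ofDual_mul_ofNichols]
  change φ _ * (Nichols.basis n).coord _ _ = _
  rw [← Nichols.basis_apply, Module.Basis.coord_apply, Module.Basis.repr_self,
    Finsupp.single_apply, add_mul, map_add, one_mul]
  simp [Prod.ext_iff, Nichols.word]

theorem cointegralAux_words (T S : Finset (Fin n)) (a : Fin 2) :
    cointegralAux n (wordBar T * (K ^ (a : ℕ) * word S)) =
      if a = 0 ∧ S = Finset.univ ∧ T = Finset.univ then 2 * Nichols.revSign n else 0 := by
  rw [wordBar_eq, cointegralAux_mul, Nichols.barFun_word, Nichols.barFun_word]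
  by_cases h : Finset.univ = T
  · subst h; simp [two_mul]
  · simp [h, Ne.symm h]

theorem cointegralAux_Kbar_words (T S : Finset (Fin n)) (a : Fin 2) :
    cointegralAux n (Kbar * wordBar T * (K ^ (a : ℕ) * word S)) = 0 := by
  rw [wordBar_eq, Kbar_eq, ofDual_mul, cointegralAux_mul,
    Nichols.conv_kFun_word _ (Nichols.barFun_comp_K T),
    Nichols.conv_kFun_word _ (Nichols.barFun_comp_K T), Nichols.barFun_word, Nichols.barFun_word,
    pow_add, pow_add]
  simp only [Fin.val_zero, Fin.val_one, pow_zero, pow_one]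
  ring_nf
  simp

theorem isBerezin_cointegralAux (n : ℕ) : (gens n).IsBerezin (cointegralAux n) 1 := by
  intro s a h
  set S : Finset (Fin n) := Finset.univ.filter fun i => (h i).1 with hS
  set T : Finset (Fin n) := Finset.univ.filter fun i => (h i).2 with hT
  have hfull : (h = fun _ => (true, true)) ↔ S = Finset.univ ∧ T = Finset.univ := by
    simp only [hS, hT, Finset.filter_eq_self, Finset.mem_univ, forall_const, funext_iff,
      Prod.ext_iff, forall_and]
  have hX : (gens n).X' h = oprod fun i =>
      (if i ∈ T then xibar i else 1) * (if i ∈ S then (xi i : DNichols n) else 1) := by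
    rw [DoubleGens.X']
    congr 1
    funext i
    simp only [hS, hT, Finset.mem_filter, Finset.mem_univ, true_and]
    rcases h i with ⟨_ | _, _ | _⟩ <;> simp [gens]
  obtain ⟨t, ht, htf⟩ : ∃ t : ℂ, (gens n).X' h = t • (wordBar T * word S) ∧
      ((h = fun _ => (true, true)) → t = Nichols.revSign n) := by
    by_cases hf : h = fun _ => (true, true)
    · refine ⟨Nichols.revSign n, ?_, fun _ => rfl⟩
      obtain ⟨h1, h2⟩ := hfull.mp hf
      rw [hX, h1, h2]
      simp only [Finset.mem_univ, if_true]
      rw [oprod_mul xibar xi fun i j hij => (gens n).ξ_mul_ξ true false i j hij]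
      simp [wordBar, word, orderedProd_eq_oprod, Nichols.revSign]
    · obtain ⟨t, ht⟩ := exists_oprod_mul (fun i => if i ∈ T then (xibar i : DNichols n) else 1)
        (fun i => if i ∈ S then (xi i : DNichols n) else 1) fun i j hij => by
          have h1 : (xi i * xibar j : DNichols n) = (-1 : ℂ) • (xibar j * xi i) := by
            rw [neg_one_smul]; exact (gens n).ξ_mul_ξ true false i j hij
          have h2 : ∀ x y : DNichols n, x * y = y * x → ∃ t : ℂ, x * y = t • (y * x) :=
            fun x y hxy => ⟨1, by rw [one_smul, hxy]⟩
          split_ifs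
          · exact ⟨_, h1⟩
          all_goals exact h2 _ _ (by simp)
      exact ⟨t, hX.trans ht, fun h => absurd h hf⟩
  obtain ⟨u, hKw⟩ : ∃ u : ℂ, K * wordBar T = u • (wordBar T * K : DNichols n) := by
    refine ⟨∏ i, (if i ∈ T then -1 else 1), mul_oprod_of_smul _ _ _ fun i => ?_⟩
    split_ifs
    · rw [neg_one_smul]; exact (gens n).K_mul_ξ false i
    · simp
  have hC : (gens n).C = Kbar * K := (gens n).K_mul_Kb
  have hKK : (K : DNichols n) * K = 1 := (gens n).K_mul_K
  rw [ht, mul_smul_comm, mul_smul_comm, map_smul, DoubleGens.e, smul_mul_assoc, map_smul, add_mul,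
    one_mul, smul_mul_assoc, map_add, map_smul, hC]
  have h0 := cointegralAux_words T S 0
  have h1 := cointegralAux_words T S 1
  have h0' := cointegralAux_Kbar_words T S 0
  have h1' := cointegralAux_Kbar_words T S 1
  simp only [Fin.val_zero, Fin.val_one, pow_zero, pow_one, one_mul] at h0 h1 h0' h1'
  have hr := Nichols.revSign_mul_self n
  cases a
  · have e2 : Kbar * K * (wordBar T * word S) = u • (Kbar * wordBar T * (K * word S)) := by
      rw [mul_assoc, ← mul_assoc K, hKw, smul_mul_assoc, mul_smul_comm]
      simp only [mul_assoc]
    simp only [DoubleGens.Kp_false, one_mul, true_and, hfull]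
    rw [e2, map_smul, h0, h1']
    by_cases hf : S = Finset.univ ∧ T = Finset.univ
    · rw [if_pos ⟨trivial, hf⟩, if_pos hf, htf (hfull.mpr hf)]
      simp only [smul_eq_mul]
      linear_combination hr
    · rw [if_neg fun h => hf h.2, if_neg hf]; simp
  · have e1 : K * (wordBar T * word S) = u • (wordBar T * (K * word S)) := by
      rw [← mul_assoc K, hKw, smul_mul_assoc]
      simp only [mul_assoc]
    have e2 : Kbar * K * (K * (wordBar T * word S)) = Kbar * wordBar T * word S := by
      rw [mul_assoc, ← mul_assoc K K, hKK, one_mul, mul_assoc]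
    have hK : (gens n).Kp true = K := rfl
    rw [hK, e1, ← e1, e2, e1, map_smul, h1, h0']
    simp

theorem half_smul_group_sum : (1 / 2 : ℂ) • (1 + K + Kbar + K * Kbar : DNichols n) =
    (gens n).e true * (1 + K) := by
  set D := gens n
  change _ = D.e true * (1 + D.K)
  rw [DoubleGens.e, smul_mul_assoc, sg_true, one_smul, mul_add, mul_one, add_mul, one_mul,
    D.C_mul_K]
  congr 1
  change 1 + D.K + D.Kb + D.C = _
  abel

theorem integral_eq_X' (hn : Even n) : integral n = Nichols.revSign n •
    ((gens n).e true * ((1 + K) * (gens n).X' fun _ => (true, true))) := by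
  set D := gens n
  have hxi : word Finset.univ * wordBar Finset.univ = Nichols.revSign n •
      oprod fun i => D.ξ true i * D.ξ false i := by
    rw [oprod_mul (D.ξ true) (D.ξ false) fun i j hij => D.ξ_mul_ξ false true i j hij]
    change _ = Nichols.revSign n • Nichols.revSign n • _
    rw [smul_smul, Nichols.revSign_mul_self, one_smul]
    simp only [word, wordBar, orderedProd_eq_oprod, Finset.mem_univ, if_true]
    rfl
  have h2 : D.e true * oprod (fun i => D.ξ true i * D.ξ false i) =
      D.e true * D.X' fun _ => (true, true) := by
    rw [D.e_mul_oprod_congr true _ fun i => (-1 : ℂ) • (D.ξ false i * D.ξ true i), oprod_smul]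
    · simp only [Finset.prod_const, Finset.card_univ, Fintype.card_fin, hn.neg_one_pow, one_smul]
      rfl
    · intro i
      have h3 := D.ξ_mul_ξ_not true i
      have h4 := D.ξ_mul_ξ_not' true i
      simp only [Bool.not_true, sg_true, one_smul] at h3 h4
      rw [h3, h4, neg_one_smul, mul_add, D.e_mul_e, if_neg (by simp), add_zero, mul_neg, mul_sub,
        D.e_mul_e, if_neg (by simp), zero_sub, neg_neg]
  rw [integral, ← smul_mul_assoc, half_smul_group_sum, hxi, mul_smul_comm, (D.commute_e true _).eq,
    mul_assoc, h2, ← mul_assoc, ← (D.commute_e true _).eq, mul_assoc]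

theorem cointegralAux_integral (hn : Even n) : cointegralAux n (integral n) = (-1) ^ (n / 2) := by
  have hB := isBerezin_cointegralAux n
  have h0 := hB true false fun _ => (true, true)
  have h1 := hB true true fun _ => (true, true)
  rw [integral_eq_X' hn, map_smul, add_mul, mul_add, map_add]
  have hK : (gens n).Kp true = K := rfl
  rw [DoubleGens.Kp_false] at h0
  rw [hK] at h1
  rw [h0, h1]
  simp only [and_self, if_true, Bool.true_eq_false, false_and, if_false, add_zero, smul_eq_mul,
    mul_one]
  obtain ⟨m, rfl⟩ := hn
  have := neg_one_pow_mul_revSign (m + m)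
  rwa [Even.neg_one_pow ⟨m, rfl⟩, one_mul, show (m + m + 1) / 2 = (m + m) / 2 by omega] at this

theorem isBerezin_cointegral (hn : Even n) :
    (gens n).IsBerezin (cointegral n) ((-1) ^ (n / 2)) := by
  intro s a h
  rw [cointegral, LinearMap.smul_apply, isBerezin_cointegralAux, cointegralAux_integral hn,
    ← inv_pow]
  split_ifs <;> norm_num

theorem SLM_eq (n : ℕ) : SLM n = (gens n).Smap (cointegral n) := by
  rw [SLM, R21, R_eq]
  rfl

end DNichols

/-! ### The trace map of the double -/

namespace Nichols

variable {n : ℕ}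

theorem dualDistrib_comulDual (φ : Module.Dual ℂ (Nichols n)) (x y : Nichols n) :
    TensorProduct.dualDistrib ℂ _ _ (DNichols.comulDual φ) (x ⊗ₜ y) = φ (y * x) := by
  rw [DNichols.comulDual]
  simp only [LinearMap.sum_apply, LinearMap.smulRight_apply, map_sum, map_smul,
    LinearMap.smul_apply, TensorProduct.dualDistrib_apply, LinearMap.applyₗ_apply_apply]
  conv_rhs => rw [← (basis n).sum_repr x, ← (basis n).sum_repr y, Finset.sum_mul, map_sum]
  refine Finset.sum_congr rfl fun b _ => ?_
  rw [Finset.mul_sum, map_sum]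
  refine Finset.sum_congr rfl fun c _ => ?_
  rw [smul_mul_smul_comm, map_smul, smul_eq_mul, smul_eq_mul, Module.Basis.coord_apply,
    Module.Basis.coord_apply]
  ring

theorem dualDistrib_injective :
    Function.Injective (TensorProduct.dualDistrib ℂ (Nichols n) (Nichols n)) := by
  have : Module.Finite ℂ (Nichols n) := Module.Finite.of_basis (basis n)
  exact (TensorProduct.dualDistribEquiv ℂ (Nichols n) (Nichols n)).injective

/-- The convolution product of `H* ⊗ H*`. -/
noncomputable def convTensor : Module.Dual ℂ (Nichols n) ⊗[ℂ] Module.Dual ℂ (Nichols n) →ₗ[ℂ]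
    Module.End ℂ (Module.Dual ℂ (Nichols n) ⊗[ℂ] Module.Dual ℂ (Nichols n)) :=
  TensorProduct.homTensorHomMap (.id ℂ) _ _ _ _ ∘ₗ TensorProduct.map conv conv

theorem convTensor_tmul (α β φ ψ : Module.Dual ℂ (Nichols n)) :
    convTensor (α ⊗ₜ β) (φ ⊗ₜ ψ) = conv α φ ⊗ₜ conv β ψ := rfl

theorem dualDistrib_convTensor (t u : Module.Dual ℂ (Nichols n) ⊗[ℂ] Module.Dual ℂ (Nichols n))
    (x y : Nichols n) : TensorProduct.dualDistrib ℂ _ _ (convTensor t u) (x ⊗ₜ y) =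
      LinearMap.mul' ℂ ℂ (TensorProduct.map (TensorProduct.dualDistrib ℂ _ _ t)
        (TensorProduct.dualDistrib ℂ _ _ u) (TensorProduct.tensorTensorTensorComm ℂ _ _ _ _
          (Coalgebra.comul x ⊗ₜ Coalgebra.comul y))) := by
  induction t with
  | zero => simp
  | add t t' ht ht' =>
    simp only [map_add, LinearMap.add_apply, TensorProduct.map_add_left, ht, ht']
  | tmul α β =>
    induction u with
    | zero => simp
    | add u u' hu hu' =>
      simp only [map_add, LinearMap.add_apply, TensorProduct.map_add_right, hu, hu']
    | tmul φ ψ =>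
      rw [convTensor_tmul, TensorProduct.dualDistrib_apply, conv_apply, conv_apply]
      generalize Coalgebra.comul (R := ℂ) x = p
      generalize Coalgebra.comul (R := ℂ) y = q
      induction p with
      | zero => simp
      | add p p' hp hp' => simp only [map_add, add_mul, TensorProduct.add_tmul, hp, hp']
      | tmul p₁ p₂ =>
        induction q with
        | zero => simp
        | add q q' hq hq' => simp only [map_add, mul_add, TensorProduct.tmul_add, hq, hq']
        | tmul q₁ q₂ =>
          simp only [TensorProduct.map_tmul, LinearMap.mul'_apply,
            TensorProduct.tensorTensorTensorComm_tmul, TensorProduct.dualDistrib_apply]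
          ring

/-- The comultiplication of `H*` is multiplicative. -/
theorem comulDual_conv (χ ψ : Module.Dual ℂ (Nichols n)) : DNichols.comulDual (conv χ ψ) =
    convTensor (DNichols.comulDual χ) (DNichols.comulDual ψ) := by
  refine dualDistrib_injective (TensorProduct.ext' fun x y => ?_)
  rw [dualDistrib_comulDual, dualDistrib_convTensor, conv_apply, Bialgebra.comul_mul]
  generalize Coalgebra.comul (R := ℂ) x = p
  generalize Coalgebra.comul (R := ℂ) y = q
  induction p with
  | zero => simp
  | add p p' hp hp' => simp only [map_add, mul_add, TensorProduct.add_tmul, hp, hp']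
  | tmul p₁ p₂ =>
    induction q with
    | zero => simp
    | add q q' hq hq' => simp only [map_add, add_mul, TensorProduct.tmul_add, hq, hq']
    | tmul q₁ q₂ =>
      simp only [TensorProduct.map_tmul, LinearMap.mul'_apply,
        TensorProduct.tensorTensorTensorComm_tmul, dualDistrib_comulDual,
        Algebra.TensorProduct.tmul_mul_tmul]

theorem comulDual_counit : DNichols.comulDual (Coalgebra.counit : Module.Dual ℂ (Nichols n)) =
    Coalgebra.counit ⊗ₜ Coalgebra.counit := by
  refine dualDistrib_injective (TensorProduct.ext' fun x y => ?_)
  rw [dualDistrib_comulDual, TensorProduct.dualDistrib_apply, Bialgebra.counit_mul, mul_comm]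

theorem comulDual_kFun : DNichols.comulDual (kFun : Module.Dual ℂ (Nichols n)) =
    kFun ⊗ₜ kFun := by
  refine dualDistrib_injective (TensorProduct.ext' fun x y => ?_)
  rw [dualDistrib_comulDual, TensorProduct.dualDistrib_apply, kFun_mul, mul_comm]

theorem comulDual_xFun (i : Fin n) : DNichols.comulDual (xFun i) =
    kFun ⊗ₜ xFun i + xFun i ⊗ₜ Coalgebra.counit := by
  refine dualDistrib_injective (TensorProduct.ext' fun x y => ?_)
  rw [dualDistrib_comulDual, map_add, LinearMap.add_apply, TensorProduct.dualDistrib_apply,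
    TensorProduct.dualDistrib_apply, xFun_mul]
  ring

theorem comul_antipodeInv (x : Nichols n) : Coalgebra.comul (R := ℂ) (antipodeInv x) =
    TensorProduct.map antipodeInv antipodeInv
      (TensorProduct.comm ℂ _ _ (Coalgebra.comul (R := ℂ) x)) := by
  have hmul : ∀ p q : Nichols n ⊗[ℂ] Nichols n, TensorProduct.map antipodeInv antipodeInv
      (TensorProduct.comm ℂ _ _ (p * q)) = TensorProduct.map antipodeInv antipodeInv
      (TensorProduct.comm ℂ _ _ q) * TensorProduct.map antipodeInv antipodeInv
      (TensorProduct.comm ℂ _ _ p) := by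
    intro p q
    induction p with
    | zero => simp
    | add p p' hp hp' => simp only [map_add, add_mul, mul_add, hp, hp']
    | tmul p₁ p₂ =>
      induction q with
      | zero => simp
      | add q q' hq hq' => simp only [map_add, mul_add, add_mul, hq, hq']
      | tmul q₁ q₂ => simp [antipodeInv_mul]
  induction x using induct with
  | hK => simp [comul_K, antipodeInv_K]
  | hxi i =>
    simp [comul_K, comul_xi, antipodeInv_K, antipodeInv_xi, mul_add, antipodeInv_one, K_mul_K]
    abel
  | halg r =>
    rw [antipodeInv_algebraMap, Bialgebra.comul_algebraMap,
      Algebra.TensorProduct.algebraMap_apply]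
    simp [antipodeInv_one, Algebra.algebraMap_eq_smul_one, TensorProduct.smul_tmul']
  | hadd a b ha hb => simp only [map_add, ha, hb]
  | hmul a b ha hb => rw [antipodeInv_mul, Bialgebra.comul_mul, Bialgebra.comul_mul, ha, hb, hmul]

theorem conv_comp_antipodeInv (φ ψ : Module.Dual ℂ (Nichols n)) :
    conv φ ψ ∘ₗ antipodeInv = conv (ψ ∘ₗ antipodeInv) (φ ∘ₗ antipodeInv) := by
  ext x
  rw [LinearMap.comp_apply, conv_apply, conv_apply, comul_antipodeInv]
  induction Coalgebra.comul (R := ℂ) x with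
  | zero => simp
  | add p p' hp hp' => simp only [map_add, hp, hp']
  | tmul p q => simp [mul_comm]

theorem counit_antipodeInv (x : Nichols n) :
    Coalgebra.counit (R := ℂ) (antipodeInv x) = Coalgebra.counit (R := ℂ) x := by
  induction x using induct with
  | hK => rw [antipodeInv_K]
  | hxi i => simp [antipodeInv_xi, counit_xi]
  | halg r => rw [antipodeInv_algebraMap]
  | hadd a b ha hb => simp only [map_add, ha, hb]
  | hmul a b ha hb => rw [antipodeInv_mul, Bialgebra.counit_mul, Bialgebra.counit_mul, ha, hb,
      mul_comm]

theorem kFun_antipodeInv (x : Nichols n) : kFun (antipodeInv x) = kFun x := by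
  induction x using induct with
  | hK => rw [antipodeInv_K]
  | hxi i => simp [antipodeInv_xi, kFun_mul]
  | halg r => rw [antipodeInv_algebraMap]
  | hadd a b ha hb => simp only [map_add, ha, hb]
  | hmul a b ha hb => rw [antipodeInv_mul, kFun_mul, kFun_mul, ha, hb, mul_comm]

theorem xFun_comp_antipodeInv (i : Fin n) : xFun i ∘ₗ antipodeInv = -conv kFun (xFun i) := by
  rw [← add_eq_zero_iff_eq_neg]
  refine dual_eq_zero _ ?_ ?_ ?_
  · simp [conv_one, antipodeInv_one]
  · intro y hy
    rw [LinearMap.add_apply, LinearMap.comp_apply] at hy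
    rw [LinearMap.add_apply, LinearMap.comp_apply, conv_K_mul, antipodeInv_mul, antipodeInv_K,
      kFun_comp_K, xFun_comp_K, xFun_mul, xFun_K, kFun_K, map_neg, LinearMap.neg_apply,
      LinearMap.neg_apply]
    linear_combination -hy
  · intro j y _
    rw [LinearMap.add_apply, LinearMap.comp_apply, conv_xi_mul, antipodeInv_mul, antipodeInv_xi,
      kFun_comp_K, kFun_comp_xi, xFun_mul, xFun_mul, xFun_xi, kFun_mul, kFun_xi,
      counit_antipodeInv, counit_K, xFun_K, xFun_comp_xi]
    split_ifs <;> simp [conv_kFun_kFun]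

end Nichols

namespace DNichols

open Nichols (conv convTensor kFun xFun barFun barProd antipodeInv antipodeLin antipodeLin_mul
  antipodeInv_one)

variable {n : ℕ}

/-- `h₁ ⊗ h₂` acts on the double by `x ↦ s(h₂) x h₁`. -/
noncomputable def adNichols : Nichols n ⊗[ℂ] Nichols n →ₗ[ℂ] Module.End ℂ (DNichols n) :=
  TensorProduct.lift ((LinearMap.mul ℂ (Module.End ℂ (DNichols n))).compl₁₂
    ((LinearMap.mul ℂ (DNichols n)).flip ∘ₗ ofNichols)
    (LinearMap.mul ℂ (DNichols n) ∘ₗ ofNichols ∘ₗ antipodeLin))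

theorem adNichols_tmul (h k : Nichols n) (x : DNichols n) : adNichols (h ⊗ₜ k) x =
    ofNichols (antipodeLin k) * x * ofNichols h := rfl

theorem adNichols_mul (u v : Nichols n ⊗[ℂ] Nichols n) :
    adNichols (u * v) = adNichols v * adNichols u := by
  induction u with
  | zero => simp
  | add u u' hu hu' => simp only [map_add, mul_add, add_mul, hu, hu']
  | tmul u₁ u₂ =>
    induction v with
    | zero => simp
    | add v v' hv hv' => simp only [map_add, mul_add, add_mul, hv, hv']
    | tmul v₁ v₂ =>
      ext x
      simp only [Algebra.TensorProduct.tmul_mul_tmul, Module.End.mul_apply, adNichols_tmul,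
        antipodeLin_mul, ofNichols_mul, mul_assoc]

/-- `φ₁ ⊗ φ₂` acts on the double by `x ↦ (φ₂ ∘ s⁻¹) x φ₁`. -/
noncomputable def adDual : Module.Dual ℂ (Nichols n) ⊗[ℂ] Module.Dual ℂ (Nichols n) →ₗ[ℂ]
    Module.End ℂ (DNichols n) :=
  TensorProduct.lift ((LinearMap.mul ℂ (Module.End ℂ (DNichols n))).compl₁₂
    ((LinearMap.mul ℂ (DNichols n)).flip ∘ₗ ofDual)
    (LinearMap.mul ℂ (DNichols n) ∘ₗ ofDual ∘ₗ antipodeInv.dualMap))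

theorem adDual_tmul (φ ψ : Module.Dual ℂ (Nichols n)) (x : DNichols n) : adDual (φ ⊗ₜ ψ) x =
    ofDual (ψ ∘ₗ antipodeInv) * x * ofDual φ := rfl

theorem adDual_convTensor (t u : Module.Dual ℂ (Nichols n) ⊗[ℂ] Module.Dual ℂ (Nichols n)) :
    adDual (convTensor t u) = adDual u * adDual t := by
  induction t with
  | zero => simp
  | add t t' ht ht' => simp only [map_add, mul_add, LinearMap.add_apply, ht, ht']
  | tmul α β =>
    induction u with
    | zero => simp
    | add v v' hv hv' => simp only [map_add, add_mul, hv, hv']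
    | tmul φ ψ =>
      ext x
      simp only [Nichols.convTensor_tmul, Module.End.mul_apply, adDual_tmul,
        Nichols.conv_comp_antipodeInv, ← ofDual_mul, mul_assoc]

theorem adDual_conv (φ ψ : Module.Dual ℂ (Nichols n)) : adDual (comulDual (conv φ ψ)) =
    adDual (comulDual ψ) * adDual (comulDual φ) := by
  rw [Nichols.comulDual_conv, adDual_convTensor]

theorem adDual_counit :
    adDual (comulDual (Coalgebra.counit : Module.Dual ℂ (Nichols n))) = 1 := by
  have h : (Coalgebra.counit : Module.Dual ℂ (Nichols n)) ∘ₗ antipodeInv = Coalgebra.counit :=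
    LinearMap.ext Nichols.counit_antipodeInv
  ext x
  rw [Nichols.comulDual_counit, adDual_tmul, h, ofDual_counit, one_mul, mul_one,
    Module.End.one_apply]

theorem adDual_counit_add_kFun : adDual (comulDual (Coalgebra.counit + kFun)) =
    (gens n).adGrp false := by
  have h : (kFun : Module.Dual ℂ (Nichols n)) ∘ₗ antipodeInv = kFun :=
    LinearMap.ext Nichols.kFun_antipodeInv
  rw [map_add, map_add, adDual_counit]
  ext x
  rw [Nichols.comulDual_kFun, LinearMap.add_apply, adDual_tmul, h, ← Kbar_eq, mul_assoc]
  rfl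

theorem adDual_xFun (i : Fin n) : adDual (comulDual (xFun i)) = (gens n).adξ false i := by
  ext x
  have h : (Coalgebra.counit : Module.Dual ℂ (Nichols n)) ∘ₗ antipodeInv = Coalgebra.counit :=
    LinearMap.ext Nichols.counit_antipodeInv
  rw [Nichols.comulDual_xFun, map_add, LinearMap.add_apply, adDual_tmul, adDual_tmul, h,
    Nichols.xFun_comp_antipodeInv, map_neg, ← ofDual_mul, ← Kbar_eq, ← xibar_eq, ofDual_counit,
    one_mul, neg_mul, neg_mul, mul_assoc (Kbar * xibar i), neg_add_eq_sub]
  rfl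

theorem adDual_barFun : adDual (comulDual (barFun (Finset.univ : Finset (Fin n)))) =
    ((List.finRange n).map ((gens n).adξ false)).reverse.prod := by
  have : ∀ L : List (Fin n), adDual (comulDual (barProd Finset.univ L)) =
      (L.map ((gens n).adξ false)).reverse.prod := fun L => by
    induction L with
    | nil => exact adDual_counit
    | cons i L ih =>
      rw [barProd, if_pos (Finset.mem_univ i), adDual_conv, ih, adDual_xFun]
      simp
  exact this _

theorem adNichols_one : adNichols (Coalgebra.comul (R := ℂ) (1 : Nichols n)) = 1 := by
  ext x
  have h : antipodeLin (1 : Nichols n) = 1 := by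
    simpa using Nichols.antipodeLin_algebraMap (n := n) 1
  rw [Bialgebra.comul_one, Algebra.TensorProduct.one_def, adNichols_tmul, h, ofNichols_one, one_mul,
    mul_one, Module.End.one_apply]

theorem adNichols_one_add_K : adNichols (Coalgebra.comul (R := ℂ) (1 + Nichols.K : Nichols n)) =
    (gens n).adGrp true := by
  rw [map_add, map_add, adNichols_one]
  ext x
  rw [Nichols.comul_K, LinearMap.add_apply, adNichols_tmul, Nichols.antipodeLin_K, mul_assoc]
  rfl

theorem adNichols_xi (i : Fin n) : adNichols (Coalgebra.comul (R := ℂ) (Nichols.xi i)) =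
    (gens n).adξ true i := by
  have h : antipodeLin (1 : Nichols n) = 1 := by
    simpa using Nichols.antipodeLin_algebraMap (n := n) 1
  ext x
  rw [Nichols.comul_xi, map_add, LinearMap.add_apply, adNichols_tmul, adNichols_tmul,
    Nichols.antipodeLin_xi, h, ofNichols_one, one_mul, map_neg, ofNichols_mul,
    neg_mul, neg_mul, mul_assoc (ofNichols _ * ofNichols _), neg_add_eq_sub]
  rfl

theorem adNichols_top : adNichols (Coalgebra.comul (R := ℂ)
    (Nichols.orderedProd Nichols.xi (Finset.univ : Finset (Fin n)))) =
      ((List.finRange n).map ((gens n).adξ true)).reverse.prod := by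
  have : ∀ L : List (Fin n), adNichols (Coalgebra.comul (R := ℂ) (L.map Nichols.xi).prod) =
      (L.map ((gens n).adξ true)).reverse.prod := fun L => by
    induction L with
    | nil => exact adNichols_one
    | cons i L ih =>
      rw [List.map_cons, List.prod_cons, Bialgebra.comul_mul, adNichols_mul, ih, adNichols_xi]
      simp
  simpa [Nichols.orderedProd] using this (List.finRange n)

/-- The map `x ↦ s(b) x a K⁻¹` attached to `a ⊗ b`. -/
noncomputable def adTensor : DNichols n ⊗[ℂ] DNichols n →ₗ[ℂ] Module.End ℂ (DNichols n) :=
  TensorProduct.lift (LinearMap.mk₂ ℂ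
    (fun a b : DNichols n => LinearMap.mulLeft ℂ (antipode b) ∘ₗ LinearMap.mulRight ℂ (a * K))
    (fun _ _ _ => by ext; simp [add_mul, mul_add, mul_assoc])
    (fun _ _ _ => by ext; simp [mul_assoc])
    (fun _ _ _ => by ext; simp [add_mul])
    (fun _ _ _ => by ext; simp))

/-- The adjoint action of the double is composed of those of `H` and of its dual. -/
theorem adTensor_comul (φ : Module.Dual ℂ (Nichols n)) (h : Nichols n) :
    adTensor (comul (mk φ h)) = LinearMap.mulRight ℂ K *
      adNichols (Coalgebra.comul (R := ℂ) h) * adDual (comulDual φ) := by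
  change adTensor (TensorProduct.tensorTensorTensorComm ℂ (Module.Dual ℂ (Nichols n))
    (Module.Dual ℂ (Nichols n)) (Nichols n) (Nichols n)
      (comulDual φ ⊗ₜ Coalgebra.comul (R := ℂ) h)) = _
  generalize comulDual φ = t
  generalize Coalgebra.comul (R := ℂ) h = u
  induction t with
  | zero => rw [TensorProduct.zero_tmul, map_zero, map_zero, mul_zero]; exact map_zero adTensor
  | add t t' ht ht' =>
    rw [TensorProduct.add_tmul, map_add, map_add, mul_add, ← ht, ← ht']
    exact map_add adTensor _ _
  | tmul α β =>
    induction u with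
    | zero =>
      rw [TensorProduct.tmul_zero, map_zero, map_zero, mul_zero, zero_mul]; exact map_zero adTensor
    | add u u' hu hu' =>
      rw [TensorProduct.tmul_add, map_add, map_add, mul_add, add_mul, ← hu, ← hu']
      exact map_add adTensor _ _
    | tmul h k =>
      ext x
      change ofNichols (antipodeLin k) * ofDual (β ∘ₗ antipodeInv) * (x * (mk α h * K)) =
        ofNichols (antipodeLin k) * (ofDual (β ∘ₗ antipodeInv) * x * ofDual α) * ofNichols h * K
      rw [← ofDual_mul_ofNichols]
      simp only [mul_assoc]

theorem integral_eq (hn : Even n) : integral n = (1 / 2 : ℂ) •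
    mk (conv (Coalgebra.counit + kFun) (barFun Finset.univ))
      ((1 + Nichols.K) * Nichols.orderedProd Nichols.xi Finset.univ) := by
  have hX : wordBar Finset.univ * word Finset.univ = Nichols.revSign n •
      (gens n).X' fun _ => (true, true) := by
    have h : ((gens n).X' fun _ => (true, true)) = oprod fun i => xibar i * xi i := rfl
    rw [h, oprod_mul xibar xi fun i j hij => (gens n).ξ_mul_ξ true false i j hij]
    change _ = Nichols.revSign n • Nichols.revSign n • _
    rw [smul_smul, Nichols.revSign_mul_self, one_smul]
    simp only [word, wordBar, orderedProd_eq_oprod, Finset.mem_univ, if_true]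
  have hK : (K : DNichols n) * wordBar Finset.univ = wordBar Finset.univ * K := by
    have h := mul_oprod_of_smul (xibar (n := n)) K (fun _ => -1) fun i => by
      rw [neg_one_smul]; exact (gens n).K_mul_ξ false i
    simp only [Finset.prod_const, Finset.card_univ, Fintype.card_fin, hn.neg_one_pow,
      one_smul] at h
    simpa only [wordBar, orderedProd_eq_oprod, Finset.mem_univ, if_true] using h
  have hg : (1 + Kbar) * (1 + K) = (1 + K + Kbar + K * Kbar : DNichols n) := by
    have h : (K : DNichols n) * Kbar = Kbar * K := (gens n).K_mul_Kb
    rw [h, mul_add, mul_one, add_mul, one_mul]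
    abel
  rw [integral_eq_X' hn, ← ofDual_mul_ofNichols, ← ofDual_mul, map_add, ofDual_counit, ← Kbar_eq,
    ← wordBar_eq, ofNichols_mul, map_add, ofNichols_one, ← word_eq]
  change _ = (1 / 2 : ℂ) • ((1 + Kbar) * wordBar Finset.univ * ((1 + K) * word Finset.univ))
  have h1 : (1 + Kbar) * wordBar Finset.univ * ((1 + K) * word Finset.univ) =
      (1 + Kbar) * (1 + K) * (wordBar Finset.univ * word Finset.univ : DNichols n) := by
    have h2 : wordBar Finset.univ * (1 + K) = (1 + K) * (wordBar Finset.univ : DNichols n) := by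
      rw [mul_add, add_mul, hK, mul_one, one_mul]
    rw [mul_assoc, ← mul_assoc _ (1 + K), h2]
    simp only [mul_assoc]
  rw [h1, hg, ← smul_mul_assoc (1 / 2 : ℂ), half_smul_group_sum, hX, mul_smul_comm, mul_assoc]

theorem traceMap_eq (hn : Even n) : traceMap n = (gens n).trMap := by
  change adTensor (comul (integral n)) = _
  rw [integral_eq hn, map_smul, map_smul, adTensor_comul, adDual_conv, adDual_barFun,
    Bialgebra.comul_mul, adNichols_mul, adNichols_top, adDual_counit_add_kFun, adNichols_one_add_K,
    DoubleGens.trMap]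
  simp only [mul_assoc]
  rfl

theorem higman_eq (hpos : 0 < n) (hn : Even n) : higman n =
    Submodule.span ℂ (Set.range fun j => (gens n).mono (DoubleGens.higIdx j)) := by
  rw [higman, traceMap_eq hn, DoubleGens.range_trMap _ hpos hn]

end DNichols

/-! ### The center and its two summands -/

namespace DoubleGens

variable {A : Type*} [Ring A] [Algebra ℂ A] {n : ℕ} (D : DoubleGens A n)

/-- The center is spanned by central monomials. -/
theorem center_eq : Subalgebra.toSubmodule (Subalgebra.center ℂ A) =
    Submodule.span ℂ (D.basis '' {p | CentralIdx p}) := by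
  refine le_antisymm (fun z hz => ?_) (Submodule.span_le.mpr ?_)
  · rw [Module.Basis.mem_span_image]
    intro p hp
    exact centralIdx_of_central (D := D) (z := z)
      (fun w => (((Subalgebra.mem_center_iff (R := ℂ)).mp hz) w).symm) (Finsupp.mem_support_iff.mp hp)
  · rintro _ ⟨p, hp, rfl⟩
    rw [basis_apply]
    exact (Subalgebra.mem_center_iff (R := ℂ)).mpr fun w => (D.commute_mono hp w).symm

/-- The indices of the even monomials in the sector `C = 1`. -/
def evenIdx (n : ℕ) : Set (Idx n) := {p | p.1 = true ∧ p.2.1 = false ∧ parity p.2.2 = 1}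

theorem center_eq_sup : Subalgebra.toSubmodule (Subalgebra.center ℂ A) =
    Submodule.span ℂ (Set.range fun j => D.mono (higIdx j)) ⊔
      Submodule.span ℂ (D.basis '' evenIdx n) := by
  rw [center_eq D, sup_comm, ← Submodule.span_union]
  congr 1
  ext z
  simp only [← basis_apply, Set.mem_image, Set.mem_ofPred_eq, CentralIdx, Set.mem_union,
    Set.mem_range, evenIdx]
  constructor
  · rintro ⟨p, h | ⟨j, rfl⟩, rfl⟩
    exacts [Or.inl ⟨p, h, rfl⟩, Or.inr ⟨j, rfl⟩]
  · rintro (⟨p, h, rfl⟩ | ⟨j, rfl⟩)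
    exacts [⟨p, Or.inl h, rfl⟩, ⟨_, Or.inr ⟨j, rfl⟩, rfl⟩]

theorem higIdx_injective : Function.Injective (higIdx (n := n)) := by
  intro i j h
  have h1 := congrArg Prod.fst h
  have h2 := congrArg (fun p : Idx n => p.2.1) h
  fin_cases i <;> fin_cases j <;> simp_all [higIdx]

theorem disjoint_hig_even : Disjoint (Submodule.span ℂ (Set.range fun j => D.mono (higIdx j)))
    (Submodule.span ℂ (D.basis '' evenIdx n)) := by
  have h : (Set.range fun j => D.mono (higIdx j)) = D.basis '' Set.range higIdx := by
    rw [← Set.range_comp]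
    simp only [Function.comp_def, basis_apply]
  rw [h]
  refine D.basis.linearIndependent.disjoint_span_image (Set.disjoint_left.mpr ?_)
  rintro _ ⟨j, rfl⟩ hj
  fin_cases j <;> simp [higIdx, evenIdx] at hj

end DoubleGens

namespace DNichols

variable {n : ℕ}

/-- In the sector `C = 1`, the words are the monomials up to nonzero scalars. -/
theorem exists_mono_eq_smul (S T : Finset (Fin n)) : ∃ t : ℂ,
    (gens n).mono (true, false, fun i => (decide (i ∈ S), decide (i ∈ T))) =
      t • ((1 + K * Kbar) * (word S * wordBar T)) := by
  obtain ⟨t, ht⟩ := exists_oprod_mul (fun i => if i ∈ S then (xi i : DNichols n) else 1)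
    (fun i => if i ∈ T then (xibar i : DNichols n) else 1) fun i j hij => by
      have h1 : (xibar i * xi j : DNichols n) = (-1 : ℂ) • (xi j * xibar i) := by
        rw [neg_one_smul]; exact xibar_mul_xi hij
      have h2 : ∀ x y : DNichols n, x * y = y * x → ∃ t : ℂ, x * y = t • (y * x) :=
        fun x y hxy => ⟨1, by rw [one_smul, hxy]⟩
      split_ifs
      · exact ⟨_, h1⟩
      all_goals exact h2 _ _ (by simp)
  have he : (1 + K * Kbar : DNichols n) = (2 : ℂ) • (gens n).e true := by
    rw [DoubleGens.e, smul_smul, sg_true, one_smul]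
    norm_num
    rfl
  refine ⟨t / 2, ?_⟩
  rw [he, smul_mul_assoc, smul_smul, div_mul_cancel₀ _ two_ne_zero]
  change (gens n).e true * ((gens n).Kp false * oprod _) = t • (_ * (oprod _ * oprod _))
  rw [DoubleGens.Kp_false, one_mul, ← mul_smul_comm, ← ht]
  refine (gens n).e_mul_oprod_congr true _ _ fun i => ?_
  by_cases hS : i ∈ S <;> by_cases hT : i ∈ T <;> simp only [hS, hT, decide_true, decide_false,
    if_true, if_false, mul_one, one_mul]
  · have h3 := (gens n).ξ_mul_ξ_not true i
    simp only [Bool.not_true, sg_true, one_smul] at h3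
    change _ = (gens n).e true * ((gens n).ξ true i * (gens n).ξ false i)
    rw [h3, mul_add, (gens n).e_mul_e, if_neg (by simp), add_zero]
    rfl
  · rfl
  · rfl
  · rw [DoubleGens.letter_ff, mul_one]

theorem parity_decide (S T : Finset (Fin n)) :
    parity (fun i => (decide (i ∈ S), decide (i ∈ T))) = (-1) ^ (S.card + T.card) := by
  have h : ∀ i, sgnL (decide (i ∈ S), decide (i ∈ T)) =
      (if i ∈ S then -1 else 1) * if i ∈ T then -1 else 1 := fun i => by
    by_cases hS : i ∈ S <;> by_cases hT : i ∈ T <;> simp [hS, hT, sgnL]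
  rw [parity, Finset.prod_congr rfl fun i _ => h i, Finset.prod_mul_distrib, pow_add]
  simp

theorem zLambda_eq (n : ℕ) : zLambda n =
    Submodule.span ℂ ((gens n).basis '' DoubleGens.evenIdx n) := by
  have heven : ∀ S T : Finset (Fin n), Even (S.card + T.card) ↔
      parity (fun i => (decide (i ∈ S), decide (i ∈ T))) = 1 := fun S T => by
    rw [parity_decide, neg_one_pow_eq_one_iff_even (by norm_num)]
  apply le_antisymm
  · refine Submodule.span_le.mpr ?_
    rintro _ ⟨S, T, hST, rfl⟩
    obtain ⟨t, ht⟩ := exists_mono_eq_smul S T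
    have hne := (gens n).basis.ne_zero
      (true, false, fun i => (decide (i ∈ S), decide (i ∈ T)))
    rw [DoubleGens.basis_apply, ht] at hne
    rw [SetLike.mem_coe, ← Submodule.smul_mem_iff _ (left_ne_zero_of_smul hne), ← ht,
      ← DoubleGens.basis_apply]
    exact Submodule.subset_span ⟨_, ⟨rfl, rfl, (heven S T).mp hST⟩, rfl⟩
  · refine Submodule.span_le.mpr ?_
    rintro _ ⟨⟨s, a, g⟩, ⟨rfl, rfl, hg⟩, rfl⟩
    have hgST : g = fun i => (decide (i ∈ Finset.univ.filter fun i => (g i).1),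
        decide (i ∈ Finset.univ.filter fun i => (g i).2)) := by
      funext i; simp
    obtain ⟨t, ht⟩ := exists_mono_eq_smul (Finset.univ.filter fun i => (g i).1)
      (Finset.univ.filter fun i => (g i).2)
    rw [← hgST] at ht
    rw [SetLike.mem_coe, DoubleGens.basis_apply]
    simp only at hg ⊢
    rw [ht]
    refine Submodule.smul_mem _ _ (Submodule.subset_span ⟨_, _, (heven _ _).mpr ?_, rfl⟩)
    rw [← hgST, hg]

end DNichols

/-! ### Tensor powers of the standard representation in the center -/

/-- A choice of `k` sites, and of one of the odd generators at each of the other sites. -/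
abbrev Pattern (n k : ℕ) : Type :=
  (S : {S : Finset (Fin n) // S.card = k}) × ({j : Fin n // j ∉ S.1} → Bool)

namespace Pattern

variable {n k : ℕ}

theorem card_compl {S : Finset (Fin n)} (h : S.card = k) :
    Fintype.card {j : Fin n // j ∉ S} = n - k := by
  rw [Fintype.card_subtype_compl, Fintype.card_fin, Fintype.card_coe, h]

theorem card_eq (n k : ℕ) : Fintype.card (Pattern n k) = n.choose k * 2 ^ (n - k) := by
  rw [Fintype.card_sigma]
  have h : ∀ S : {S : Finset (Fin n) // S.card = k},
      Fintype.card ({j : Fin n // j ∉ S.1} → Bool) = 2 ^ (n - k) := fun S => by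
    rw [Fintype.card_fun, card_compl S.2, Fintype.card_bool]
  rw [Finset.sum_congr rfl fun S _ => h S, Finset.sum_const, Finset.card_univ,
    Fintype.card_finset_len, Fintype.card_fin, smul_eq_mul]

/-- The numbering of the chosen sites. -/
noncomputable def idx (p : Pattern n k) : {j : Fin n // j ∈ p.1.1} ≃ Fin k :=
  Finset.equivFinOfCardEq p.1.2

/-- The letters that correspond to a pattern and to a choice of basis vectors of the standard
representation at its sites: the first basis vector stands for `γ`, the second for `1`. -/
noncomputable def letters (p : Pattern n k) (f : Fin k → Fin 2) (j : Fin n) : Letter :=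
  if hj : j ∈ p.1.1 then (f (p.idx ⟨j, hj⟩) == 0, f (p.idx ⟨j, hj⟩) == 0)
  else (p.2 ⟨j, hj⟩, !p.2 ⟨j, hj⟩)

theorem mem_support_iff (p : Pattern n k) (f : Fin k → Fin 2) (j : Fin n) :
    j ∈ p.1.1 ↔ (p.letters f j).1 = (p.letters f j).2 := by
  rw [letters]
  split_ifs with h <;> simp [h]

theorem parity_letters (p : Pattern n k) (f : Fin k → Fin 2) (hk : Even k) (hn : Even n) :
    parity (p.letters f) = 1 := by
  have h : ∀ j, sgnL (p.letters f j) = if j ∉ p.1.1 then -1 else 1 := fun j => by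
    by_cases hj : j ∈ p.1.1 <;> simp [letters, hj, sgnL]
  have hle : k ≤ n := by
    rw [← p.1.2]; exact (Finset.card_le_univ _).trans (Fintype.card_fin n).le
  have hc := card_compl p.1.2
  rw [Fintype.card_subtype] at hc
  rw [parity, Finset.prod_congr rfl fun j _ => h j, Finset.prod_ite, Finset.prod_const,
    Finset.prod_const_one, mul_one, hc]
  exact ((Nat.even_sub hle).mpr ⟨fun _ => hk, fun _ => hn⟩).neg_one_pow

/-- The pattern with a given number in the direct sum of tensor powers. -/
noncomputable def ofIndex (i : ModularRep.EvenIndex n) : Pattern n (i.1 : ℕ) :=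
  (Fintype.equivFinOfCardEq (card_eq n i.1)).symm i.2

theorem letters_injective : Function.Injective
    fun x : (i : ModularRep.EvenIndex n) × (Fin (i.1 : ℕ) → Fin 2) =>
      (ofIndex x.1).letters x.2 := by
  rintro ⟨⟨k, a⟩, f⟩ ⟨⟨k', a'⟩, f'⟩ h
  dsimp only at h
  obtain ⟨p, rfl⟩ := (Fintype.equivFinOfCardEq (card_eq n k)).surjective a
  obtain ⟨p', rfl⟩ := (Fintype.equivFinOfCardEq (card_eq n k')).surjective a'
  simp only [ofIndex, Equiv.symm_apply_apply] at h
  have hS : p.1.1 = p'.1.1 := by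
    ext j
    rw [p.mem_support_iff f, p'.mem_support_iff f', h]
  obtain rfl : k = k' := by
    apply Subtype.ext; apply Fin.ext
    rw [← p.1.2, ← p'.1.2, hS]
  obtain ⟨S, o⟩ := p
  obtain ⟨S', o'⟩ := p'
  obtain rfl : S = S' := Subtype.ext hS
  obtain rfl : o = o' := by
    funext ⟨j, hj⟩
    have := congrArg Prod.fst (congrFun h j)
    simpa [letters, hj] using this
  obtain rfl : f = f' := by
    funext x
    obtain ⟨⟨j, hj⟩, rfl⟩ := (idx ⟨S, o⟩).surjective x
    have := congrArg Prod.fst (congrFun h j)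
    simp only [letters, hj, dif_pos] at this
    have h2 : ∀ a b : Fin 2, (a == 0) = (b == 0) → a = b := by decide
    exact h2 _ _ this
  rfl

theorem exists_letters (hn : Even n) (g : Fin n → Letter) (hg : parity g = 1) :
    ∃ x : (i : ModularRep.EvenIndex n) × (Fin (i.1 : ℕ) → Fin 2),
      (ofIndex x.1).letters x.2 = g := by
  set S : Finset (Fin n) := Finset.univ.filter fun j => (g j).1 = (g j).2 with hS
  have hle : S.card ≤ n := (Finset.card_le_univ _).trans (Fintype.card_fin n).le
  have heven : Even S.card := by
    have h : ∀ j, sgnL (g j) = if j ∉ S then -1 else 1 := fun j => by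
      rw [hS]
      rcases h : g j with ⟨_ | _, _ | _⟩ <;> simp [h, sgnL]
    have hc := card_compl (rfl : S.card = S.card)
    rw [Fintype.card_subtype] at hc
    rw [parity, Finset.prod_congr rfl fun j _ => h j, Finset.prod_ite, Finset.prod_const,
      Finset.prod_const_one, mul_one, hc, neg_one_pow_eq_one_iff_even (by norm_num)] at hg
    rw [Nat.even_sub hle] at hg
    exact hg.mp hn
  let k : {k : Fin (n + 1) // Even (k : ℕ)} := ⟨⟨S.card, Nat.lt_succ_of_le hle⟩, heven⟩
  let p : Pattern n (k : ℕ) := ⟨⟨S, rfl⟩, fun j => (g j).1⟩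
  refine ⟨⟨⟨k, Fintype.equivFinOfCardEq (card_eq n k) p⟩,
    fun x => if (g (p.idx.symm x)).1 then 0 else 1⟩, ?_⟩
  funext j
  rw [ofIndex, Equiv.symm_apply_apply]
  by_cases hj : j ∈ S
  · have h2 : (g j).1 = (g j).2 := by simpa [hS] using hj
    rw [letters, dif_pos (show j ∈ p.1.1 from hj)]
    dsimp only
    rw [Equiv.symm_apply_apply]
    rcases h : g j with ⟨_ | _, _ | _⟩ <;> simp_all
  · have h2 : (g j).1 ≠ (g j).2 := by simpa [hS] using hj
    rw [letters, dif_neg (show j ∉ p.1.1 from hj)]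
    change ((g j).1, !(g j).1) = g j
    rcases h : g j with ⟨_ | _, _ | _⟩ <;> simp_all

end Pattern

namespace DoubleGens

variable {A : Type*} [Ring A] [Algebra ℂ A] {n k : ℕ} (D : DoubleGens A n)

/-- A vector of the standard representation as an element of the algebra at a site: the basis
vectors are sent to `-γ_j` and `1`. -/
noncomputable def stdElt (j : Fin n) : (Fin 2 → ℂ) →ₗ[ℂ] A :=
  (LinearMap.proj 1).smulRight (1 : A) - (LinearMap.proj 0).smulRight (D.γ j)

theorem stdElt_apply (j : Fin n) (v : Fin 2 → ℂ) : D.stdElt j v = v 1 • (1 : A) - v 0 • D.γ j := rfl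

/-- The factors of the element of the center attached to vectors at the sites of a pattern. -/
noncomputable def site (p : Pattern n k) (v : Fin k → Fin 2 → ℂ) (j : Fin n) : A :=
  if hj : j ∈ p.1.1 then D.stdElt j (v (p.idx ⟨j, hj⟩)) else D.ξ (p.2 ⟨j, hj⟩) j

theorem site_update (p : Pattern n k) (v : Fin k → Fin 2 → ℂ) (i : Fin k) (w : Fin 2 → ℂ) :
    D.site p (Function.update v i w) =
      Function.update (D.site p v) (p.idx.symm i) (D.stdElt (p.idx.symm i) w) := by
  funext j
  by_cases h : j = p.idx.symm i
  · subst h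
    rw [Function.update_self, site, dif_pos (p.idx.symm i).2, Subtype.coe_eta,
      Equiv.apply_symm_apply, Function.update_self]
  · rw [Function.update_of_ne h, site, site]
    split_ifs with hj
    · rw [Function.update_of_ne]
      rintro rfl
      exact h (by simp)
    · rfl

/-- The multilinear map that sends vectors at the sites of a pattern to a central element. -/
noncomputable def patternMap (p : Pattern n k) :
    MultilinearMap ℂ (fun _ : Fin k => Fin 2 → ℂ) A where
  toFun v := D.e true * oprod (D.site p v)
  map_update_add' := by
    intro inst v i x y
    rw [Subsingleton.elim inst (instDecidableEqFin k)]
    simp only [site_update, oprod_eq_mkPiAlgebraFin, map_add, MultilinearMap.map_update_add,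
      mul_add]
  map_update_smul' := by
    intro inst v i c x
    rw [Subsingleton.elim inst (instDecidableEqFin k)]
    simp only [site_update, oprod_eq_mkPiAlgebraFin, map_smul, MultilinearMap.map_update_smul,
      mul_smul_comm]

theorem patternMap_apply (p : Pattern n k) (v : Fin k → Fin 2 → ℂ) :
    D.patternMap p v = D.e true * oprod (D.site p v) := rfl

theorem patternMap_single (p : Pattern n k) (f : Fin k → Fin 2) :
    D.patternMap p (fun i => Pi.single (f i) 1) =
      (∏ j, swapSign (p.letters f j)) • D.mono (true, false, p.letters f) := by
  have h : D.site p (fun i => Pi.single (f i) 1) =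
      fun j => swapSign (p.letters f j) • D.letter j (p.letters f j) := by
    funext j
    rw [site, Pattern.letters]
    split_ifs with hj
    · rw [stdElt_apply]
      generalize f (p.idx ⟨j, hj⟩) = b
      fin_cases b <;> simp [swapSign]
    · cases p.2 ⟨j, hj⟩ <;> simp [swapSign]
  rw [patternMap_apply, h, oprod_smul, mul_smul_comm]
  simp [mono, X]

theorem patternMap_std_S (p : Pattern n k) (f : Fin k → Fin 2) :
    D.patternMap p (fun i => ModularRep.std ModularGroup.S (Pi.single (f i) 1)) =
      D.mono (true, false, fun j => swapL (p.letters f j)) := by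
  have h : D.site p (fun i => ModularRep.std ModularGroup.S (Pi.single (f i) 1)) =
      fun j => D.letter j (swapL (p.letters f j)) := by
    funext j
    rw [site, Pattern.letters]
    split_ifs with hj
    · rw [stdElt_apply]
      generalize f (p.idx ⟨j, hj⟩) = b
      fin_cases b <;> simp [swapL, ModularRep.std, ModularGroup.S, Matrix.mulVec, dotProduct]
    · cases p.2 ⟨j, hj⟩ <;> simp [swapL]
  rw [patternMap_apply, h]
  simp [mono, X]

theorem patternMap_std_T (p : Pattern n k) (v : Fin k → Fin 2 → ℂ) :
    D.patternMap p (fun i => ModularRep.std ModularGroup.T (v i)) =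
      D.ribbon * D.patternMap p v := by
  rw [patternMap_apply, patternMap_apply, ribbon_mul_even]
  · refine D.e_mul_oprod_congr true _ _ fun j => ?_
    rw [site, site]
    split_ifs with hj
    · rw [stdElt_apply, stdElt_apply]
      generalize v (p.idx ⟨j, hj⟩) = w
      have h1 : ModularRep.std ModularGroup.T w 0 = w 0 + w 1 := by
        simp [ModularRep.std, ModularGroup.T, Matrix.mulVec, dotProduct]
      have h2 : ModularRep.std ModularGroup.T w 1 = w 1 := by
        simp [ModularRep.std, ModularGroup.T, Matrix.mulVec, dotProduct]
      have h3 : D.e true * (D.γ j * D.γ j) = 0 := by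
        rw [γ_mul_γ, e_mul_e, if_neg (by simp)]
      rw [h1, h2]
      simp only [mul_sub, sub_mul, one_mul, mul_one, mul_smul_comm, h3]
      module
    · rw [sub_mul, one_mul, γ_mul_ξ, mul_sub, mul_smul_comm, ← mul_assoc, e_mul_e,
        if_neg (by simp)]
      simp
  · intro i j hij
    rw [site]
    split_ifs with hj
    · rw [stdElt_apply]
      exact ((Commute.one_left _).smul_left _).sub_left ((D.commute_γ_γ i j).smul_left _)
    · exact D.ξ_commute_γ _ hij

/-- The embedding of the direct sum of tensor powers into the center. -/
noncomputable def evenMap :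
    (DirectSum (ModularRep.EvenIndex n) fun i => ⨂[ℂ] _ : Fin (i.1 : ℕ), (Fin 2 → ℂ)) →ₗ[ℂ] A :=
  DirectSum.toModule ℂ _ _ fun i => PiTensorProduct.lift (D.patternMap (Pattern.ofIndex i))

theorem evenMap_lof_tprod (i : ModularRep.EvenIndex n) (v : Fin (i.1 : ℕ) → Fin 2 → ℂ) :
    D.evenMap (DirectSum.lof ℂ _ _ i (PiTensorProduct.tprod ℂ v)) =
      D.patternMap (Pattern.ofIndex i) v := by
  rw [evenMap, DirectSum.toModule_lof, PiTensorProduct.lift.tprod]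

theorem evenSum_lof_tprod (g : SL(2, ℤ)) (i : ModularRep.EvenIndex n)
    (v : Fin (i.1 : ℕ) → Fin 2 → ℂ) :
    ModularRep.evenSum n g (DirectSum.lof ℂ _ _ i (PiTensorProduct.tprod ℂ v)) =
      DirectSum.lof ℂ _ _ i (PiTensorProduct.tprod ℂ fun j => ModularRep.std g (v j)) := by
  change DirectSum.lmap (fun i : ModularRep.EvenIndex n => ModularRep.stdPow (i.1 : ℕ) g) _ = _
  rw [DirectSum.lmap_lof]
  congr 1
  exact PiTensorProduct.map_tprod _ _

theorem evenMap_T (x : DirectSum (ModularRep.EvenIndex n) fun i =>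
    ⨂[ℂ] _ : Fin (i.1 : ℕ), (Fin 2 → ℂ)) :
    D.evenMap (ModularRep.evenSum n ModularGroup.T x) = D.ribbon * D.evenMap x := by
  suffices h : D.evenMap ∘ₗ ModularRep.evenSum n ModularGroup.T =
      LinearMap.mulLeft ℂ D.ribbon ∘ₗ D.evenMap from LinearMap.congr_fun h x
  refine DirectSum.linearMap_ext _ fun i => PiTensorProduct.ext (MultilinearMap.ext fun v => ?_)
  simp only [LinearMap.compMultilinearMap_apply, LinearMap.comp_apply, LinearMap.mulLeft_apply,
    evenSum_lof_tprod, evenMap_lof_tprod, patternMap_std_T]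

theorem swapSign_mul_self (l : Letter) : swapSign l * swapSign l = 1 := by
  rw [swapSign]; split_ifs <;> norm_num

theorem evenMap_S {lam : A →ₗ[ℂ] ℂ} {c : ℂ} (hlam : D.IsBerezin lam c) (hn : Even n)
    (x : DirectSum (ModularRep.EvenIndex n) fun i => ⨂[ℂ] _ : Fin (i.1 : ℕ), (Fin 2 → ℂ)) :
    c • D.evenMap (ModularRep.evenSum n ModularGroup.S x) = D.Smap lam (D.evenMap x) := by
  suffices h : c • (D.evenMap ∘ₗ ModularRep.evenSum n ModularGroup.S) =
      D.Smap lam ∘ₗ D.evenMap from LinearMap.congr_fun h x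
  refine DirectSum.linearMap_ext _ fun i => PiTensorProduct.ext
    (Module.Basis.ext_multilinear (fun _ => Pi.basisFun ℂ (Fin 2)) fun f => ?_)
  simp only [LinearMap.compMultilinearMap_apply, LinearMap.comp_apply, LinearMap.smul_apply,
    evenSum_lof_tprod, evenMap_lof_tprod, Pi.basisFun_apply, patternMap_std_S, patternMap_single,
    map_smul]
  rw [Smap_even hlam (Pattern.parity_letters _ _ i.1.2 hn), smul_smul, mul_left_comm,
    ← Finset.prod_mul_distrib]
  simp [swapSign_mul_self]

theorem evenMap_basis (i : ModularRep.EvenIndex n) (f : Fin (i.1 : ℕ) → Fin 2) :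
    D.evenMap (DirectSum.lof ℂ _ _ i (Basis.piTensorProduct (fun _ => Pi.basisFun ℂ (Fin 2)) f)) =
      (∏ j, swapSign ((Pattern.ofIndex i).letters f j)) •
        D.basis (true, false, (Pattern.ofIndex i).letters f) := by
  rw [Basis.piTensorProduct_apply, evenMap_lof_tprod, basis_apply, ← patternMap_single]
  simp only [Pi.basisFun_apply]

theorem prod_swapSign_mul_self (g : Fin n → Letter) :
    (∏ j, swapSign (g j)) * ∏ j, swapSign (g j) = 1 := by
  rw [← Finset.prod_mul_distrib]
  exact Finset.prod_eq_one fun j _ => swapSign_mul_self _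

theorem evenMap_injective : Function.Injective D.evenMap := by
  classical
  let J := (i : ModularRep.EvenIndex n) × (Fin (i.1 : ℕ) → Fin 2)
  let b : J → DirectSum (ModularRep.EvenIndex n) fun i => ⨂[ℂ] _ : Fin (i.1 : ℕ), (Fin 2 → ℂ) :=
    fun x => DirectSum.lof ℂ _ _ x.1 (Basis.piTensorProduct (fun _ => Pi.basisFun ℂ (Fin 2)) x.2)
  let idx : J → Idx n := fun x => (true, false, (Pattern.ofIndex x.1).letters x.2)
  have hidx : Function.Injective idx := fun x y h =>
    Pattern.letters_injective (by simpa [idx] using h)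
  let left := D.basis.constr ℂ (Function.extend idx
    (fun x => (∏ j, swapSign ((Pattern.ofIndex x.1).letters x.2 j)) • b x) 0)
  have h : left ∘ₗ D.evenMap = LinearMap.id := by
    refine DirectSum.linearMap_ext _ fun i =>
      (Basis.piTensorProduct fun _ => Pi.basisFun ℂ (Fin 2)).ext fun f => ?_
    simp only [LinearMap.comp_apply, evenMap_basis, map_smul, left, Module.Basis.constr_basis,
      LinearMap.id_apply]
    rw [show ((true, false, (Pattern.ofIndex i).letters f) : Idx n) = idx ⟨i, f⟩ from rfl,
      hidx.extend_apply, smul_smul, prod_swapSign_mul_self, one_smul]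
  exact Function.LeftInverse.injective (g := left) fun x => LinearMap.congr_fun h x

theorem range_evenMap (hn : Even n) :
    LinearMap.range D.evenMap = Submodule.span ℂ (D.basis '' evenIdx n) := by
  apply le_antisymm
  · rintro _ ⟨x, rfl⟩
    induction x using DirectSum.induction_on with
    | zero => rw [map_zero]; exact zero_mem _
    | add x y hx hy => rw [map_add]; exact add_mem hx hy
    | of i x =>
      change D.evenMap (DirectSum.lof ℂ _ _ i x) ∈ _
      have hx : x ∈ Submodule.span ℂ (Set.range
          (Basis.piTensorProduct fun _ : Fin (i.1 : ℕ) => Pi.basisFun ℂ (Fin 2))) := by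
        rw [Module.Basis.span_eq]; trivial
      induction hx using Submodule.span_induction with
      | zero => rw [map_zero, map_zero]; exact zero_mem _
      | add x y _ _ hx hy => rw [map_add, map_add]; exact add_mem hx hy
      | smul c x _ hx => rw [map_smul, map_smul]; exact Submodule.smul_mem _ _ hx
      | mem x hx =>
        obtain ⟨f, rfl⟩ := hx
        rw [evenMap_basis]
        exact Submodule.smul_mem _ _ (Submodule.subset_span
          ⟨_, ⟨rfl, rfl, Pattern.parity_letters _ _ i.1.2 hn⟩, rfl⟩)
  · refine Submodule.span_le.mpr ?_
    rintro _ ⟨⟨s, a, g⟩, ⟨rfl, rfl, hg⟩, rfl⟩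
    obtain ⟨⟨i, f⟩, rfl⟩ := Pattern.exists_letters hn g hg
    refine ⟨(∏ j, swapSign ((Pattern.ofIndex i).letters f j)) •
      DirectSum.lof ℂ _ _ i (Basis.piTensorProduct (fun _ => Pi.basisFun ℂ (Fin 2)) f), ?_⟩
    rw [map_smul, evenMap_basis, smul_smul, prod_swapSign_mul_self, one_smul]

end DoubleGens

/-! ### The Higman ideal as a representation -/

namespace WeilTwo

theorem weilRepInt_apply (g : SL(2, ℤ)) : weilRepInt g =
    if ((g 1 0 : ℤ) : ZMod 2) = 0 then weilT ^ ((g 0 1 : ℤ) : ZMod 2).val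
    else weilT ^ ((g 0 0 : ℤ) : ZMod 2).val * weilS * weilT ^ ((g 1 1 : ℤ) : ZMod 2).val := rfl

theorem weilRepInt_S : weilRepInt ModularGroup.S = weilS := by
  simp [weilRepInt_apply, ModularGroup.coe_S]

theorem weilRepInt_T : weilRepInt ModularGroup.T = weilT := by
  simp [weilRepInt_apply, ModularGroup.coe_T, ZMod.val_one]

/-- An invariant function is determined by its values at `(0, 0)` and `(0, 1)`. -/
theorem invariants_ext {f g : M → ℂ} (hf : f ∈ invariants) (hg : g ∈ invariants)
    (h0 : f (0, 0) = g (0, 0)) (h1 : f (0, 1) = g (0, 1)) : f = g := by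
  rw [mem_invariants] at hf hg
  refine funext (forall_M h0 h1 ?_ ?_)
  · rw [← hf.1, ← hg.1, h1]
  · rw [← hf.2, ← hg.2, h1]

theorem N1_S (f : N1.toSubmodule) :
    (N1.toRepresentation ModularGroup.S f : M → ℂ) (0, 0) =
      -(1 / 2) * ((f : M → ℂ) (0, 0) + 3 * (f : M → ℂ) (0, 1)) ∧
    (N1.toRepresentation ModularGroup.S f : M → ℂ) (0, 1) =
      -(1 / 2) * ((f : M → ℂ) (0, 0) - (f : M → ℂ) (0, 1)) := by
  have h : (N1.toRepresentation ModularGroup.S f : M → ℂ) = weilS f := by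
    rw [← weilRepInt_S]; rfl
  have hf := (mem_invariants _).mp f.2
  rw [h, (weilS_values _).1, (weilS_values _).2.1, ← hf.1, ← hf.2]
  constructor <;> ring

theorem N1_T (f : N1.toSubmodule) :
    (N1.toRepresentation ModularGroup.T f : M → ℂ) (0, 0) = (f : M → ℂ) (0, 0) ∧
    (N1.toRepresentation ModularGroup.T f : M → ℂ) (0, 1) = -(f : M → ℂ) (0, 1) := by
  have h : (N1.toRepresentation ModularGroup.T f : M → ℂ) = weilT f := by
    rw [← weilRepInt_T]; rfl
  rw [h, (weilT_values _).1, (weilT_values _).2.1]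
  exact ⟨rfl, rfl⟩

end WeilTwo

namespace DoubleGens

open WeilTwo

variable {A : Type*} [Ring A] [Algebra ℂ A] {n : ℕ} (D : DoubleGens A n)

/-- The coefficients of the element of the Higman ideal attached to `(c, f)`. -/
noncomputable def higCoeff : (ℂ × N1.toSubmodule) →ₗ[ℂ] Fin 3 → ℂ where
  toFun x := ![(x.1 + 2 * (x.2 : M → ℂ) (0, 0)) / 3,
    (x.1 - (x.2 : M → ℂ) (0, 0)) / 3 - (x.2 : M → ℂ) (0, 1),
    (x.1 - (x.2 : M → ℂ) (0, 0)) / 3 + (x.2 : M → ℂ) (0, 1)]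
  map_add' x y := by
    ext j
    fin_cases j <;> simp <;> ring
  map_smul' c x := by
    ext j
    fin_cases j <;> simp <;> ring

theorem higCoeff_injective : Function.Injective higCoeff := by
  intro x y h
  have h0 : (x.1 + 2 * (x.2 : M → ℂ) (0, 0)) / 3 = (y.1 + 2 * (y.2 : M → ℂ) (0, 0)) / 3 :=
    congrFun h 0
  have h1 : (x.1 - (x.2 : M → ℂ) (0, 0)) / 3 - (x.2 : M → ℂ) (0, 1) =
      (y.1 - (y.2 : M → ℂ) (0, 0)) / 3 - (y.2 : M → ℂ) (0, 1) := congrFun h 1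
  have h2 : (x.1 - (x.2 : M → ℂ) (0, 0)) / 3 + (x.2 : M → ℂ) (0, 1) =
      (y.1 - (y.2 : M → ℂ) (0, 0)) / 3 + (y.2 : M → ℂ) (0, 1) := congrFun h 2
  refine Prod.ext ?_ (Subtype.ext (invariants_ext x.2.2 y.2.2 ?_ ?_))
  · linear_combination h0 + h1 + h2
  · linear_combination h0 - (h1 + h2) / 2
  · linear_combination (h2 - h1) / 2

theorem higCoeff_surjective : Function.Surjective higCoeff := by
  intro a
  let f : M → ℂ := fun x => if x = (0, 0) then a 0 - (a 1 + a 2) / 2 else (a 2 - a 1) / 2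
  have hf : f ∈ invariants := (mem_invariants f).mpr ⟨rfl, rfl⟩
  refine ⟨(a 0 + a 1 + a 2, ⟨f, hf⟩), ?_⟩
  have h0 : f (0, 0) = a 0 - (a 1 + a 2) / 2 := rfl
  have h1 : f (0, 1) = (a 2 - a 1) / 2 := rfl
  funext j
  fin_cases j
  · change (a 0 + a 1 + a 2 + 2 * f (0, 0)) / 3 = a 0
    rw [h0]; ring
  · change (a 0 + a 1 + a 2 - f (0, 0)) / 3 - f (0, 1) = a 1
    rw [h0, h1]; ring
  · change (a 0 + a 1 + a 2 - f (0, 0)) / 3 + f (0, 1) = a 2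
    rw [h0, h1]; ring

/-- The embedding of the sum of the trivial representation and `N₁` into the center. -/
noncomputable def higMap : (ℂ × N1.toSubmodule) →ₗ[ℂ] A :=
  Fintype.linearCombination ℂ (fun j => D.mono (higIdx j)) ∘ₗ higCoeff

theorem higMap_apply (x : ℂ × N1.toSubmodule) : D.higMap x = higCoeff x 0 • D.mono (higIdx 0) +
    higCoeff x 1 • D.mono (higIdx 1) + higCoeff x 2 • D.mono (higIdx 2) := by
  rw [higMap, LinearMap.comp_apply, Fintype.linearCombination_apply, Fin.sum_univ_three]

theorem higMap_injective : Function.Injective D.higMap := by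
  have h : LinearIndependent ℂ fun j => D.mono (higIdx j) := by
    simpa only [Function.comp_def, D.basis_apply] using
      D.basis.linearIndependent.comp higIdx higIdx_injective
  rw [higMap, LinearMap.coe_comp]
  exact (linearIndependent_iff_injective_fintypeLinearCombination.mp h).comp higCoeff_injective

theorem range_higMap :
    LinearMap.range D.higMap = Submodule.span ℂ (Set.range fun j => D.mono (higIdx j)) := by
  rw [higMap, LinearMap.range_comp_of_range_eq_top _ (LinearMap.range_eq_top.mpr
    higCoeff_surjective), Fintype.range_linearCombination]

theorem higMap_S {lam : A →ₗ[ℂ] ℂ} {c : ℂ} (hlam : D.IsBerezin lam c) (hn : Even n)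
    (x : ℂ × N1.toSubmodule) :
    c • D.higMap (((Representation.trivial ℂ SL(2, ℤ) ℂ).prod N1.toRepresentation)
      ModularGroup.S x) = D.Smap lam (D.higMap x) := by
  obtain ⟨z, f⟩ := x
  change c • D.higMap (z, N1.toRepresentation ModularGroup.S f) = _
  rw [higMap_apply, higMap_apply, map_add, map_add, map_smul, map_smul, map_smul,
    Smap_hig_zero hlam hn, Smap_hig_one hlam hn, Smap_hig_two hlam]
  have h0 : higCoeff (z, N1.toRepresentation ModularGroup.S f) 0 = higCoeff (z, f) 1 := by
    change (z + 2 * (N1.toRepresentation ModularGroup.S f : M → ℂ) (0, 0)) / 3 =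
      (z - (f : M → ℂ) (0, 0)) / 3 - (f : M → ℂ) (0, 1)
    rw [(N1_S f).1]; ring
  have h1 : higCoeff (z, N1.toRepresentation ModularGroup.S f) 1 = higCoeff (z, f) 0 := by
    change (z - (N1.toRepresentation ModularGroup.S f : M → ℂ) (0, 0)) / 3 -
      (N1.toRepresentation ModularGroup.S f : M → ℂ) (0, 1) = (z + 2 * (f : M → ℂ) (0, 0)) / 3
    rw [(N1_S f).1, (N1_S f).2]; ring
  have h2 : higCoeff (z, N1.toRepresentation ModularGroup.S f) 2 = higCoeff (z, f) 2 := by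
    change (z - (N1.toRepresentation ModularGroup.S f : M → ℂ) (0, 0)) / 3 +
      (N1.toRepresentation ModularGroup.S f : M → ℂ) (0, 1) =
        (z - (f : M → ℂ) (0, 0)) / 3 + (f : M → ℂ) (0, 1)
    rw [(N1_S f).1, (N1_S f).2]; ring
  rw [h0, h1, h2]
  module

theorem higMap_T (hn : Even n) (x : ℂ × N1.toSubmodule) :
    D.higMap (((Representation.trivial ℂ SL(2, ℤ) ℂ).prod N1.toRepresentation)
      ModularGroup.T x) = D.ribbon * D.higMap x := by
  obtain ⟨z, f⟩ := x
  change D.higMap (z, N1.toRepresentation ModularGroup.T f) = _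
  rw [higMap_apply, higMap_apply, mul_add, mul_add, mul_smul_comm, mul_smul_comm, mul_smul_comm,
    ribbon_mul_hig_zero, ribbon_mul_hig_one D hn, ribbon_mul_hig_two D hn]
  have h0 : higCoeff (z, N1.toRepresentation ModularGroup.T f) 0 = higCoeff (z, f) 0 := by
    change (z + 2 * (N1.toRepresentation ModularGroup.T f : M → ℂ) (0, 0)) / 3 =
      (z + 2 * (f : M → ℂ) (0, 0)) / 3
    rw [(N1_T f).1]
  have h1 : higCoeff (z, N1.toRepresentation ModularGroup.T f) 1 = higCoeff (z, f) 2 := by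
    change (z - (N1.toRepresentation ModularGroup.T f : M → ℂ) (0, 0)) / 3 -
      (N1.toRepresentation ModularGroup.T f : M → ℂ) (0, 1) =
        (z - (f : M → ℂ) (0, 0)) / 3 + (f : M → ℂ) (0, 1)
    rw [(N1_T f).1, (N1_T f).2]; ring
  have h2 : higCoeff (z, N1.toRepresentation ModularGroup.T f) 2 = higCoeff (z, f) 1 := by
    change (z - (N1.toRepresentation ModularGroup.T f : M → ℂ) (0, 0)) / 3 +
      (N1.toRepresentation ModularGroup.T f : M → ℂ) (0, 1) =
        (z - (f : M → ℂ) (0, 0)) / 3 - (f : M → ℂ) (0, 1)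
    rw [(N1_T f).1, (N1_T f).2]; ring
  rw [h0, h1, h2]
  abel

end DoubleGens

/-! ### Transport of representations -/

namespace Subrepresentation

variable {G V V₁ : Type*} [Monoid G] [AddCommMonoid V] [Module ℂ V]
  [AddCommMonoid V₁] [Module ℂ V₁]
  {ρ : Representation ℂ G V} {σ : Representation ℂ G V₁}

/-- The image of an intertwining map. -/
def ofRange (f : V₁ →ₗ[ℂ] V) (hf : ∀ g v, ρ g (f v) = f (σ g v)) : Subrepresentation ρ where
  toSubmodule := LinearMap.range f
  apply_mem_toSubmodule := by
    rintro g _ ⟨v, rfl⟩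
    exact ⟨σ g v, (hf g v).symm⟩

theorem nonempty_equiv_ofRange (f : V₁ →ₗ[ℂ] V) (hf : ∀ g v, ρ g (f v) = f (σ g v))
    (hinj : Function.Injective f) : Nonempty ((ofRange f hf).toRepresentation.Equiv σ) := by
  let e : V₁ ≃ₗ[ℂ] (ofRange f hf).toSubmodule := LinearEquiv.ofInjective f hinj
  refine ⟨Representation.Equiv.mk e.symm fun g => LinearMap.ext fun x => ?_⟩
  obtain ⟨v, rfl⟩ := e.surjective x
  apply e.injective
  change e (e.symm _) = e (σ g (e.symm (e v)))
  rw [e.apply_symm_apply, e.symm_apply_apply]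
  exact Subtype.ext (hf g v)

end Subrepresentation

theorem mainTheorem4 (n : ℕ) (hpos : 0 < n) (hn : Even n) :
    ∃ ρ : Representation ℂ SL(2, ℤ) (DNichols.center n),
      (∀ z, (ρ ModularGroup.S z : DNichols n) = (-1 : ℂ) ^ (n / 2) • DNichols.SLM n z) ∧
      (∀ z, (ρ ModularGroup.T z : DNichols n) = DNichols.TLM n z) ∧
      ∃ hig lam : Subrepresentation ρ,
        hig.toSubmodule.map (DNichols.center n).subtype = DNichols.higman n ∧
        lam.toSubmodule.map (DNichols.center n).subtype = DNichols.zLambda n ∧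
        IsCompl hig.toSubmodule lam.toSubmodule ∧
        Nonempty (hig.toRepresentation.Equiv
          ((Representation.trivial ℂ SL(2, ℤ) ℂ).prod WeilTwo.N1.toRepresentation)) ∧
        Nonempty (lam.toRepresentation.Equiv (ModularRep.evenSum n)) := by
  set D := DNichols.gens n
  let σ := (Representation.trivial ℂ SL(2, ℤ) ℂ).prod WeilTwo.N1.toRepresentation
  let τ := ModularRep.evenSum n
  let c : ℂ := (-1) ^ (n / 2)
  have hc : c * c = 1 := by rw [← mul_pow]; norm_num
  have hlam : D.IsBerezin (DNichols.cointegral n) c := DNichols.isBerezin_cointegral hn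
  have hcenter : DNichols.center n = LinearMap.range D.higMap ⊔ LinearMap.range D.evenMap := by
    rw [D.range_higMap, D.range_evenMap hn]
    exact D.center_eq_sup
  have hdisj : Disjoint (LinearMap.range D.higMap) (LinearMap.range D.evenMap) := by
    rw [D.range_higMap, D.range_evenMap hn]
    exact D.disjoint_hig_even
  let F := D.higMap.coprod D.evenMap
  have hF : LinearMap.range F = DNichols.center n := by
    rw [hcenter, LinearMap.range_coprod]
  have hFinj : Function.Injective F := by
    rintro ⟨x, y⟩ ⟨x', y'⟩ hxy
    have hxy' : D.higMap x + D.evenMap y = D.higMap x' + D.evenMap y' := hxy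
    have h : D.higMap x - D.higMap x' = D.evenMap y' - D.evenMap y := by
      rw [sub_eq_sub_iff_add_eq_add, hxy', add_comm]
    have h0 := Submodule.disjoint_def.mp hdisj _
      (Submodule.sub_mem _ (LinearMap.mem_range_self _ x) (LinearMap.mem_range_self _ x'))
      (h ▸ Submodule.sub_mem _ (LinearMap.mem_range_self _ y') (LinearMap.mem_range_self _ y))
    exact Prod.ext (D.higMap_injective (sub_eq_zero.mp h0))
      (D.evenMap_injective (sub_eq_zero.mp (h ▸ h0)).symm)
  let E : ((ℂ × WeilTwo.N1.toSubmodule) × _) ≃ₗ[ℂ] DNichols.center n :=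
    (LinearEquiv.ofInjective F hFinj).trans (LinearEquiv.ofEq _ _ hF)
  have hE : ∀ x, (E x : DNichols n) = F x := fun _ => rfl
  let ρ : Representation ℂ SL(2, ℤ) (DNichols.center n) :=
    (E.conjRingEquiv.toRingHom : _ →* _).comp (σ.prod τ)
  have hρ : ∀ g x, ρ g (E x) = E (σ.prod τ g x) := fun g x => by
    change E (σ.prod τ g (E.symm (E x))) = _
    rw [E.symm_apply_apply]
  let f : (ℂ × WeilTwo.N1.toSubmodule) →ₗ[ℂ] DNichols.center n :=
    E.toLinearMap ∘ₗ LinearMap.inl ℂ _ _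
  let h : (DirectSum (ModularRep.EvenIndex n) fun i => ⨂[ℂ] _ : Fin (i.1 : ℕ), (Fin 2 → ℂ)) →ₗ[ℂ]
      DNichols.center n :=
    E.toLinearMap ∘ₗ LinearMap.inr ℂ _ _
  have hf : ∀ g x, ρ g (f x) = f (σ g x) := fun g x => by
    refine (hρ g _).trans (congrArg E ?_)
    change (σ g x, τ g 0) = (σ g x, 0)
    rw [map_zero]
  have hh : ∀ g x, ρ g (h x) = h (τ g x) := fun g x => by
    refine (hρ g _).trans (congrArg E ?_)
    change (σ g 0, τ g x) = (0, τ g x)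
    rw [map_zero]
  refine ⟨ρ, fun z => ?_, fun z => ?_, .ofRange f hf, .ofRange h hh, ?_, ?_, ?_,
    Subrepresentation.nonempty_equiv_ofRange f hf (E.injective.comp LinearMap.inl_injective),
    Subrepresentation.nonempty_equiv_ofRange h hh (E.injective.comp LinearMap.inr_injective)⟩
  · obtain ⟨⟨x, y⟩, rfl⟩ := E.surjective z
    rw [hρ, hE, hE, DNichols.SLM_eq]
    change D.higMap (σ ModularGroup.S x) + D.evenMap (τ ModularGroup.S y) =
      c • D.Smap _ (D.higMap x + D.evenMap y)
    rw [map_add, ← D.higMap_S hlam hn, ← D.evenMap_S hlam hn, smul_add, smul_smul, smul_smul, hc,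
      one_smul, one_smul]
  · obtain ⟨⟨x, y⟩, rfl⟩ := E.surjective z
    rw [hρ, hE, hE, DNichols.TLM, DNichols.nu_eq]
    change D.higMap (σ ModularGroup.T x) + D.evenMap (τ ModularGroup.T y) =
      D.ribbon * (D.higMap x + D.evenMap y)
    rw [mul_add, ← D.higMap_T hn, ← D.evenMap_T]
  · rw [DNichols.higman_eq hpos hn, ← D.range_higMap]
    change (LinearMap.range f).map _ = _
    rw [← LinearMap.range_comp]
    congr 1
    refine LinearMap.ext fun x => ?_
    change F (x, 0) = _
    simp [F]
  · rw [DNichols.zLambda_eq, ← D.range_evenMap hn]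
    change (LinearMap.range h).map _ = _
    rw [← LinearMap.range_comp]
    congr 1
    refine LinearMap.ext fun x => ?_
    change F (0, x) = _
    simp [F]
  · change IsCompl (LinearMap.range f) (LinearMap.range h)
    rw [LinearMap.range_comp, LinearMap.range_comp]
    exact (Submodule.orderIsoMapComap E).isCompl LinearMap.isCompl_range_inl_inr
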